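/- **Setting.** Let $\mathcal S,\mathcal A$ be countable, $\mathcal P(\cdot\mid s,a)$ transition probabilities on $\mathcal S$, $r,c:\mathcal S\times\mathcal A\to[0,1]$, $b\ge 0$, $\rho$ an initial distribution and $\gamma\in[0,1)$. For a memoryless policy $\pi$ let $V_r^\pi(s)=\mathbb E[\sum_{k\ge0}\gamma^k r(s_k,a_k)\mid s_0=s]$, $Q_r^\pi(s,a)=r(s,a)+\gamma\,\mathbb E_{s'\sim\mathcal P(\cdot\mid s,a)}V_r^\pi(s')$, $J_r(\pi)=\mathbb E_{s\sim\rho}V_r^\pi(s)$, and define $V_c^\pi,Q_c^\pi,J_c$ in the same way from $c$. Let $\pi^*$ maximise $J_r$ among the policies with $J_c(\pi)\ge b$. Assume $\zeta:=\sup_\pi J_c(\pi)-b>0$ and put $U=\frac{2}{\zeta(1-\gamma)}$. Let $\phi:\mathcal S\times\mathcal A\to\mathbb R^d$ be features such that for every memoryless policy $\pi$ $$\inf_{\theta\in\mathbb R^d}\sup_{s,a}|Q_r^\pi(s,a)-\langle\theta,\phi(s,a)\rangle|\le\varepsilon_b,\qquad \inf_{\theta\in\mathbb R^d}\sup_{s,a}|Q_c^\pi(s,a)-\langle\theta,\phi(s,a)\rangle|\le\varepsilon_b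 .$$ Let $\mathcal C\subseteq\mathcal S\times\mathcal A$ be a coreset with weights $\omega$: $|\mathcal C|\le d(d+1)/2$, $\omega\ge0$, $\sum_{z\in\mathcal C}\omega(z)=1$, every $\phi(s,a)$ lies in the span of $\{\phi(z):z\in\mathcal C,\ \omega(z)>0\}$, and $\|\phi(s,a)\|_{G^\dagger}\le\sqrt d$ for all $(s,a)$, where $G=\sum_{z\in\mathcal C}\omega(z)\phi(z)\phi(z)^{\mathsf T}$ and $G^\dagger$ is its pseudoinverse. **Algorithm (Coin-Betting Politex).** Start from a policy $\pi_0$, a number $\lambda_0\in[0,U]$ and $w_0=0$, and let $m,T\ge1$. At iteration $t=0,\dots,T-1$, for each $z\in\mathcal C$ sample $m$ trajectories that start at $z$ and follow $\pi_t$, all of them independent given the earlier iterations, and let $q_{r,t}(z),q_{c,t}(z)$ be the averages of their discounted returns. Let $\hat\theta_{r,t}$ minimise $\sum_{z\in\mathcal C}\omega(z)(\langle\theta,\phi(z)\rangle-q_{r,t}(z))^2$, let $\hat Q_{r,t}(s,a)$ be $\langle\hat\theta_{r,t},\phi(s,a)\rangle$ truncated to $[0,\frac1{1-\gamma}]$,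 and define $\hat Q_{c,t}$ in the same way. Put $\hat Q_t=\hat Q_{r,t}+\lambda_t\hat Q_{c,t}$ and $g_t=\mathbb E_{s\sim\rho}\langle\pi_t(\cdot\mid s),\hat Q_{c,t}(s,\cdot)\rangle-b$. *Primal update:* let $\hat A_t(s,a)=\frac{1-\gamma}{1+U}[\hat Q_t(s,a)-\langle\hat Q_t(s,\cdot),\pi_t(\cdot\mid s)\rangle]$, and let $\tilde A_t(s,a)$ be $\hat A_t(s,a)$ if $w_t(s,a)>0$ and $[\hat A_t(s,a)]_+$ otherwise. Then $$w_{t+1}(s,a)=\frac{\sum_{i\le t}\tilde A_i(s,a)}{(t+1)+T/2}\Bigl(1+\sum_{i\le t}\tilde A_i(s,a)w_i(s,a)\Bigr),$$ and $\pi_{t+1}(a\mid s)\propto\pi_0(a\mid s)[w_{t+1}(s,a)]_+$; if the normaliser is $0$ at $s$, then $\pi_{t+1}(\cdot\mid s)=\pi_0(\cdot\mid s)$. *Dual update:* with $\sigma(x)=1/(1+e^{-x})$, $$\beta_t=(1-\gamma)\Bigl(2\,\sigma\Bigl(\tfrac{2\sum_{i\le t}g_i}{\frac1{1-\gamma}+\sum_{i\le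 t}|g_i|}\Bigr)-1\Bigr),\qquad \lambda_{t+1}=\mathbb P_{[0,U]}\Bigl[\lambda_0-\beta_t\Bigl(\tfrac1{1-\gamma}-\sum_{i\le t}(\lambda_i-\lambda_0)g_i\Bigr)\Bigr],$$ where $\mathbb P_{[0,U]}$ is the projection onto $[0,U]$. **Claim.** Let $K=\mathbb E_{s\sim\nu}\,\mathrm{KL}(\pi^*(\cdot\mid s)\,\|\,\pi_0(\cdot\mid s))<\infty$, where $\nu$ is the normalised discounted state occupancy measure of $\pi^*$ from $\rho$. For every $\delta\in(0,1)$ put $$\tilde\varepsilon=\varepsilon_b(1+\sqrt d)+\frac{\sqrt d}{1-\gamma}\sqrt{\frac{\log(2d(d+1)/\delta)}{2m}},\qquad \Psi=4U\sqrt{\log((T+1)U)}+1 .$$ Then, with probability at least $1-\delta$, the average optimality gap $\mathrm{OG}=\frac1T\sum_{t<T}[J_r(\pi^*)-J_r(\pi_t)]$ and the average constraint violation $\mathrm{CV}=\frac1T\bigl[\sum_{t<T}(b-J_c(\pi_t))\bigr]_+$ satisfy, simultaneously, $$\mathrm{OG}\le\frac{\frac{3(1+U)\sqrt{1+K}}{1-\gamma}+\Psi}{(1-\gamma)\sqrt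 T}+\frac{\tilde\varepsilon\,(2+(1+\gamma)U)}{1-\gamma},$$ $$\mathrm{CV}\le\frac{\zeta\Bigl(\frac{3(1+U)\sqrt{1+K}}{1-\gamma}+\Psi\Bigr)}{\sqrt T}+\zeta\,\tilde\varepsilon\,(2+2U).$$ Hence, for fixed $\zeta$ and $K$ and up to a factor $\sqrt{\log((T+1)U)}$, $\mathrm{OG}=O\bigl(\frac{1}{(1-\gamma)^3\sqrt T}+\frac{\tilde\varepsilon}{(1-\gamma)^2}\bigr)$ and $\mathrm{CV}=O\bigl(\frac{1}{(1-\gamma)^2\sqrt T}+\frac{\tilde\varepsilon}{1-\gamma}\bigr)$. -/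

import Mathlib

open scoped ENNReal

noncomputable section

/-- A discounted constrained Markov decision process on discrete state and action spaces:
maximise the discounted reward `r` subject to the discounted constraint reward `c` being
at least `b`. -/
structure CMDP (S A : Type*) where
  P : S → A → PMF S
  r : S → A → ℝ
  c : S → A → ℝ
  b : ℝ
  ρ : PMF S
  γ : ℝ
  γ_nonneg : 0 ≤ γ
  γ_lt_one : γ < 1
  r_mem : ∀ s a, r s a ∈ Set.Icc (0 : ℝ) 1
  c_mem : ∀ s a, c s a ∈ Set.Icc (0 : ℝ) 1

/-- A memoryless (stochastic) policy. -/
abbrev Policy (S A : Type*) := S → PMF A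

/-- Expectation of `f` under the discrete distribution `p`. -/
def PMF.expect {α : Type*} (p : PMF α) (f : α → ℝ) : ℝ := ∑' x, (p x).toReal * f x

namespace CMDP

variable {S A : Type*} (M : CMDP S A)

/-- Law of the state at time `k` when the initial state has law `μ` and `π` is followed. -/
def stateLaw (π : Policy S A) (μ : PMF S) : ℕ → PMF S
  | 0 => μ
  | k + 1 => (stateLaw π μ k).bind fun s => (π s).bind fun a => M.P s a

/-- Value function of `π` for the one-step reward `f`:
`V(s) = ∑ₖ γᵏ E[f(sₖ, aₖ) | s₀ = s]`. -/
def value (f : S → A → ℝ) (π : Policy S A) (s : S) : ℝ :=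
  ∑' k : ℕ, M.γ ^ k * (M.stateLaw π (PMF.pure s) k).expect fun s' => (π s').expect (f s')

/-- Action-value function of `π` for the one-step reward `f`. -/
def qValue (f : S → A → ℝ) (π : Policy S A) (z : S × A) : ℝ :=
  f z.1 z.2 + M.γ * (M.P z.1 z.2).expect (M.value f π)

/-- Expected discounted return of `π` from the initial distribution. -/
def ret (f : S → A → ℝ) (π : Policy S A) : ℝ := M.ρ.expect (M.value f π)

/-- Expected discounted reward of `π`. -/
def Jr (π : Policy S A) : ℝ := M.ret M.r π

/-- Expected discounted constraint reward of `π`. -/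
def Jc (π : Policy S A) : ℝ := M.ret M.c π

/-- `π` is feasible and has the largest reward value among all feasible policies. -/
def IsOptimal (π : Policy S A) : Prop :=
  M.b ≤ M.Jc π ∧ ∀ π' : Policy S A, M.b ≤ M.Jc π' → M.Jr π' ≤ M.Jr π

/-- `ζ`: the largest constraint value of a policy, minus `b`. -/
def slater : ℝ := (⨆ π : Policy S A, M.Jc π) - M.b

/-- The upper bound `U = 2 / (ζ (1 - γ))` for the dual variables. -/
def dualBound : ℝ := 2 / (M.slater * (1 - M.γ))

/-- The normalised discounted state occupancy measure of `π` started from `ρ`. -/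
def occupancy (π : Policy S A) (s : S) : ℝ≥0∞ :=
  ENNReal.ofReal (1 - M.γ) * ∑' k : ℕ, ENNReal.ofReal (M.γ ^ k) * M.stateLaw π M.ρ k s

/-- `KL(π ‖ π')`, averaged over the states visited by `π`:
the mean of `KL(π(·|s) ‖ π'(·|s))` for `s` drawn from the occupancy measure of `π`. -/
def policyKL [MeasurableSpace A] (π π' : Policy S A) : ℝ≥0∞ :=
  ∑' s, M.occupancy π s * InformationTheory.klDiv (π s).toMeasure (π' s).toMeasure

/-- Average optimality gap of the policies `π 0, …, π (T - 1)`. -/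
def optGap (πstar : Policy S A) (T : ℕ) (π : ℕ → Policy S A) : ℝ :=
  (1 / (T : ℝ)) * ∑ t ∈ Finset.range T, (M.Jr πstar - M.Jr (π t))

/-- Average constraint violation of the policies `π 0, …, π (T - 1)`. -/
def consViol (T : ℕ) (π : ℕ → Policy S A) : ℝ :=
  (1 / (T : ℝ)) * max (∑ t ∈ Finset.range T, (M.b - M.Jc (π t))) 0

/-- For every memoryless policy, the reward and constraint action-value functions are, in
sup norm, `ε`-close to the span of the features. -/
def Realizable {d : ℕ} (φ : S × A → Fin d → ℝ) (ε : ℝ) : Prop :=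
  ∀ π : Policy S A,
    (⨅ θ : Fin d → ℝ, ⨆ z : S × A, ENNReal.ofReal |M.qValue M.r π z - θ ⬝ᵥ φ z|)
        ≤ ENNReal.ofReal ε ∧
    (⨅ θ : Fin d → ℝ, ⨆ z : S × A, ENNReal.ofReal |M.qValue M.c π z - θ ⬝ᵥ φ z|)
        ≤ ENNReal.ofReal ε

end CMDP

/-- `B` is the Moore–Penrose pseudoinverse of the real matrix `A` (the four Penrose equations). -/
structure IsPseudoinverse {d : ℕ} (A B : Matrix (Fin d) (Fin d) ℝ) : Prop where
  mul_mul_left : A * B * A = A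
  mul_mul_right : B * A * B = B
  symm_left : (A * B).transpose = A * B
  symm_right : (B * A).transpose = B * A

/-- The weighted Gram matrix `∑_{z ∈ C} ω(z) φ(z) φ(z)ᵀ`. -/
def gramMatrix {Z : Type*} {d : ℕ} (φ : Z → Fin d → ℝ) (C : Finset Z) (wt : Z → ℝ) :
    Matrix (Fin d) (Fin d) ℝ :=
  ∑ z ∈ C, wt z • Matrix.vecMulVec (φ z) (φ z)

/-- `C` with the weights `wt` is a coreset for the features `φ`: at most `d (d + 1) / 2` points,
weights forming a probability distribution, and `‖φ(z)‖_{G†} ≤ √d` for all `z`, where `G` is the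
weighted Gram matrix. As `G†` does not see directions orthogonal to the range of `G`, the features
are required to lie in this range, that is, in the span of the features of positive weight. -/
structure IsCoreset {Z : Type*} {d : ℕ} (φ : Z → Fin d → ℝ) (C : Finset Z) (wt : Z → ℝ) :
    Prop where
  card_le : 2 * C.card ≤ d * (d + 1)
  wt_nonneg : ∀ z ∈ C, 0 ≤ wt z
  wt_sum : ∑ z ∈ C, wt z = 1
  mem_span : ∀ z, φ z ∈ Submodule.span ℝ (φ '' {z' | z' ∈ C ∧ 0 < wt z'})
  norm_le : ∃ Gd, IsPseudoinverse (gramMatrix φ C wt) Gd ∧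
    ∀ z, Real.sqrt (φ z ⬝ᵥ Matrix.mulVec Gd (φ z)) ≤ Real.sqrt d

/-- `θ` minimises the weighted least squares criterion for the targets `q`. -/
def IsLeastSquares {Z : Type*} {d : ℕ} (φ : Z → Fin d → ℝ) (C : Finset Z) (wt : Z → ℝ)
    (q : Z → ℝ) (θ : Fin d → ℝ) : Prop :=
  ∀ θ' : Fin d → ℝ, ∑ z ∈ C, wt z * (θ ⬝ᵥ φ z - q z) ^ 2 ≤ ∑ z ∈ C, wt z * (θ' ⬝ᵥ φ z - q z) ^ 2

namespace CMDP

variable {S A : Type*} (M : CMDP S A)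

/-- The linear estimate of an action value, truncated to the range `[0, 1 / (1 - γ)]`. -/
def qHat {d : ℕ} (φ : S × A → Fin d → ℝ) (θ : Fin d → ℝ) (s : S) (a : A) : ℝ :=
  max 0 (min (1 / (1 - M.γ)) (θ ⬝ᵥ φ (s, a)))

/-- The normalised estimated advantage of the Lagrangian reward `r + lam * c` under `π`. -/
def advHat {d : ℕ} (φ : S × A → Fin d → ℝ) (U : ℝ) (θr θc : Fin d → ℝ) (lam : ℝ)
    (π : Policy S A) (s : S) (a : A) : ℝ :=
  (1 - M.γ) / (1 + U) *
    ((M.qHat φ θr s a + lam * M.qHat φ θc s a)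
      - (π s).expect fun a' => M.qHat φ θr s a' + lam * M.qHat φ θc s a')

/-- The truncated advantage used by the bettor: unchanged if the current bet `w` is positive,
and replaced by its positive part otherwise. -/
def advTilde {d : ℕ} (φ : S × A → Fin d → ℝ) (U : ℝ) (θr θc : Fin d → ℝ) (lam : ℝ)
    (w : S → A → ℝ) (π : Policy S A) (s : S) (a : A) : ℝ :=
  if 0 < w s a then M.advHat φ U θr θc lam π s a else max (M.advHat φ U θr θc lam π s a) 0

/-- The estimated constraint value of `π`. -/
def JcHat {d : ℕ} (φ : S × A → Fin d → ℝ) (θc : Fin d → ℝ) (π : Policy S A) : ℝ :=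
  M.ρ.expect fun s => (π s).expect (M.qHat φ θc s)

/-- `T` iterations of Coin-Betting Politex, with feature map `φ`, coreset `C` with weights `wt`,
initial policy `π₀` and initial dual variable `lam₀`, fed with the estimates
`qr t`, `qc t` of the action values of the policy `π t` at the points of the coreset. -/
structure IsCBPRun {d : ℕ} (φ : S × A → Fin d → ℝ) (C : Finset (S × A)) (wt : S × A → ℝ) (T : ℕ)
    (π₀ : Policy S A) (lam₀ : ℝ) (qr qc : ℕ → S × A → ℝ)
    (θr θc : ℕ → Fin d → ℝ) (w : ℕ → S → A → ℝ) (π : ℕ → Policy S A) (lam : ℕ → ℝ) : Prop where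
  fit_r : ∀ t < T, IsLeastSquares φ C wt (qr t) (θr t)
  fit_c : ∀ t < T, IsLeastSquares φ C wt (qc t) (θc t)
  w_zero : ∀ s a, w 0 s a = 0
  π_zero : π 0 = π₀
  lam_zero : lam 0 = lam₀
  w_succ : ∀ t < T, ∀ s a, w (t + 1) s a =
    (∑ i ∈ Finset.range (t + 1),
        M.advTilde φ M.dualBound (θr i) (θc i) (lam i) (w i) (π i) s a)
      / (((t : ℝ) + 1) + (T : ℝ) / 2)
      * (1 + ∑ i ∈ Finset.range (t + 1),
        M.advTilde φ M.dualBound (θr i) (θc i) (lam i) (w i) (π i) s a * w i s a)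
  π_succ_of_eq_zero : ∀ t < T, ∀ s,
    ∑' a', π₀ s a' * ENNReal.ofReal (w (t + 1) s a') = 0 → π (t + 1) s = π₀ s
  π_succ_of_ne_zero : ∀ t < T, ∀ s,
    ∑' a', π₀ s a' * ENNReal.ofReal (w (t + 1) s a') ≠ 0 →
      ∀ a, π (t + 1) s a =
        π₀ s a * ENNReal.ofReal (w (t + 1) s a)
          / ∑' a', π₀ s a' * ENNReal.ofReal (w (t + 1) s a')
  lam_succ : ∀ t < T, lam (t + 1) =
    max 0 (min M.dualBound
      (lam₀ -
        (1 - M.γ) *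
          (2 * Real.sigmoid
            (2 * (∑ i ∈ Finset.range (t + 1), (M.JcHat φ (θc i) (π i) - M.b))
              / (1 / (1 - M.γ) + ∑ i ∈ Finset.range (t + 1), |M.JcHat φ (θc i) (π i) - M.b|))
            - 1) *
        (1 / (1 - M.γ)
          - ∑ i ∈ Finset.range (t + 1), (lam i - lam₀) * (M.JcHat φ (θc i) (π i) - M.b))))

open Classical in
/-- Probability that a trajectory that starts from the state-action pair `z` and follows `π`
agrees with `h` at the times `0, …, n`. -/
def prefixProb (π : Policy S A) (z : S × A) (n : ℕ) (h : ℕ → S × A) : ℝ≥0∞ :=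
  (if h 0 = z then 1 else 0) *
    ∏ k ∈ Finset.range n, M.P (h k).1 (h k).2 (h (k + 1)).1 * π (h (k + 1)).1 (h (k + 1)).2

/-- The empirical mean over `m` trajectories of the discounted return for the one-step
reward `f`. -/
def mcReturn (f : S → A → ℝ) {m : ℕ} (x : Fin m → ℕ → S × A) : ℝ :=
  (1 / (m : ℝ)) * ∑ j, ∑' k : ℕ, M.γ ^ k * f (x j k).1 (x j k).2

end CMDP

/-- The σ-algebra generated by the trajectories sampled before iteration `t`. -/
abbrev pastTrajectories {S A Ω : Type*} [MeasurableSpace S] [MeasurableSpace A]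
    (C : Finset (S × A)) {m : ℕ} (X : ℕ → S × A → Fin m → ℕ → Ω → S × A) (t : ℕ) :
    MeasurableSpace Ω :=
  ⨆ (i : ℕ) (_ : i < t) (z : S × A) (_ : z ∈ C) (j : Fin m) (k : ℕ),
    MeasurableSpace.comap (X i z j k) inferInstance

/-- `X t z j` is the `j`-th trajectory sampled from `z ∈ C` at iteration `t`. Given the
trajectories of the earlier iterations, those of iteration `t` are independent, and each is a
trajectory of the Markov decision process that starts from `z` and follows `π t`. -/
structure IsRollout {S A Ω : Type*} [MeasurableSpace S] [MeasurableSpace A] [MeasurableSpace Ω]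
    (μ : MeasureTheory.Measure Ω) (M : CMDP S A) (C : Finset (S × A)) {m : ℕ} (T : ℕ)
    (X : ℕ → S × A → Fin m → ℕ → Ω → S × A) (π : ℕ → Ω → Policy S A) : Prop where
  measurable : ∀ t < T, ∀ z ∈ C, ∀ j k, Measurable (X t z j k)
  law : ∀ t < T, ∀ E : Set Ω, @MeasurableSet Ω (pastTrajectories C X t) E →
    ∀ (n : ℕ) (h : S × A → Fin m → ℕ → S × A),
      μ (E ∩ {ω | ∀ z ∈ C, ∀ j, ∀ k ≤ n, X t z j k ω = h z j k}) =
        ∫⁻ ω in E, ∏ z ∈ C, ∏ j, M.prefixProb (π t ω) z n (h z j) ∂μ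

/-- The function approximation and sampling error level `ε̃`. -/
def approxError (εb : ℝ) (d m : ℕ) (γ δ : ℝ) : ℝ :=
  εb * (1 + Real.sqrt d)
    + Real.sqrt d / (1 - γ) * Real.sqrt (Real.log (2 * d * (d + 1) / δ) / (2 * m))

/-- `Ψ = 4 U √(log ((T + 1) U)) + 1`. -/
def dualRegretConst (U : ℝ) (T : ℕ) : ℝ :=
  4 * U * Real.sqrt (Real.log (((T : ℝ) + 1) * U)) + 1

end

/-! The proof is a Lagrangian regret analysis. For a multiplier `x ≥ 0`, the performance difference
lemma splits `J_r(π*) - J_r(π_t) + x (b - J_c(π_t))` into a primal regret, the dual term `(λ_t - x)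
g_t` and estimation errors (`lagrangian_gap_le`). Summed over `t`, the choice `x = 0` bounds OG. The
choice `x = U` bounds OG plus `U` times the violation. The gap cannot be too negative: by
`avg_Jr_sub_le` an average violation `v` buys a reward excess of at most `v / (ζ (1 - γ))`. Since
`U` is twice this slope, the violation itself is bounded. Convexity of the set of occupancy measures
(`exists_mixture`) takes the place of strong duality.

Primal regret: for every state and action a bettor bets on the estimated advantages. A shifted
logarithmic potential shows that a coin sum `S` forces wealth at least `exp (S² / (9T/2) - 2)`
(`exp_le_wealth`). Averaged under `π₀` the wealth is at most `1`, because `π_t ∝ π₀ [w_t]₊` makes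
the centred advantages orthogonal to the positive bets. The Donsker-Varadhan inequality transfers
this to `π*` at the price of the relative entropy (`expect_sq_sum_coin_le`).

Dual regret: `2 σ(2z) - 1 = tanh z`, so `λ_t - λ_0` is the bet of a bettor with fraction `tanh (x /
D)`, clipped to `[-λ_0, U - λ_0]`. Without clipping, its wealth dominates `exp (x² / (2D)) / D²`.
Clipping can break this invariant; `Capped` remembers where the clipping began, and
`Capped.expPotential_le` shows that domination is restored once the clipping ends.

Estimation: least squares on the coreset amplifies sup-norm errors by `√d`. Only the sum of the
errors over the iterations enters the regret, so `exists_error_bound` applies a Chernoff bound to a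
product over iterations instead of a union bound, and no `log T` appears. The product is integrated
factor by factor, conditioning on the past (`IsRollout.lintegral_block`); this requires `π_t` to be
measurable in the past (`IsCBPRun.measurable`). -/

noncomputable section

/-! ### Expectations of bounded functions under discrete distributions. -/

namespace PMF

variable {α β : Type*}

lemma hasSum_toReal (p : PMF α) : HasSum (fun x => (p x).toReal) 1 := by
  have h := p.tsum_coe
  have hs : Summable fun x => (p x).toReal := ENNReal.summable_toReal (by simp [h])
  have h2 : (∑' x, p x).toReal = ∑' x, (p x).toReal :=
    ENNReal.tsum_toReal_eq fun x => p.apply_ne_top x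
  rw [h, ENNReal.toReal_one] at h2
  rw [h2]
  exact hs.hasSum

lemma summable_expect (p : PMF α) {f : α → ℝ} {B : ℝ} (hf : ∀ x, |f x| ≤ B) :
    Summable fun x => (p x).toReal * f x := by
  refine Summable.of_norm_bounded (p.hasSum_toReal.summable.mul_right B) fun x => ?_
  rw [Real.norm_eq_abs, abs_mul, abs_of_nonneg ENNReal.toReal_nonneg]
  exact mul_le_mul_of_nonneg_left (hf x) ENNReal.toReal_nonneg

lemma expect_const (p : PMF α) (c : ℝ) : p.expect (fun _ => c) = c := by
  simp only [expect, tsum_mul_right, p.hasSum_toReal.tsum_eq, one_mul]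

lemma expect_add (p : PMF α) {f g : α → ℝ} {B B' : ℝ} (hf : ∀ x, |f x| ≤ B)
    (hg : ∀ x, |g x| ≤ B') : p.expect (fun x => f x + g x) = p.expect f + p.expect g := by
  simp only [expect, mul_add]
  exact (p.summable_expect hf).tsum_add (p.summable_expect hg)

lemma expect_sub (p : PMF α) {f g : α → ℝ} {B B' : ℝ} (hf : ∀ x, |f x| ≤ B)
    (hg : ∀ x, |g x| ≤ B') : p.expect (fun x => f x - g x) = p.expect f - p.expect g := by
  simp only [expect, mul_sub]
  exact (p.summable_expect hf).tsum_sub (p.summable_expect hg)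

lemma expect_mul_left (p : PMF α) (c : ℝ) (f : α → ℝ) :
    p.expect (fun x => c * f x) = c * p.expect f := by
  simp only [expect, mul_left_comm _ c, tsum_mul_left]

lemma expect_sum (p : PMF α) {ι : Type*} (s : Finset ι) {f : ι → α → ℝ} {B : ι → ℝ}
    (hf : ∀ i ∈ s, ∀ x, |f i x| ≤ B i) :
    p.expect (fun x => ∑ i ∈ s, f i x) = ∑ i ∈ s, p.expect (f i) := by
  simp only [expect, Finset.mul_sum]
  exact Summable.tsum_finsetSum fun i hi => p.summable_expect (hf i hi)

lemma expect_mono (p : PMF α) {f g : α → ℝ} {B B' : ℝ} (hf : ∀ x, |f x| ≤ B)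
    (hg : ∀ x, |g x| ≤ B') (h : ∀ x, f x ≤ g x) : p.expect f ≤ p.expect g :=
  Summable.tsum_le_tsum (fun x => mul_le_mul_of_nonneg_left (h x) ENNReal.toReal_nonneg)
    (p.summable_expect hf) (p.summable_expect hg)

lemma expect_nonneg (p : PMF α) {f : α → ℝ} (hf : ∀ x, 0 ≤ f x) : 0 ≤ p.expect f :=
  tsum_nonneg fun x => mul_nonneg ENNReal.toReal_nonneg (hf x)

lemma abs_expect_le (p : PMF α) {f : α → ℝ} {B : ℝ} (hf : ∀ x, |f x| ≤ B) :
    |p.expect f| ≤ B := by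
  have hB : ∀ _ : α, |B| ≤ |B| := fun _ => le_rfl
  have hB' : ∀ _ : α, |-B| ≤ |-B| := fun _ => le_rfl
  refine abs_le.2 ⟨?_, ?_⟩
  · simpa [expect_const] using p.expect_mono hB' hf fun x => (abs_le.1 (hf x)).1
  · simpa [expect_const] using p.expect_mono hf hB fun x => (abs_le.1 (hf x)).2

lemma expect_mem_Icc (p : PMF α) {f : α → ℝ} {B : ℝ} (hf : ∀ x, f x ∈ Set.Icc 0 B) :
    p.expect f ∈ Set.Icc 0 B := by
  have h : ∀ x, |f x| ≤ B := fun x => by rw [abs_of_nonneg (hf x).1]; exact (hf x).2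
  exact ⟨p.expect_nonneg fun x => (hf x).1, (abs_le.1 (p.abs_expect_le h)).2⟩

lemma abs_expect_sub_le (p : PMF α) {f g : α → ℝ} {B B' e : ℝ} (hf : ∀ x, |f x| ≤ B)
    (hg : ∀ x, |g x| ≤ B') (h : ∀ x, |f x - g x| ≤ e) : |p.expect f - p.expect g| ≤ e := by
  rw [← p.expect_sub hf hg]
  exact p.abs_expect_le h

lemma expect_pure (a : α) (f : α → ℝ) : (PMF.pure a).expect f = f a := by
  classical
  rw [expect, tsum_eq_single a]
  · simp
  · intro b hb
    simp [hb]

lemma ofReal_expect (p : PMF α) {f : α → ℝ} {B : ℝ} (hf : ∀ x, f x ∈ Set.Icc 0 B) :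
    ENNReal.ofReal (p.expect f) = ∑' x, p x * ENNReal.ofReal (f x) := by
  have h : ∀ x, |f x| ≤ B := fun x => by rw [abs_of_nonneg (hf x).1]; exact (hf x).2
  rw [expect, ENNReal.ofReal_tsum_of_nonneg
    (fun x => mul_nonneg ENNReal.toReal_nonneg (hf x).1) (p.summable_expect h)]
  refine tsum_congr fun x => ?_
  rw [ENNReal.ofReal_mul ENNReal.toReal_nonneg, ENNReal.ofReal_toReal (p.apply_ne_top x)]

lemma expect_bind (p : PMF α) (q : α → PMF β) {f : β → ℝ} {B : ℝ} (hf : ∀ x, |f x| ≤ B) :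
    (p.bind q).expect f = p.expect fun x => (q x).expect f := by
  -- For nonnegative functions both sides are double series in `ℝ≥0∞`, whose order is free; adding
  -- the constant `B` reduces the bounded case to this one.
  have key : ∀ {g : β → ℝ} {B : ℝ}, (∀ x, g x ∈ Set.Icc 0 B) →
      (p.bind q).expect g = p.expect fun x => (q x).expect g := by
    intro g B hg
    have h1 := (p.bind q).ofReal_expect hg
    have h2 := p.ofReal_expect fun x => (q x).expect_mem_Icc hg
    have h3 : ENNReal.ofReal ((p.bind q).expect g)
        = ENNReal.ofReal (p.expect fun x => (q x).expect g) := by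
      rw [h1, h2]
      simp only [PMF.bind_apply, (q _).ofReal_expect hg, ← ENNReal.tsum_mul_left,
        ← ENNReal.tsum_mul_right, mul_assoc]
      exact ENNReal.tsum_comm
    rwa [ENNReal.ofReal_eq_ofReal_iff ((p.bind q).expect_mem_Icc hg).1
      (p.expect_mem_Icc fun x => (q x).expect_mem_Icc hg).1] at h3
  have hg : ∀ x, f x + B ∈ Set.Icc 0 (2 * B) := fun x => by
    have := abs_le.1 (hf x); constructor <;> linarith [this.1, this.2]
  have hB : ∀ _ : β, |B| ≤ |B| := fun _ => le_rfl
  have hB' : ∀ _ : α, |B| ≤ |B| := fun _ => le_rfl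
  have h := key hg
  have h1 : ∀ r : PMF β, r.expect (fun x => f x + B) = r.expect f + B := fun r => by
    rw [r.expect_add hf hB, r.expect_const]
  simp only [h1] at h
  rw [p.expect_add (fun x => (q x).abs_expect_le hf) hB', p.expect_const] at h
  linarith

lemma expect_fintype [Fintype α] (p : PMF α) (f : α → ℝ) :
    p.expect f = ∑ x, (p x).toReal * f x := tsum_fintype _

lemma expect_eq_zero_of_forall (p : PMF α) {f : α → ℝ} (h : ∀ x, p x = 0 ∨ f x = 0) :
    p.expect f = 0 := by
  rw [expect, ← tsum_zero (α := ℝ) (β := α)]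
  refine tsum_congr fun x => ?_
  rcases h x with h | h <;> simp [h]

end PMF

/-! ### Exchange of expectations, state-action laws and geometric discounting. -/

namespace PMF

variable {α β : Type*}

/-- Fubini follows from commutativity of `bind` for the law of the pair, with no separate
summability argument. -/
lemma expect_comm (p : PMF α) (q : PMF β) {F : α → β → ℝ} {B : ℝ} (hF : ∀ x y, |F x y| ≤ B) :
    p.expect (fun x => q.expect (F x)) = q.expect fun y => p.expect fun x => F x y := by
  have h := congrArg (fun r : PMF (α × β) => r.expect fun z => F z.1 z.2)
    (PMF.bind_comm p q fun a b => PMF.pure (a, b))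
  have hF' : ∀ z : α × β, |F z.1 z.2| ≤ B := fun z => hF _ _
  simpa only [expect_bind _ _ hF', expect_pure] using h

/-- The law of a state-action pair whose state has law `ν` and whose action follows `π`. -/
def joint (ν : PMF α) (π : α → PMF β) : PMF (α × β) :=
  ν.bind fun s => (π s).bind fun a => PMF.pure (s, a)

lemma joint_apply (ν : PMF α) (π : α → PMF β) (s : α) (a : β) :
    ν.joint π (s, a) = ν s * π s a := by
  classical
  rw [joint, PMF.bind_apply, tsum_eq_single s]
  · rw [PMF.bind_apply, tsum_eq_single a]
    · simp
    · intro b hb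
      simp [Ne.symm hb]
  · intro s' hs'
    simp [Ne.symm hs']

lemma expect_joint (ν : PMF α) (π : α → PMF β) {g : α → β → ℝ} {B : ℝ}
    (hg : ∀ s a, |g s a| ≤ B) :
    (ν.joint π).expect (fun z => g z.1 z.2) = ν.expect fun s => (π s).expect (g s) := by
  have hF' : ∀ z : α × β, |g z.1 z.2| ≤ B := fun z => hg _ _
  simp only [joint, expect_bind _ _ hF', expect_pure]

/-- The geometric distribution with weights `(1 - γ) γ ^ k`. -/
def discount (γ : ℝ) (h0 : 0 ≤ γ) (h1 : γ < 1) : PMF ℕ :=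
  ⟨fun k => ENNReal.ofReal ((1 - γ) * γ ^ k), by
    have h : HasSum (fun k : ℕ => (1 - γ) * γ ^ k) 1 := by
      simpa [mul_inv_cancel₀ (sub_pos.2 h1).ne'] using
        (hasSum_geometric_of_lt_one h0 h1).mul_left (1 - γ)
    have hn : ∀ k : ℕ, 0 ≤ (1 - γ) * γ ^ k := fun k =>
      mul_nonneg (sub_pos.2 h1).le (pow_nonneg h0 k)
    rw [ENNReal.summable.hasSum_iff, ← ENNReal.ofReal_tsum_of_nonneg hn h.summable, h.tsum_eq,
      ENNReal.ofReal_one]⟩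

lemma discount_apply {γ : ℝ} (h0 : 0 ≤ γ) (h1 : γ < 1) (k : ℕ) :
    discount γ h0 h1 k = ENNReal.ofReal ((1 - γ) * γ ^ k) := rfl

lemma expect_discount {γ : ℝ} (h0 : 0 ≤ γ) (h1 : γ < 1) (g : ℕ → ℝ) :
    (discount γ h0 h1).expect g = (1 - γ) * ∑' k, γ ^ k * g k := by
  rw [expect, ← tsum_mul_left]
  refine tsum_congr fun k => ?_
  rw [discount_apply, ENNReal.toReal_ofReal (mul_nonneg (sub_pos.2 h1).le (pow_nonneg h0 k)),
    mul_assoc]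

lemma expect_discount_succ {γ : ℝ} (h0 : 0 ≤ γ) (h1 : γ < 1) {g : ℕ → ℝ} {B : ℝ}
    (hg : ∀ k, |g k| ≤ B) :
    (discount γ h0 h1).expect g
      = (1 - γ) * g 0 + γ * (discount γ h0 h1).expect fun k => g (k + 1) := by
  have hs : Summable fun k : ℕ => γ ^ k * g k := by
    refine Summable.of_norm_bounded ((summable_geometric_of_lt_one h0 h1).mul_right B) fun k => ?_
    rw [Real.norm_eq_abs, abs_mul, abs_of_nonneg (pow_nonneg h0 k)]
    exact mul_le_mul_of_nonneg_left (hg k) (pow_nonneg h0 k)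
  rw [expect_discount, expect_discount, hs.tsum_eq_zero_add]
  simp only [pow_succ, mul_comm _ γ, mul_assoc, tsum_mul_left, pow_zero, one_mul]
  ring

end PMF

/-! ### Occupancy measures, Bellman equation, performance differences, mixtures. -/

namespace CMDP

variable {S A : Type*} (M : CMDP S A)

/-- The length `1 / (1 - γ)` of the effective horizon. -/
def horizon : ℝ := 1 / (1 - M.γ)

lemma one_sub_pos : 0 < 1 - M.γ := sub_pos.2 M.γ_lt_one

lemma horizon_pos : 0 < M.horizon := one_div_pos.2 M.one_sub_pos

lemma one_sub_mul_horizon : (1 - M.γ) * M.horizon = 1 := by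
  rw [horizon, mul_one_div_cancel M.one_sub_pos.ne']

lemma one_add_mul_horizon : 1 + M.γ * M.horizon = M.horizon := by
  linarith [M.one_sub_mul_horizon]

/-- One transition of the state when `π` is followed. -/
def step (π : Policy S A) (s : S) : PMF S := (π s).bind (M.P s)

lemma stateLaw_succ (π : Policy S A) (μ : PMF S) (k : ℕ) :
    M.stateLaw π μ (k + 1) = (M.stateLaw π μ k).bind (M.step π) := rfl

/-- The defining recursion peels off the last transition; the Bellman equation needs the first one.
-/
lemma stateLaw_succ' (π : Policy S A) (μ : PMF S) (k : ℕ) :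
    M.stateLaw π μ (k + 1) = M.stateLaw π (μ.bind (M.step π)) k := by
  induction k with
  | zero => rfl
  | succ k ih => rw [stateLaw_succ, ih]; rfl

lemma stateLaw_bind {ι : Type*} (π : Policy S A) (p : PMF ι) (q : ι → PMF S) (k : ℕ) :
    M.stateLaw π (p.bind q) k = p.bind fun i => M.stateLaw π (q i) k := by
  induction k with
  | zero => rfl
  | succ k ih => simp only [stateLaw_succ, ih, PMF.bind_bind]

/-- The law of the exponents `k` weighted by the discount factor. -/
def disc : PMF ℕ := PMF.discount M.γ M.γ_nonneg M.γ_lt_one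

/-- The normalised discounted occupancy measure of `π` started from `μ`, as a distribution. -/
def occ (π : Policy S A) (μ : PMF S) : PMF S := M.disc.bind (M.stateLaw π μ)

lemma occ_apply (π : Policy S A) (s : S) : M.occ π M.ρ s = M.occupancy π s := by
  simp only [occ, disc, PMF.bind_apply, PMF.discount_apply, occupancy, ← ENNReal.tsum_mul_left,
    ENNReal.ofReal_mul M.one_sub_pos.le, mul_assoc]

lemma expect_occ (π : Policy S A) (μ : PMF S) {g : S → ℝ} {B : ℝ} (hg : ∀ s, |g s| ≤ B) :
    (M.occ π μ).expect g = M.disc.expect fun k => (M.stateLaw π μ k).expect g :=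
  PMF.expect_bind _ _ hg

lemma expect_occ_eq_add (π : Policy S A) (μ : PMF S) {g : S → ℝ} {B : ℝ} (hg : ∀ s, |g s| ≤ B) :
    (M.occ π μ).expect g = (1 - M.γ) * μ.expect g
      + M.γ * M.disc.expect fun k => (M.stateLaw π μ (k + 1)).expect g := by
  rw [expect_occ M π μ hg, disc, PMF.expect_discount_succ _ _ fun k => PMF.abs_expect_le _ hg]
  rfl

/-- The flow equation of the occupancy measure. -/
lemma occ_flow (π : Policy S A) (μ : PMF S) {g : S → ℝ} {B : ℝ} (hg : ∀ s, |g s| ≤ B) :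
    (M.occ π μ).expect g = (1 - M.γ) * μ.expect g
      + M.γ * (M.occ π μ).expect fun s => (M.step π s).expect g := by
  rw [expect_occ_eq_add M π μ hg, expect_occ M π μ fun s => PMF.abs_expect_le _ hg]
  simp only [stateLaw_succ, PMF.expect_bind _ _ hg]

/-- The time-zero part of the occupancy measure is `(1 - γ) μ`, and the rest has mass `γ`. Applied
to an estimation error, this yields `1 + γ` instead of `2` in front of `U` in the bound on OG. -/
lemma abs_expect_occ_sub_le (π : Policy S A) (μ : PMF S) {g : S → ℝ} {B : ℝ}
    (hg : ∀ s, |g s| ≤ B) : |(M.occ π μ).expect g - (1 - M.γ) * μ.expect g| ≤ M.γ * B := by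
  rw [expect_occ_eq_add M π μ hg, add_sub_cancel_left, abs_mul, abs_of_nonneg M.γ_nonneg]
  exact mul_le_mul_of_nonneg_left
    (PMF.abs_expect_le _ fun k => PMF.abs_expect_le _ hg) M.γ_nonneg

variable {f : S → A → ℝ}

lemma abs_le_of_mem {B x : ℝ} (h : x ∈ Set.Icc 0 B) : |x| ≤ B := by
  rw [abs_of_nonneg h.1]; exact h.2

lemma policy_reward_mem (hf : ∀ s a, f s a ∈ Set.Icc (0 : ℝ) 1) (π : Policy S A) (s : S) :
    (π s).expect (f s) ∈ Set.Icc (0 : ℝ) 1 :=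
  PMF.expect_mem_Icc _ (hf s)

lemma value_eq (f : S → A → ℝ) (π : Policy S A) (s : S) :
    M.value f π s = M.horizon * M.disc.expect fun k =>
      (M.stateLaw π (PMF.pure s) k).expect fun s' => (π s').expect (f s') := by
  rw [disc, PMF.expect_discount, ← mul_assoc, mul_comm M.horizon, one_sub_mul_horizon, one_mul]
  rfl

lemma value_mem (hf : ∀ s a, f s a ∈ Set.Icc (0 : ℝ) 1) (π : Policy S A) (s : S) :
    M.value f π s ∈ Set.Icc 0 M.horizon := by
  rw [value_eq]
  have h := M.disc.expect_mem_Icc fun k =>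
    (M.stateLaw π (PMF.pure s) k).expect_mem_Icc (policy_reward_mem hf π)
  exact ⟨mul_nonneg M.horizon_pos.le h.1, mul_le_of_le_one_right M.horizon_pos.le h.2⟩

lemma abs_value_le (hf : ∀ s a, f s a ∈ Set.Icc (0 : ℝ) 1) (π : Policy S A) (s : S) :
    |M.value f π s| ≤ M.horizon := abs_le_of_mem (M.value_mem hf π s)

lemma expect_value (hf : ∀ s a, f s a ∈ Set.Icc (0 : ℝ) 1) (π : Policy S A) (μ : PMF S) :
    μ.expect (M.value f π) = M.horizon * M.disc.expect fun k =>
      (M.stateLaw π μ k).expect fun s' => (π s').expect (f s') := by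
  have hb := fun s => abs_le_of_mem (policy_reward_mem hf π s)
  have h : (M.value f π) = fun s => M.horizon * M.disc.expect fun k =>
      (M.stateLaw π (PMF.pure s) k).expect fun s' => (π s').expect (f s') :=
    funext (M.value_eq f π)
  rw [h, PMF.expect_mul_left, PMF.expect_comm _ _ fun s k => PMF.abs_expect_le _ hb]
  simp only [← PMF.expect_bind _ _ hb, ← stateLaw_bind, PMF.bind_pure]

lemma ret_eq_expect_occ (hf : ∀ s a, f s a ∈ Set.Icc (0 : ℝ) 1) (π : Policy S A) :
    M.ret f π = M.horizon * (M.occ π M.ρ).expect fun s => (π s).expect (f s) := by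
  rw [ret, expect_value M hf, expect_occ M π _ fun s => abs_le_of_mem (policy_reward_mem hf π s)]

/-- The Bellman equation of the value function. -/
lemma value_bellman (hf : ∀ s a, f s a ∈ Set.Icc (0 : ℝ) 1) (π : Policy S A) (s : S) :
    M.value f π s = (π s).expect (f s) + M.γ * (M.step π s).expect (M.value f π) := by
  have hb := fun s => abs_le_of_mem (policy_reward_mem hf π s)
  rw [expect_value M hf, value_eq, disc,
    PMF.expect_discount_succ _ _ fun k => PMF.abs_expect_le _ hb]
  simp only [stateLaw_succ', PMF.pure_bind]
  simp only [stateLaw, PMF.expect_pure]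
  linear_combination ((π s).expect (f s)) * M.one_sub_mul_horizon

lemma qValue_mem (hf : ∀ s a, f s a ∈ Set.Icc (0 : ℝ) 1) (π : Policy S A) (z : S × A) :
    M.qValue f π z ∈ Set.Icc 0 M.horizon := by
  have h1 := hf z.1 z.2
  have h2 := (M.P z.1 z.2).expect_mem_Icc (M.value_mem hf π)
  have h3 := mul_nonneg M.γ_nonneg h2.1
  have h4 := mul_le_mul_of_nonneg_left h2.2 M.γ_nonneg
  have h5 := M.one_add_mul_horizon
  constructor
  · exact add_nonneg h1.1 h3
  · rw [qValue]; linarith [h1.2]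

lemma abs_qValue_le (hf : ∀ s a, f s a ∈ Set.Icc (0 : ℝ) 1) (π : Policy S A) (z : S × A) :
    |M.qValue f π z| ≤ M.horizon := abs_le_of_mem (M.qValue_mem hf π z)

lemma expect_qValue (hf : ∀ s a, f s a ∈ Set.Icc (0 : ℝ) 1) (π' π : Policy S A) (s : S) :
    (π' s).expect (fun a => M.qValue f π (s, a))
      = (π' s).expect (f s) + M.γ * (M.step π' s).expect (M.value f π) := by
  have h1 : ∀ a, |f s a| ≤ 1 := fun a => abs_le_of_mem (hf s a)
  have h2 : ∀ a, |M.γ * (M.P s a).expect (M.value f π)| ≤ M.γ * M.horizon := fun a => by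
    rw [abs_mul, abs_of_nonneg M.γ_nonneg]
    exact mul_le_mul_of_nonneg_left (PMF.abs_expect_le _ (M.abs_value_le hf π)) M.γ_nonneg
  simp only [qValue, step]
  rw [PMF.expect_add _ h1 h2, PMF.expect_mul_left, PMF.expect_bind _ _ (M.abs_value_le hf π)]

lemma value_eq_expect_qValue (hf : ∀ s a, f s a ∈ Set.Icc (0 : ℝ) 1) (π : Policy S A) (s : S) :
    M.value f π s = (π s).expect fun a => M.qValue f π (s, a) := by
  rw [expect_qValue M hf, ← value_bellman M hf]

lemma ret_mem (hf : ∀ s a, f s a ∈ Set.Icc (0 : ℝ) 1) (π : Policy S A) :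
    M.ret f π ∈ Set.Icc 0 M.horizon :=
  PMF.expect_mem_Icc _ (M.value_mem hf π)

lemma ret_eq_expect_qValue (hf : ∀ s a, f s a ∈ Set.Icc (0 : ℝ) 1) (π : Policy S A) :
    M.ret f π = M.ρ.expect fun s => (π s).expect fun a => M.qValue f π (s, a) := by
  rw [ret]; congr 1; exact funext (M.value_eq_expect_qValue hf π)

/-- The performance difference lemma. -/
lemma performance_difference (hf : ∀ s a, f s a ∈ Set.Icc (0 : ℝ) 1) (π' π : Policy S A) :
    (1 - M.γ) * (M.ret f π' - M.ret f π) = (M.occ π' M.ρ).expect fun s =>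
      (π' s).expect (fun a => M.qValue f π (s, a))
        - (π s).expect fun a => M.qValue f π (s, a) := by
  have hV := M.abs_value_le hf π
  have hb := fun s => abs_le_of_mem (policy_reward_mem hf π' s)
  have h2 : ∀ s, |M.γ * (M.step π' s).expect (M.value f π)| ≤ M.γ * M.horizon := fun a => by
    rw [abs_mul, abs_of_nonneg M.γ_nonneg]
    exact mul_le_mul_of_nonneg_left (PMF.abs_expect_le _ (M.abs_value_le hf π)) M.γ_nonneg
  have hflow := M.occ_flow π' M.ρ hV
  rw [PMF.expect_sub _ (fun s => PMF.abs_expect_le _ fun a => M.abs_qValue_le hf π (s, a))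
    (fun s => PMF.abs_expect_le _ fun a => M.abs_qValue_le hf π (s, a))]
  simp only [expect_qValue M hf π' π, ← value_eq_expect_qValue M hf]
  rw [PMF.expect_add _ hb h2, PMF.expect_mul_left, ret_eq_expect_occ M hf π', ret, hflow]
  linear_combination ((M.occ π' M.ρ).expect fun s => (π' s).expect (f s)) * M.one_sub_mul_horizon

/-- Mixtures of memoryless policies are realised by memoryless policies. -/
lemma exists_mixture {ι : Type*} (κ : PMF ι) (πs : ι → Policy S A) :
    ∃ π : Policy S A, ∀ f : S → A → ℝ, (∀ s a, f s a ∈ Set.Icc (0 : ℝ) 1) →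
      M.ret f π = κ.expect fun i => M.ret f (πs i) := by
  classical
  obtain ⟨i₀⟩ : Nonempty ι := let ⟨i, _⟩ := κ.support_nonempty; ⟨i⟩
  set ν : ι → PMF S := fun i => M.occ (πs i) M.ρ with hν
  set N : PMF S := κ.bind ν with hN
  have hsum : ∀ s, ∑' a, ∑' i, κ i * (ν i s * πs i s a) = N s := by
    intro s
    rw [ENNReal.tsum_comm, hN, PMF.bind_apply]
    simp only [ENNReal.tsum_mul_left, PMF.tsum_coe, mul_one]
  -- The conditional law of the action given the state under the mixed occupancy measure; off the
  -- support of `N` any choice works.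
  let π : Policy S A := fun s => if h : N s = 0 then πs i₀ s else
    PMF.normalize (fun a => ∑' i, κ i * (ν i s * πs i s a)) (by rwa [hsum])
      (by rw [hsum]; exact N.apply_ne_top s)
  have hπ : ∀ s a, N s * π s a = ∑' i, κ i * (ν i s * πs i s a) := by
    intro s a
    by_cases h : N s = 0
    · have h' := hsum s
      rw [h, ENNReal.tsum_eq_zero] at h'
      rw [h, zero_mul, h' a]
    · simp only [π, h, dif_neg, not_false_iff, PMF.normalize_apply, hsum]
      rw [mul_comm, mul_assoc, ENNReal.inv_mul_cancel h (N.apply_ne_top s), mul_one]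
  have hjoint : N.joint π = κ.bind fun i => (ν i).joint (πs i) := by
    ext ⟨s, a⟩
    simp only [PMF.joint_apply, hπ, PMF.bind_apply]
  have hmix : ∀ {g : S → A → ℝ} {B : ℝ}, (∀ s a, |g s a| ≤ B) →
      N.expect (fun s => (π s).expect (g s))
        = κ.expect fun i => (ν i).expect fun s => (πs i s).expect (g s) := by
    intro g B hg
    have hg' : ∀ z : S × A, |g z.1 z.2| ≤ B := fun z => hg _ _
    rw [← PMF.expect_joint _ _ hg, hjoint, PMF.expect_bind _ _ hg']
    simp only [PMF.expect_joint _ _ hg]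
  refine ⟨π, fun f hf => ?_⟩
  have hV := M.abs_value_le hf π
  have hb := fun s => abs_le_of_mem (policy_reward_mem hf π s)
  have hPV : ∀ s a, |(M.P s a).expect (M.value f π)| ≤ M.horizon := fun s a =>
    PMF.abs_expect_le _ hV
  have hstep : ∀ (π' : Policy S A) s, (M.step π' s).expect (M.value f π)
      = (π' s).expect fun a => (M.P s a).expect (M.value f π) := fun π' s =>
    PMF.expect_bind _ _ hV
  -- `N` need not be identified as the occupancy measure of `π`: its flow equation, tested against
  -- the value function of `π` and combined with the Bellman equation, already gives the return.
  have hflow : N.expect (M.value f π) = (1 - M.γ) * M.ρ.expect (M.value f π)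
      + M.γ * N.expect fun s => (M.step π s).expect (M.value f π) := by
    simp only [hstep]
    rw [hmix hPV, hN, PMF.expect_bind _ _ hV]
    have h1 : ∀ i, (ν i).expect (M.value f π) = (1 - M.γ) * M.ρ.expect (M.value f π)
        + M.γ * (ν i).expect fun s => (πs i s).expect fun a =>
          (M.P s a).expect (M.value f π) := by
      intro i
      rw [hν, M.occ_flow (πs i) M.ρ hV]
      simp only [hstep]
    simp only [h1]
    have hc : ∀ _ : ι, |(1 - M.γ) * M.ρ.expect (M.value f π)|
      ≤ |(1 - M.γ) * M.ρ.expect (M.value f π)| := fun _ => le_rfl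
    have h2 : ∀ i, |M.γ * (ν i).expect fun s => (πs i s).expect fun a =>
        (M.P s a).expect (M.value f π)| ≤ M.γ * M.horizon := fun i => by
      rw [abs_mul, abs_of_nonneg M.γ_nonneg]
      exact mul_le_mul_of_nonneg_left
        (PMF.abs_expect_le _ fun s => PMF.abs_expect_le _ (hPV s)) M.γ_nonneg
    rw [PMF.expect_add _ hc h2, PMF.expect_const, PMF.expect_mul_left]
  have h2 : ∀ s, |M.γ * (M.step π s).expect (M.value f π)| ≤ M.γ * M.horizon := fun a => by
    rw [abs_mul, abs_of_nonneg M.γ_nonneg]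
    exact mul_le_mul_of_nonneg_left (PMF.abs_expect_le _ hV) M.γ_nonneg
  have hbell : N.expect (M.value f π) = N.expect (fun s => (π s).expect (f s))
      + M.γ * N.expect fun s => (M.step π s).expect (M.value f π) := by
    conv_lhs => rw [funext (M.value_bellman hf π)]
    rw [PMF.expect_add _ hb h2, PMF.expect_mul_left]
  have hret : (1 - M.γ) * M.ret f π = N.expect fun s => (π s).expect (f s) := by
    rw [ret]; linarith
  rw [hmix fun s a => abs_le_of_mem (hf s a)] at hret
  simp only [ret_eq_expect_occ M hf (πs _), PMF.expect_mul_left]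
  rw [← hret]
  linear_combination (-M.ret f π) * M.one_sub_mul_horizon

lemma slater_le_horizon_sub (πstar : Policy S A) : M.slater ≤ M.horizon - M.b := by
  have : Nonempty (Policy S A) := ⟨πstar⟩
  have : (⨆ π : Policy S A, M.Jc π) ≤ M.horizon := ciSup_le fun π => (M.ret_mem M.c_mem π).2
  rw [slater]; linarith

/-- A mixture of policies that violates the constraint by `v` on average exceeds the optimal
reward by at most `v / (ζ (1 - γ))`. -/
lemma avg_Jr_sub_le {πstar : Policy S A} (hstar : M.IsOptimal πstar) (hζ : 0 < M.slater)
    {T : ℕ} (hT : 1 ≤ T) (π : ℕ → Policy S A) {v : ℝ} (hv : 0 < v)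
    (hv' : v = 1 / (T : ℝ) * ∑ t ∈ Finset.range T, (M.b - M.Jc (π t))) :
    M.slater * (1 / (T : ℝ) * ∑ t ∈ Finset.range T, (M.Jr (π t) - M.Jr πstar))
      ≤ v * M.horizon := by
  have hT0 : (0 : ℝ) < T := by exact_mod_cast hT
  have : Nonempty (Fin T) := ⟨⟨0, hT⟩⟩
  obtain ⟨πb, hπb⟩ := M.exists_mixture (PMF.uniformOfFintype (Fin T)) fun i => π i
  have havg : ∀ g : ℕ → ℝ, (PMF.uniformOfFintype (Fin T)).expect (fun i => g i)
      = 1 / (T : ℝ) * ∑ t ∈ Finset.range T, g t := by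
    intro g
    rw [PMF.expect_fintype, Finset.mul_sum, Finset.sum_range]
    simp
  have hr : M.Jr πb = 1 / (T : ℝ) * ∑ t ∈ Finset.range T, M.Jr (π t) := by
    rw [Jr, hπb _ M.r_mem]; exact havg fun t => M.Jr (π t)
  have hc : M.Jc πb = 1 / (T : ℝ) * ∑ t ∈ Finset.range T, M.Jc (π t) := by
    rw [Jc, hπb _ M.c_mem]; exact havg fun t => M.Jc (π t)
  have hc' : M.Jc πb = M.b - v := by
    rw [hv', hc, Finset.sum_sub_distrib, Finset.sum_const, Finset.card_range, nsmul_eq_mul]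
    field_simp; ring
  have hgoal : 1 / (T : ℝ) * ∑ t ∈ Finset.range T, (M.Jr (π t) - M.Jr πstar)
      = M.Jr πb - M.Jr πstar := by
    rw [hr, Finset.sum_sub_distrib, Finset.sum_const, Finset.card_range, nsmul_eq_mul]
    field_simp
  rw [hgoal]
  by_contra! hcon
  set x := M.Jr πb - M.Jr πstar with hx
  have hvG : 0 < v * M.horizon := mul_pos hv M.horizon_pos
  have hxpos : 0 < x := by
    by_contra! h
    nlinarith [mul_nonneg hζ.le (neg_nonneg.2 h)]
  have : Nonempty (Policy S A) := ⟨πstar⟩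
  -- The supremum defining `ζ` need not be attained, but an excess `x` that is too large leaves room
  -- for a policy whose slack `z` satisfies `z x > v / (1 - γ)`.
  have hlt : M.b + v * M.horizon / x < ⨆ π : Policy S A, M.Jc π := by
    have : v * M.horizon / x < M.slater := by rwa [div_lt_iff₀ hxpos]
    rw [slater] at this; linarith
  obtain ⟨π', hπ'⟩ := exists_lt_of_lt_ciSup hlt
  set z := M.Jc π' - M.b with hz
  have hzx : v * M.horizon < z * x := by
    rw [← div_lt_iff₀ hxpos]; rw [hz]; linarith
  have hzpos : 0 < z := by
    by_contra! h
    nlinarith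
  -- With weight `v / (v + z)` on `π'`, the mixture with `πb` meets the constraint with equality, so
  -- that optimality of `πstar` applies to it.
  have hα1 : v / (v + z) ≤ 1 := by rw [div_le_one (by positivity)]; linarith
  have hα0 : 0 ≤ v / (v + z) := by positivity
  have hcoin : ∑ i : Bool, ENNReal.ofReal (if i then v / (v + z) else 1 - v / (v + z)) = 1 := by
    simp [← ENNReal.ofReal_add hα0 (sub_nonneg.2 hα1)]
  obtain ⟨π'', hπ''⟩ := M.exists_mixture (PMF.ofFintype _ hcoin) fun i => if i then π' else πb
  have hmix : ∀ f : S → A → ℝ, (∀ s a, f s a ∈ Set.Icc (0 : ℝ) 1) → M.ret f π''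
      = v / (v + z) * M.ret f π' + (1 - v / (v + z)) * M.ret f πb := by
    intro f hf
    rw [hπ'' f hf, PMF.expect_fintype]
    simp [ENNReal.toReal_ofReal hα0, ENNReal.toReal_ofReal (sub_nonneg.2 hα1)]
  have hcm : M.Jc π'' = M.b := by
    rw [Jc, hmix _ M.c_mem]
    change v / (v + z) * M.Jc π' + (1 - v / (v + z)) * M.Jc πb = M.b
    rw [hc', show M.Jc π' = M.b + z by rw [hz]; ring]
    field_simp; ring
  have hopt := hstar.2 π'' hcm.ge
  rw [Jr, hmix _ M.r_mem] at hopt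
  change v / (v + z) * M.Jr π' + (1 - v / (v + z)) * M.Jr πb ≤ _ at hopt
  have h1 : 0 ≤ M.Jr π' := (M.ret_mem M.r_mem π').1
  have h2 : M.Jr πb ≤ M.horizon := (M.ret_mem M.r_mem πb).2
  have h3 : x ≤ v / (v + z) * M.horizon := by
    have h4 := mul_nonneg hα0 h1
    have h5 := mul_le_mul_of_nonneg_left h2 hα0
    rw [hx]; linarith
  rw [div_mul_eq_mul_div, le_div_iff₀ (by positivity)] at h3
  nlinarith

end CMDP

/-! ### The primal bettor: coin betting with a shifted potential. -/

namespace CoinBetting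

open Real Finset

/-- This is `x ≤ sinh x` at `x = log y`. -/
lemma log_le_half_sub_inv {y : ℝ} (hy : 1 ≤ y) : log y ≤ (y - y⁻¹) / 2 := by
  have h := Real.self_le_sinh_iff.2 (log_nonneg hy)
  rwa [Real.sinh_eq, Real.exp_neg, Real.exp_log (by linarith)] at h

/-- The excess `1 / u` is the loss per round of the potential argument; the shift `T / 2` of the
bias keeps it at most `2 / T`. -/
lemma mul_log_add_two_sub_le {u : ℝ} (hu : 0 < u) :
    (u + 2) * log (u + 2) - u * log u ≤ 2 * (1 + log u + 1 / u) := by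
  have h1 : log (u + 2) = log u + log ((u + 2) / u) := by
    rw [log_div (by linarith) hu.ne']; ring
  have h2 := log_le_half_sub_inv (y := (u + 2) / u) (by rw [le_div_iff₀ hu]; linarith)
  have h3 := mul_le_mul_of_nonneg_left h2 (by linarith : 0 ≤ u + 2)
  have h4 : (u + 2) * (((u + 2) / u - ((u + 2) / u)⁻¹) / 2) = 2 + 2 / u := by
    have : u + 2 ≠ 0 := by linarith
    field_simp; ring
  rw [h1]
  have h5 : 2 * (1 / u) = 2 / u := by ring
  linarith

lemma one_add_log_le_mul_log_succ_sub {D : ℝ} (hD : 0 < D) :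
    1 + log D ≤ (D + 1) * log (D + 1) - D * log D := by
  have h1 : log (D + 1) = log D + log ((D + 1) / D) := by
    rw [log_div (by linarith) hD.ne']; ring
  have h2 := Real.one_sub_inv_le_log_of_pos (x := (D + 1) / D) (by positivity)
  have h3 := mul_le_mul_of_nonneg_left h2 (by linarith : 0 ≤ D + 1)
  have h4 : (D + 1) * (1 - ((D + 1) / D)⁻¹) = 1 := by
    have : D + 1 ≠ 0 := by linarith
    field_simp; ring
  rw [h1]
  linarith

/-- The logarithmic potential `D h(S / D)` of a bettor with bias `D` and coin sum `S`,
where `h` is the relative entropy of a coin with mean `S / D` from a fair one. -/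
def potential (D S : ℝ) : ℝ :=
  ((D + S) * log (D + S) + (D - S) * log (D - S)) / 2 - D * log D

/-- The left side is convex in `g`, as `u log u` is convex, and the right side is concave. Hence
only the endpoints `g = ±1` matter, with weights `p` and `q`; there the claim combines the two
preceding bounds on increments. -/
lemma potential_step {D S g κ : ℝ} (hu : 0 < D + S) (hv : 0 < D - S) (hg : |g| ≤ 1)
    (hκu : 1 / (D + S) ≤ κ) (hκv : 1 / (D - S) ≤ κ) :
    potential (D + 1) (S + g) - potential D S ≤ log (1 + g * (S / D)) + κ := by
  have hD : 0 < D := by linarith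
  obtain ⟨hg1, hg2⟩ := abs_le.1 hg
  set p := (1 + g) / 2 with hp
  set q := (1 - g) / 2 with hq
  have hp0 : 0 ≤ p := by rw [hp]; linarith
  have hq0 : 0 ≤ q := by rw [hq]; linarith
  have hpq : p + q = 1 := by rw [hp, hq]; ring
  have hc1 := Real.convexOn_mul_log.2 (x := D + S + 2) (y := D + S) (by simp; linarith)
    (by simp; linarith) hp0 hq0 hpq
  have hc2 := Real.convexOn_mul_log.2 (x := D - S) (y := D - S + 2) (by simp; linarith)
    (by simp; linarith) hp0 hq0 hpq
  have hl := strictConcaveOn_log_Ioi.concaveOn.2 (x := (D + S) / D) (y := (D - S) / D)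
    (by simp; positivity) (by simp; positivity) hp0 hq0 hpq
  simp only [smul_eq_mul] at hc1 hc2 hl
  rw [log_div hu.ne' hD.ne', log_div hv.ne' hD.ne'] at hl
  have e1 : p * (D + S + 2) + q * (D + S) = D + 1 + (S + g) := by rw [hp, hq]; ring
  have e2 : p * (D - S) + q * (D - S + 2) = D + 1 - (S + g) := by rw [hp, hq]; ring
  have e3 : p * ((D + S) / D) + q * ((D - S) / D) = 1 + g * (S / D) := by
    rw [hp, hq]; field_simp; ring
  rw [e1] at hc1
  rw [e2] at hc2
  rw [e3] at hl
  have hA := mul_le_mul_of_nonneg_left (mul_log_add_two_sub_le hu) hp0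
  have hB := mul_le_mul_of_nonneg_left (mul_log_add_two_sub_le hv) hq0
  have hC := one_add_log_le_mul_log_succ_sub hD
  have hκ1 := mul_le_mul_of_nonneg_left hκu hp0
  have hκ2 := mul_le_mul_of_nonneg_left hκv hq0
  have hκ : p * κ + q * κ = κ := by rw [← add_mul, hpq, one_mul]
  have hLD : p * log D + q * log D = log D := by rw [← add_mul, hpq, one_mul]
  have hU : p * ((D + S) * log (D + S)) + q * ((D + S) * log (D + S))
    = (D + S) * log (D + S) := by rw [← add_mul, hpq, one_mul]
  have hV : p * ((D - S) * log (D - S)) + q * ((D - S) * log (D - S))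
    = (D - S) * log (D - S) := by rw [← add_mul, hpq, one_mul]
  rw [potential, potential]
  ring_nf at *
  linarith

/-- The constant is not sharp: the two elementary logarithm bounds used here already give `5 / 6`.
-/
lemma two_thirds_sq_le {x : ℝ} (hx : 0 ≤ x) (hx1 : x < 1) :
    2 / 3 * x ^ 2 ≤ (1 + x) * log (1 + x) + (1 - x) * log (1 - x) := by
  have h1 := Real.le_log_one_add_of_nonneg hx
  have h2 := log_le_half_sub_inv (y := (1 - x)⁻¹) (by
    rw [one_le_inv₀ (by linarith)]; linarith)
  rw [Real.log_inv, inv_inv] at h2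
  have h3 := mul_le_mul_of_nonneg_left h1 (by linarith : 0 ≤ 1 + x)
  have h4 := mul_le_mul_of_nonneg_left h2 (by linarith : 0 ≤ 1 - x)
  have h5 : (1 - x) * (((1 - x)⁻¹ - (1 - x)) / 2) = x - x ^ 2 / 2 := by
    have : 1 - x ≠ 0 := by linarith
    field_simp; ring
  have h6 : x + x ^ 2 / 3 ≤ (1 + x) * (2 * x / (x + 2)) := by
    rw [← mul_div_assoc, le_div_iff₀ (by linarith)]
    nlinarith [mul_nonneg hx hx, mul_nonneg (mul_nonneg hx hx) (by linarith : 0 ≤ 1 - x)]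
  nlinarith [sq_nonneg x]

lemma sq_div_le_potential {D S : ℝ} (hS : |S| < D) : S ^ 2 / (3 * D) ≤ potential D S := by
  have key : ∀ {S : ℝ}, 0 ≤ S → S < D → S ^ 2 / (3 * D) ≤ potential D S := by
    intro S h0 h1
    have hD : 0 < D := h0.trans_lt h1
    have hx := two_thirds_sq_le (x := S / D) (by positivity) (by rwa [div_lt_one hD])
    have e1 : 1 + S / D = (D + S) / D := by field_simp
    have e2 : 1 - S / D = (D - S) / D := by field_simp
    rw [e1, e2, log_div (by linarith) hD.ne', log_div (by linarith) hD.ne'] at hx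
    have hm := mul_le_mul_of_nonneg_left hx (by positivity : 0 ≤ D / 2)
    have e3 : D / 2 * (2 / 3 * (S / D) ^ 2) = S ^ 2 / (3 * D) := by field_simp
    have e4 : D / 2 * ((D + S) / D * (log (D + S) - log D) + (D - S) / D * (log (D - S) - log D))
        = potential D S := by
      rw [potential]; field_simp; ring
    rwa [e3, e4] at hm
  rcases le_total 0 S with h | h
  · exact key h (by rwa [abs_of_nonneg h] at hS)
  · have h2 := key (neg_nonneg.2 h) (by rwa [abs_of_nonpos h] at hS)
    have e : potential D (-S) = potential D S := by
      rw [potential, potential, sub_neg_eq_add, ← sub_eq_add_neg]; ring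
    rwa [e, neg_sq] at h2

lemma abs_sum_range_le {g : ℕ → ℝ} {n : ℕ} (hg : ∀ i < n, |g i| ≤ 1) :
    |∑ i ∈ range n, g i| ≤ n := by
  refine (abs_sum_le_sum_abs _ _).trans ?_
  refine (sum_le_sum fun i hi => hg i (mem_range.1 hi)).trans ?_
  simp

section Wealth

variable {T : ℕ} {g w : ℕ → ℝ}

/-- The bet is a fraction of the current wealth, so the wealth evolves multiplicatively and its
logarithm can be compared with the potential round by round. -/
lemma wealth_succ
    (hw : ∀ n < T, w n = (∑ i ∈ range n, g i) / ((n : ℝ) + (T : ℝ) / 2)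
      * (1 + ∑ i ∈ range n, g i * w i))
    {n : ℕ} (hn : n < T) :
    1 + ∑ i ∈ range (n + 1), g i * w i = (1 + ∑ i ∈ range n, g i * w i)
      * (1 + g n * ((∑ i ∈ range n, g i) / ((n : ℝ) + (T : ℝ) / 2))) := by
  rw [sum_range_succ]
  rw [hw n hn]
  ring

lemma abs_fraction_lt_one (hg : ∀ n < T, |g n| ≤ 1) {n : ℕ} (hn : n < T) :
    |(∑ i ∈ range n, g i) / ((n : ℝ) + (T : ℝ) / 2)| < 1 := by
  have hT : (0 : ℝ) < T := by exact_mod_cast (Nat.zero_le n).trans_lt hn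
  rw [abs_div, abs_of_pos (by positivity : (0 : ℝ) < (n : ℝ) + T / 2),
    div_lt_one (by positivity)]
  have := abs_sum_range_le fun i hi => hg i (hi.trans hn)
  linarith

lemma one_add_mul_fraction_mem (hg : ∀ n < T, |g n| ≤ 1) {n : ℕ} (hn : n < T) :
    0 < 1 + g n * ((∑ i ∈ range n, g i) / ((n : ℝ) + (T : ℝ) / 2)) ∧
      1 + g n * ((∑ i ∈ range n, g i) / ((n : ℝ) + (T : ℝ) / 2)) ≤ 2 := by
  have h1 := abs_fraction_lt_one hg hn
  have h2 : |g n * ((∑ i ∈ range n, g i) / ((n : ℝ) + (T : ℝ) / 2))| < 1 := by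
    rw [abs_mul]
    exact (mul_le_of_le_one_left (abs_nonneg _) (hg n hn)).trans_lt h1
  have := abs_lt.1 h2
  constructor <;> linarith [this.1, this.2]

lemma wealth_mem
    (hw : ∀ n < T, w n = (∑ i ∈ range n, g i) / ((n : ℝ) + (T : ℝ) / 2)
      * (1 + ∑ i ∈ range n, g i * w i))
    (hg : ∀ n < T, |g n| ≤ 1) {n : ℕ} (hn : n ≤ T) :
    0 < 1 + ∑ i ∈ range n, g i * w i ∧ 1 + ∑ i ∈ range n, g i * w i ≤ 2 ^ n := by
  induction n with
  | zero => simp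
  | succ n ih =>
    obtain ⟨h1, h2⟩ := ih (by omega)
    obtain ⟨h3, h4⟩ := one_add_mul_fraction_mem hg (n := n) (by omega)
    rw [wealth_succ hw (by omega), pow_succ]
    exact ⟨mul_pos h1 h3, mul_le_mul h2 h4 h3.le (by positivity)⟩

lemma abs_bet_le
    (hw : ∀ n < T, w n = (∑ i ∈ range n, g i) / ((n : ℝ) + (T : ℝ) / 2)
      * (1 + ∑ i ∈ range n, g i * w i))
    (hg : ∀ n < T, |g n| ≤ 1) {n : ℕ} (hn : n < T) : |w n| ≤ 2 ^ n := by
  obtain ⟨h1, h2⟩ := wealth_mem hw hg hn.le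
  rw [hw n hn, abs_mul, abs_of_pos h1]
  exact (mul_le_of_le_one_left h1.le (abs_fraction_lt_one hg hn).le).trans h2

/-- Since `|S| ≤ n`, both `D + S` and `D - S` are at least `T / 2` for `D = n + T / 2`. Each round
thus loses at most `2 / T`, and all `T` rounds together at most `2`. -/
lemma potential_le_log_wealth
    (hw : ∀ n < T, w n = (∑ i ∈ range n, g i) / ((n : ℝ) + (T : ℝ) / 2)
      * (1 + ∑ i ∈ range n, g i * w i))
    (hg : ∀ n < T, |g n| ≤ 1) {n : ℕ} (hn : n ≤ T) :
    potential ((n : ℝ) + (T : ℝ) / 2) (∑ i ∈ range n, g i) - n * (2 / T)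
      ≤ log (1 + ∑ i ∈ range n, g i * w i) := by
  induction n with
  | zero => simp [potential]
  | succ n ih =>
    have hT : (0 : ℝ) < T := by exact_mod_cast (Nat.zero_le n).trans_lt hn
    have ih := ih (by omega)
    rw [wealth_succ hw (by omega), log_mul (wealth_mem hw hg (by omega)).1.ne'
      (one_add_mul_fraction_mem hg (by omega)).1.ne']
    have hS := abs_le.1 (abs_sum_range_le fun i hi => hg i (by omega : i < T) :
      |∑ i ∈ range n, g i| ≤ n)
    have hT2 : 1 / ((T : ℝ) / 2) = 2 / T := by rw [one_div_div]
    have hstep := potential_step (D := (n : ℝ) + (T : ℝ) / 2) (S := ∑ i ∈ range n, g i)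
      (g := g n) (κ := 2 / T) (by linarith) (by linarith) (hg n (by omega))
      (by rw [← hT2]; exact one_div_le_one_div_of_le (by positivity) (by linarith))
      (by rw [← hT2]; exact one_div_le_one_div_of_le (by positivity) (by linarith))
    rw [sum_range_succ]
    push_cast
    have e : (n : ℝ) + 1 + T / 2 = n + T / 2 + 1 := by ring
    rw [e]
    linarith

/-- The wealth of the shifted bettor is exponential in the square of the coin sum. -/
lemma exp_le_wealth
    (hw : ∀ n < T, w n = (∑ i ∈ range n, g i) / ((n : ℝ) + (T : ℝ) / 2)
      * (1 + ∑ i ∈ range n, g i * w i))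
    (hg : ∀ n < T, |g n| ≤ 1) (hT : 1 ≤ T) :
    exp ((∑ i ∈ range T, g i) ^ 2 / (9 / 2 * T) - 2) ≤ 1 + ∑ i ∈ range T, g i * w i := by
  have hT0 : (0 : ℝ) < T := by exact_mod_cast hT
  rw [← Real.le_log_iff_exp_le (wealth_mem hw hg le_rfl).1]
  refine le_trans ?_ (potential_le_log_wealth hw hg le_rfl)
  have h1 := abs_sum_range_le hg
  have h2 := sq_div_le_potential (D := (T : ℝ) + T / 2) (S := ∑ i ∈ range T, g i) (by linarith)
  -- The final bias is `3T / 2`, whence the constant `9 / 2`.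
  have e1 : 3 * ((T : ℝ) + T / 2) = 9 / 2 * T := by ring
  have e2 : (T : ℝ) * (2 / T) = 2 := by field_simp
  rw [e1] at h2
  linarith

end Wealth

end CoinBetting

/-! ### Relative entropy, and wealth averaged over the actions. -/

namespace PMF

variable {A : Type*}

lemma expect_eq_integral [MeasurableSpace A] [DiscreteMeasurableSpace A] (p : PMF A)
    {f : A → ℝ} {B : ℝ} (hf : ∀ x, |f x| ≤ B) :
    MeasureTheory.Integrable f p.toMeasure ∧ ∫ x, f x ∂p.toMeasure = p.expect f := by
  have hi : MeasureTheory.Integrable f p.toMeasure :=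
    MeasureTheory.Integrable.of_bound Measurable.of_discrete.aestronglyMeasurable B
      (Filter.Eventually.of_forall hf)
  refine ⟨hi, ?_⟩
  rw [PMF.integral_eq_tsum p f hi]
  rfl

/-- Young's inequality, from `1 + s ≤ exp s` at `s = y - log x`; applied to a density and
integrated, it becomes the Donsker-Varadhan inequality. -/
lemma mul_le_klFun_add_exp {x : ℝ} (hx : 0 ≤ x) (y : ℝ) :
    x * y ≤ InformationTheory.klFun x + Real.exp y - 1 := by
  rw [InformationTheory.klFun_apply]
  rcases hx.eq_or_lt with rfl | hx
  · simp [(Real.exp_pos y).le]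
  · have h := mul_le_mul_of_nonneg_left (Real.add_one_le_exp (y - Real.log x)) hx.le
    rw [Real.exp_sub, Real.exp_log hx, mul_div_cancel₀ _ hx.ne'] at h
    linarith

/-- The Donsker-Varadhan inequality for discrete distributions. -/
lemma expect_le_toReal_klDiv [MeasurableSpace A] [DiscreteMeasurableSpace A]
    {p q : PMF A} (hpq : InformationTheory.klDiv p.toMeasure q.toMeasure ≠ ⊤)
    {f g : A → ℝ} {B B' : ℝ} (hf : ∀ x, |f x| ≤ B) (hg : ∀ x, |g x| ≤ B')
    (hfg : ∀ x, Real.exp (f x) ≤ g x) (h1 : q.expect g ≤ 1) :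
    p.expect f ≤ (InformationTheory.klDiv p.toMeasure q.toMeasure).toReal := by
  obtain ⟨hac, hint⟩ := InformationTheory.klDiv_ne_top_iff.1 hpq
  obtain ⟨hfi, hf'⟩ := p.expect_eq_integral hf
  obtain ⟨hgi, hg'⟩ := q.expect_eq_integral hg
  rw [InformationTheory.toReal_klDiv_eq_integral_klFun hac, ← hf']
  have h2 := MeasureTheory.integral_rnDeriv_smul hac (f := f)
  have hki := (InformationTheory.integrable_klFun_rnDeriv_iff hac).2 hint
  have hi2 := (MeasureTheory.integrable_rnDeriv_smul_iff hac (f := f)).2 hfi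
  rw [← h2]
  have hgs : MeasureTheory.Integrable (fun x => g x - 1) q.toMeasure :=
    hgi.sub (MeasureTheory.integrable_const _)
  have h3 : ∫ x, ((p.toMeasure.rnDeriv q.toMeasure x).toReal • f x) ∂q.toMeasure
      ≤ ∫ x, (InformationTheory.klFun (p.toMeasure.rnDeriv q.toMeasure x).toReal
        + (g x - 1)) ∂q.toMeasure := by
    refine MeasureTheory.integral_mono hi2 (hki.add hgs)
      fun x => ?_
    have := mul_le_klFun_add_exp
      (ENNReal.toReal_nonneg (a := p.toMeasure.rnDeriv q.toMeasure x)) (f x)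
    have := hfg x
    simp only [smul_eq_mul]
    linarith
  rw [MeasureTheory.integral_add hki hgs,
    MeasureTheory.integral_sub hgi (MeasureTheory.integrable_const _), hg'] at h3
  simp at h3
  simp only [smul_eq_mul]
  linarith

/-- If `p` is proportional to `q` times the positive part of `w`, then an `h` that is centred
under `p` is orthogonal to the positive part of `w` under `q`. -/
lemma expect_mul_posPart_eq_zero {p q : PMF A} {w h : A → ℝ} {B : ℝ} (hw : ∀ a, |w a| ≤ B)
    (hp : ∑' a', q a' * ENNReal.ofReal (w a') ≠ 0 →
      ∀ a, p a = q a * ENNReal.ofReal (w a) / ∑' a', q a' * ENNReal.ofReal (w a'))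
    (hh : p.expect h = 0) : q.expect (fun a => max (w a) 0 * h a) = 0 := by
  set Z := ∑' a', q a' * ENNReal.ofReal (w a') with hZ
  have hof : ∀ a, ENNReal.ofReal (w a) = ENNReal.ofReal (max (w a) 0) := fun a => by
    rcases le_total (w a) 0 with h | h
    · rw [max_eq_right h, ENNReal.ofReal_of_nonpos h, ENNReal.ofReal_zero]
    · rw [max_eq_left h]
  -- A zero normaliser forces `w ≤ 0` on the support of `q`, so the claim then holds whatever `p`
  -- is.
  by_cases h0 : Z = 0
  · refine q.expect_eq_zero_of_forall fun a => ?_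
    rw [hZ, ENNReal.tsum_eq_zero] at h0
    rcases mul_eq_zero.1 (h0 a) with h | h
    · exact Or.inl h
    · right
      rw [ENNReal.ofReal_eq_zero] at h
      rw [max_eq_right h, zero_mul]
  · have hm : ∀ a, max (w a) 0 ∈ Set.Icc 0 B := fun a =>
      ⟨le_max_right _ _, max_le ((le_abs_self _).trans (hw a)) ((abs_nonneg _).trans (hw a))⟩
    have hZt : Z ≠ ⊤ := by
      have : Z = ENNReal.ofReal (q.expect fun a => max (w a) 0) := by
        rw [q.ofReal_expect hm, hZ]
        simp only [hof]
      rw [this]; exact ENNReal.ofReal_ne_top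
    have hZp : 0 < Z.toReal := ENNReal.toReal_pos h0 hZt
    have : q.expect (fun a => max (w a) 0 * h a) = Z.toReal * p.expect h := by
      rw [expect, expect, ← tsum_mul_left]
      refine tsum_congr fun a => ?_
      rw [hp h0 a, ENNReal.toReal_div, ENNReal.toReal_mul, hof,
        ENNReal.toReal_ofReal (le_max_right _ _)]
      field_simp
    rw [this, hh, mul_zero]

end PMF

namespace CoinBetting

open Finset

variable {A : Type*}

/-- The coin of the bettor: the outcome `h` itself if the bet is positive, and its positive part
otherwise. -/
def coin (w h : ℝ) : ℝ := if 0 < w then h else max h 0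

lemma abs_coin_le {w h : ℝ} (hh : |h| ≤ 1) : |coin w h| ≤ 1 := by
  rw [coin]
  split_ifs
  · exact hh
  · rw [abs_of_nonneg (le_max_right _ _)]
    exact max_le ((le_abs_self _).trans hh) zero_le_one

/-- Truncation only raises the coin, so upper bounds on coin sums are upper bounds on advantage
sums. -/
lemma le_coin (w h : ℝ) : h ≤ coin w h := by
  rw [coin]
  split_ifs
  · exact le_rfl
  · exact le_max_left _ _

/-- A nonpositive bet has no weight in the policy. The truncated coin is nonnegative there, so such
a bet can only lose, and the gain stays below the term that the policy accounts for. -/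
lemma coin_mul_le (w h : ℝ) : coin w h * w ≤ max w 0 * h := by
  rw [coin]
  split_ifs with hw
  · rw [max_eq_left hw.le, mul_comm]
  · rw [max_eq_right (not_lt.1 hw), zero_mul]
    exact mul_nonpos_of_nonneg_of_nonpos (le_max_right _ _) (not_lt.1 hw)

/-- Wealth bound of the coin-betting learner with expert advice at one state: the squared sum of
the coins is controlled, on average under the comparator, by the relative entropy. -/
lemma expect_sq_sum_coin_le [MeasurableSpace A] [DiscreteMeasurableSpace A]
    {T : ℕ} (hT : 1 ≤ T) {p q : PMF A}
    (hpq : InformationTheory.klDiv p.toMeasure q.toMeasure ≠ ⊤) {h w : ℕ → A → ℝ} {π : ℕ → PMF A}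
    (hh : ∀ t < T, ∀ a, |h t a| ≤ 1) (hc : ∀ t < T, (π t).expect (h t) = 0)
    (hw : ∀ t < T, ∀ a, w t a = (∑ i ∈ range t, coin (w i a) (h i a)) / ((t : ℝ) + (T : ℝ) / 2)
      * (1 + ∑ i ∈ range t, coin (w i a) (h i a) * w i a))
    (hπ : ∀ t < T, ∑' a', q a' * ENNReal.ofReal (w t a') ≠ 0 → ∀ a, π t a
      = q a * ENNReal.ofReal (w t a) / ∑' a', q a' * ENNReal.ofReal (w t a')) :
    p.expect (fun a => (∑ i ∈ range T, coin (w i a) (h i a)) ^ 2)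
      ≤ 9 / 2 * T * ((InformationTheory.klDiv p.toMeasure q.toMeasure).toReal + 2) := by
  have hT0 : (0 : ℝ) < T := by exact_mod_cast hT
  set c : ℕ → A → ℝ := fun i a => coin (w i a) (h i a) with hcdef
  have hw' : ∀ a, ∀ t < T, w t a = (∑ i ∈ range t, c i a) / ((t : ℝ) + (T : ℝ) / 2)
      * (1 + ∑ i ∈ range t, c i a * w i a) := fun a t ht => hw t ht a
  have hcb : ∀ a, ∀ t < T, |c t a| ≤ 1 := fun a t ht => abs_coin_le (hh t ht a)
  have hwb : ∀ t < T, ∀ a, |w t a| ≤ 2 ^ t := fun t ht a =>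
    abs_bet_le (g := fun i => c i a) (w := fun i => w i a) (hw' a) (hcb a) ht
  have hcw : ∀ t ∈ range T, ∀ a, |c t a * w t a| ≤ 2 ^ t := fun t ht a => by
    rw [abs_mul]
    exact (mul_le_of_le_one_left (abs_nonneg _) (hcb a t (mem_range.1 ht))).trans
      (hwb t (mem_range.1 ht) a)
  -- In each round the gain is at most `w₊ h`, whose mean under `q` vanishes because `h` is centred
  -- under the current policy.
  have hwealth : q.expect (fun a => 1 + ∑ i ∈ range T, c i a * w i a) ≤ 1 := by
    have hB : ∀ _ : A, |(1 : ℝ)| ≤ 1 := fun _ => by simp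
    have hsum : ∀ a, |∑ i ∈ range T, c i a * w i a| ≤ ∑ i ∈ range T, 2 ^ i := fun a =>
      (abs_sum_le_sum_abs _ _).trans (sum_le_sum fun i hi => hcw i hi a)
    rw [q.expect_add hB hsum, q.expect_const, q.expect_sum _ hcw]
    have : ∑ i ∈ range T, q.expect (fun a => c i a * w i a) ≤ 0 := by
      refine sum_nonpos fun i hi => ?_
      have hi' := mem_range.1 hi
      rw [← PMF.expect_mul_posPart_eq_zero (hwb i hi') (hπ i hi') (hc i hi')]
      refine q.expect_mono (hcw i hi) (B' := 2 ^ i) (fun a => ?_) fun a => coin_mul_le _ _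
      rw [abs_mul, abs_of_nonneg (le_max_right _ _)]
      refine (mul_le_of_le_one_right (le_max_right _ _) (hh i hi' a)).trans ?_
      exact max_le ((le_abs_self _).trans (hwb i hi' a)) (by positivity)
    linarith
  have hSb : ∀ a, |∑ i ∈ range T, c i a| ≤ T := fun a => abs_sum_range_le (hcb a)
  have hS2 : ∀ a, (∑ i ∈ range T, c i a) ^ 2 ∈ Set.Icc (0 : ℝ) (T ^ 2) := fun a =>
    ⟨sq_nonneg _, sq_le_sq' (abs_le.1 (hSb a)).1 (abs_le.1 (hSb a)).2⟩
  have hS2b : ∀ a, |(9 / 2 * (T : ℝ))⁻¹ * (∑ i ∈ range T, c i a) ^ 2|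
      ≤ (9 / 2 * (T : ℝ))⁻¹ * T ^ 2 := fun a => by
    rw [abs_mul, abs_of_pos (by positivity)]
    exact mul_le_mul_of_nonneg_left (CMDP.abs_le_of_mem (hS2 a)) (by positivity)
  have h2b : ∀ _ : A, |(2 : ℝ)| ≤ 2 := fun _ => by simp
  have hDV := PMF.expect_le_toReal_klDiv hpq
    (f := fun a => (9 / 2 * (T : ℝ))⁻¹ * (∑ i ∈ range T, c i a) ^ 2 - 2)
    (g := fun a => 1 + ∑ i ∈ range T, c i a * w i a)
    (B := (9 / 2 * (T : ℝ))⁻¹ * T ^ 2 + 2) (B' := 2 ^ T)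
    (fun a => (abs_sub _ _).trans (add_le_add (hS2b a) (h2b a)))
    (fun a => by
      have := wealth_mem (g := fun i => c i a) (w := fun i => w i a) (hw' a) (hcb a) le_rfl
      rw [abs_of_pos this.1]; exact this.2)
    (fun a => by
      have := exp_le_wealth (g := fun i => c i a) (w := fun i => w i a) (hw' a) (hcb a) hT
      rwa [div_eq_inv_mul] at this)
    hwealth
  rw [p.expect_sub hS2b h2b, p.expect_const, p.expect_mul_left] at hDV
  have h3 : (9 / 2 * (T : ℝ))⁻¹ * p.expect (fun a => (∑ i ∈ range T, c i a) ^ 2)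
    ≤ (InformationTheory.klDiv p.toMeasure q.toMeasure).toReal + 2 := by linarith
  rwa [inv_mul_le_iff₀ (by positivity)] at h3

end CoinBetting

/-! ### The dual bettor: adaptive `tanh` bets clipped to an interval. -/

namespace CoinBetting

open Real Finset

lemma two_mul_sigmoid_sub_one (z : ℝ) : 2 * Real.sigmoid (2 * z) - 1 = tanh z := by
  have h1 : exp (-(2 * z)) = exp (-z) * exp (-z) := by rw [← exp_add]; ring_nf
  have h2 : exp z * exp (-z) = 1 := by rw [← exp_add]; simp
  have h3 : 1 + exp (-(2 * z)) = exp (-z) * (exp z + exp (-z)) := by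
    rw [h1]; linear_combination -h2
  rw [Real.sigmoid_def, tanh_eq, h3]
  have hz := exp_pos z
  have hz' := exp_pos (-z)
  field_simp
  linear_combination (-2 : ℝ) * h2

lemma hasDerivAt_tanh (x : ℝ) : HasDerivAt tanh (1 / cosh x ^ 2) x := by
  have h := (hasDerivAt_sinh x).div (hasDerivAt_cosh x) (cosh_pos x).ne'
  have he : (tanh : ℝ → ℝ) = fun y => sinh y / cosh y := funext tanh_eq_sinh_div_cosh
  rw [he]
  exact h.congr_deriv (by rw [← cosh_sq_sub_sinh_sq x]; ring)

lemma concaveOn_tanh : ConcaveOn ℝ (Set.Ici 0) tanh := by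
  have hd : Differentiable ℝ tanh := fun x => (hasDerivAt_tanh x).differentiableAt
  refine AntitoneOn.concaveOn_of_deriv (convex_Ici 0) hd.continuous.continuousOn
    hd.differentiableOn ?_
  intro x hx y hy hxy
  rw [interior_Ici, Set.mem_Ioi] at hx hy
  rw [(hasDerivAt_tanh x).deriv, (hasDerivAt_tanh y).deriv]
  have h : cosh x ≤ cosh y := by
    rw [cosh_le_cosh, abs_of_pos hx, abs_of_pos hy]; exact hxy
  exact one_div_le_one_div_of_le (pow_pos (cosh_pos x) 2)
    (pow_le_pow_left₀ (cosh_pos x).le h 2)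

/-- By concavity and `tanh 0 = 0`, the quotient `tanh z / z` decreases; this is the form free of
division. -/
lemma tanh_mul_le_tanh_mul {p q : ℝ} (hp : 0 ≤ p) (hpq : p ≤ q) : tanh q * p ≤ tanh p * q := by
  rcases hp.eq_or_lt with rfl | hp
  · simp
  have hq : 0 < q := hp.trans_le hpq
  have h := concaveOn_tanh.2 (Set.mem_Ici.2 hq.le) (Set.mem_Ici.2 le_rfl) (div_nonneg hp.le hq.le)
    (sub_nonneg.2 ((div_le_one hq).2 hpq)) (add_sub_cancel _ _)
  simp only [smul_eq_mul, tanh_zero, mul_zero, add_zero, div_mul_cancel₀ _ hq.ne'] at h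
  rw [div_mul_eq_mul_div, div_le_iff₀ hq] at h
  linarith

lemma tanh_lt_tanh {p q : ℝ} (h : p < q) : tanh p < tanh q := by
  rw [tanh_eq_sinh_div_cosh, tanh_eq_sinh_div_cosh, div_lt_div_iff₀ (cosh_pos p) (cosh_pos q)]
  have := sinh_pos_iff.2 (sub_pos.2 h)
  rw [sinh_sub] at this
  linarith

lemma tanh_pos {z : ℝ} (hz : 0 < z) : 0 < tanh z := by
  simpa using tanh_lt_tanh hz

lemma half_le_tanh {z : ℝ} (h0 : 0 ≤ z) (h1 : z ≤ 1) : z / 2 ≤ tanh z := by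
  have h := tanh_mul_le_tanh_mul h0 h1
  have h2 : 1 / 2 ≤ tanh 1 := by
    have he := Real.exp_one_gt_d9
    have h3 : exp 1 * exp (-1) = 1 := by rw [← exp_add]; simp
    have h4 := exp_pos (-1)
    rw [tanh_eq, le_div_iff₀ (by positivity)]
    nlinarith
  nlinarith

/-- For `h = ±1` the right side equals `exp (h z) / cosh z`, and `cosh z ≤ exp (z² / 2)`. Convexity
of `exp`, with weight `|h|` against the point `0`, covers the remaining `h`. -/
lemma exp_le_one_add_mul_tanh {h : ℝ} (hh : |h| ≤ 1) (z : ℝ) :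
    exp (h * z - |h| * (z ^ 2 / 2)) ≤ 1 + h * tanh z := by
  have key : ∀ s : ℝ, s = 1 ∨ s = -1 → exp (s * z - z ^ 2 / 2) ≤ 1 + s * tanh z := by
    intro s hs
    have h1 : 1 + s * tanh z = exp (s * z) / cosh z := by
      rw [tanh_eq_sinh_div_cosh, eq_div_iff (cosh_pos z).ne', add_mul, mul_assoc,
        div_mul_cancel₀ _ (cosh_pos z).ne']
      rcases hs with rfl | rfl
      · rw [one_mul, one_mul, one_mul, cosh_add_sinh]
      · rw [neg_one_mul, one_mul, neg_one_mul, ← sub_eq_add_neg, cosh_sub_sinh]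
    rw [h1, exp_sub]
    exact div_le_div_of_nonneg_left (exp_pos _).le (cosh_pos z) (cosh_le_exp_half_sq z)
  have conv : ∀ s : ℝ, s = 1 ∨ s = -1 → exp (|h| * (s * z - z ^ 2 / 2))
      ≤ 1 + |h| * (s * tanh z) := by
    intro s hs
    have h1 := convexOn_exp.2 (Set.mem_univ (s * z - z ^ 2 / 2)) (Set.mem_univ 0)
      (abs_nonneg h) (sub_nonneg.2 hh) (by ring)
    simp only [smul_eq_mul, mul_zero, add_zero, exp_zero, mul_one] at h1
    have := mul_le_mul_of_nonneg_left (key s hs) (abs_nonneg h)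
    linarith
  rcases le_total 0 h with h0 | h0
  · have := conv 1 (Or.inl rfl)
    rw [abs_of_nonneg h0] at this ⊢
    convert this using 2 <;> ring
  · have := conv (-1) (Or.inr rfl)
    rw [abs_of_nonpos h0] at this ⊢
    convert this using 2 <;> ring

/-- The exponential potential of the bettor with adaptive bets. -/
def expPotential (x D : ℝ) : ℝ := exp (x ^ 2 / (2 * D)) / D ^ 2

lemma expPotential_pos {x D : ℝ} (hD : 0 < D) : 0 < expPotential x D := by
  rw [expPotential]; positivity

lemma expPotential_neg (x D : ℝ) : expPotential (-x) D = expPotential x D := by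
  rw [expPotential, expPotential, neg_sq]

lemma expPotential_anti {x D D' : ℝ} (hD : 0 < D) (h : D ≤ D') :
    expPotential x D' ≤ expPotential x D := by
  rw [expPotential, expPotential]
  refine div_le_div₀ (exp_pos _).le (exp_le_exp.2 ?_) (by positivity)
    (pow_le_pow_left₀ hD.le h 2)
  exact div_le_div_of_nonneg_left (sq_nonneg x) (by positivity) (by linarith)

/-- By `exp_le_one_add_mul_tanh` it suffices to compare exponents. They differ by at most `2 |h| /
D'` with `D' = D + |h|`, and the factor `1 / D²` of the potential pays for this because `log (D' /
D) ≥ |h| / D'`. -/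
lemma expPotential_step {x D h : ℝ} (hD : 0 < D) (hx : |x| ≤ D) (hh : |h| ≤ 1) :
    expPotential (x + h) (D + |h|) ≤ expPotential x D * (1 + h * tanh (x / D)) := by
  set D' := D + |h| with hD'
  have hD'0 : 0 < D' := by positivity
  set z := x / D with hz
  have hxz : x = z * D := by rw [hz, div_mul_cancel₀ _ hD.ne']
  have hz1 : |z| ≤ 1 := by rw [hz, abs_div, abs_of_pos hD]; exact (div_le_one hD).2 hx
  have h1 := exp_le_one_add_mul_tanh hh z
  have h2 : expPotential (x + h) D' ≤ expPotential x D * exp (h * z - |h| * (z ^ 2 / 2)) := by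
    have hlog : |h| / D' ≤ log (D' / D) := by
      have := Real.one_sub_inv_le_log_of_pos (x := D' / D) (by positivity)
      refine le_trans (le_of_eq ?_) this
      rw [inv_div, hD']; field_simp; ring
    have hsq : (D' / D) ^ 2 = exp (2 * log (D' / D)) := by
      rw [two_mul, exp_add, exp_log (by positivity)]; ring
    have hkey : (x + h) ^ 2 / (2 * D') ≤ x ^ 2 / (2 * D) + (h * z - |h| * (z ^ 2 / 2))
        + 2 * log (D' / D) := by
      have hb : (x + h) ^ 2 / (2 * D') - x ^ 2 / (2 * D) - (h * z - |h| * (z ^ 2 / 2))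
          ≤ 2 * (|h| / D') := by
        have e : (x + h) ^ 2 / (2 * D') - x ^ 2 / (2 * D) - (h * z - |h| * (z ^ 2 / 2))
            = (h ^ 2 / 2 - |h| * (h * z - |h| * (z ^ 2 / 2))) / D' := by
          have : |h| = D' - D := by rw [hD']; ring
          rw [this, hxz]; field_simp; ring
        rw [e]
        refine (div_le_div_of_nonneg_right ?_ hD'0.le).trans_eq (mul_div_assoc _ _ _)
        have a1 : h ^ 2 ≤ |h| := by rw [← sq_abs]; nlinarith [abs_nonneg h]
        have a2 : -(h * z) ≤ |h| := by
          have : |h * z| ≤ |h| := by rw [abs_mul]; exact mul_le_of_le_one_right (abs_nonneg _) hz1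
          linarith [neg_abs_le (h * z)]
        have a3 : z ^ 2 ≤ 1 := by rw [← sq_abs]; nlinarith [abs_nonneg z]
        have a4 : |h| * z ^ 2 ≤ 1 := by nlinarith [abs_nonneg h, sq_nonneg z]
        have a5 : |h| * (-(h * z) + |h| * z ^ 2 / 2) ≤ |h| * (1 + 1 / 2) :=
          mul_le_mul_of_nonneg_left (by linarith) (abs_nonneg h)
        nlinarith
      linarith
    have := exp_le_exp.2 hkey
    rw [exp_add, exp_add, ← hsq] at this
    rw [expPotential, expPotential, div_mul_eq_mul_div, div_le_div_iff₀ (by positivity)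
      (by positivity)]
    calc exp ((x + h) ^ 2 / (2 * D')) * D ^ 2
        ≤ exp (x ^ 2 / (2 * D)) * exp (h * z - |h| * (z ^ 2 / 2)) * (D' / D) ^ 2 * D ^ 2 :=
          mul_le_mul_of_nonneg_right this (by positivity)
      _ = _ := by rw [mul_assoc, ← mul_pow, div_mul_cancel₀ _ hD.ne']
  exact h2.trans (mul_le_mul_of_nonneg_left h1 (expPotential_pos hD).le)

/-- The state of a bettor whose bets are capped at `u`: it has wealth at least the potential at
some earlier point `(y, E)` at which the cap was active, and has grown at rate `u` since. -/
def Capped (u x D W : ℝ) : Prop :=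
  ∃ y E V : ℝ, 0 < y ∧ y ≤ x ∧ y ≤ E ∧ E ≤ D ∧ V + u * (x - y) ≤ W ∧
    expPotential y E ≤ V ∧ u ≤ tanh (y / E) * V

/-- Put `a = tanh (x / D)`, `b = tanh (y / E)` and `t = b (x - y)`. Linear growth of the wealth
together with `a W ≤ u ≤ b V` forces `a (1 + t) ≤ b`, hence `(x / D) (1 + t) ≤ y / E` by concavity
of `tanh`. As `x ≥ y`, this gives `D ≥ E (1 + t)`. The exponent of the potential has grown by at
most `log (1 + t)`, which the factor `1 / D²` absorbs, so the potential is no larger than at `(y,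
E)`. -/
lemma Capped.expPotential_le {u x D W : ℝ} (hu : 0 ≤ u) (h : Capped u x D W)
    (hW : tanh (x / D) * W ≤ u) : expPotential x D ≤ W := by
  obtain ⟨y, E, V, hy, hyx, hyE, hED, hVW, hFV, huV⟩ := h
  have hE : 0 < E := hy.trans_le hyE
  have hD : 0 < D := hE.trans_le hED
  have hx : 0 < x := hy.trans_le hyx
  have hV : 0 < V := (expPotential_pos hE).trans_le hFV
  have hΔ : 0 ≤ x - y := sub_nonneg.2 hyx
  have hVle : V ≤ W := by nlinarith [mul_nonneg hu hΔ]
  set a := tanh (x / D) with ha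
  set b := tanh (y / E) with hb
  have ha0 : 0 < a := tanh_pos (by positivity)
  have hb0 : 0 < b := tanh_pos (by positivity)
  have hu0 : 0 < u := (mul_pos ha0 (hV.trans_le hVle)).trans_le hW
  have h1 : a * V + a * (x - y) * u ≤ u := by
    have := mul_le_mul_of_nonneg_left hVW ha0.le
    nlinarith
  have hab : a * (1 + b * (x - y)) ≤ b := by
    have haΔ : 0 < 1 - a * (x - y) := by
      by_contra! hc
      have : 0 < a * V := mul_pos ha0 hV
      nlinarith
    have h2 : a * V ≤ b * V * (1 - a * (x - y)) := by
      have := mul_le_mul_of_nonneg_right huV haΔ.le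
      linarith
    have h3 : a ≤ b * (1 - a * (x - y)) := by
      by_contra! hc
      have := mul_lt_mul_of_pos_right hc hV
      linarith
    linarith
  set t := b * (x - y) with ht
  have ht0 : 0 ≤ t := mul_nonneg hb0.le hΔ
  set p := x / D with hp
  set q := y / E with hq
  have hp0 : 0 < p := by positivity
  have hq0 : 0 < q := by positivity
  have hpq : p ≤ q := by
    by_contra! hc
    have := tanh_lt_tanh hc
    nlinarith
  have hpt : p * (1 + t) ≤ q := by
    have h4 := tanh_mul_le_tanh_mul hp0.le hpq
    have h5 : b * p * (1 + t) ≤ a * (1 + t) * q := by nlinarith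
    have h6 : b * (p * (1 + t)) ≤ b * q := by nlinarith
    exact le_of_mul_le_mul_left h6 hb0
  have hDE : E * (1 + t) ≤ D := by
    have h7 : x * (1 + t) * E ≤ y * D := by
      rw [hp, hq, div_mul_eq_mul_div, div_le_div_iff₀ hD hE] at hpt
      exact hpt
    have h8 : x * (E * (1 + t)) ≤ x * D := by nlinarith
    exact le_of_mul_le_mul_left h8 hx
  have hq2 : q / 2 ≤ b := half_le_tanh hq0.le ((div_le_one hE).2 hyE)
  have hexp : x ^ 2 / (2 * D) ≤ y ^ 2 / (2 * E) + log (1 + t) := by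
    have e1 : x ^ 2 / (2 * D) = x * p / 2 := by rw [hp]; field_simp
    have e2 : y ^ 2 / (2 * E) = y * q / 2 := by rw [hq]; field_simp
    have hl := Real.one_sub_inv_le_log_of_pos (x := 1 + t) (by linarith)
    have e3 : 1 - (1 + t)⁻¹ = t / (1 + t) := by field_simp; ring
    rw [e3] at hl
    have h9 : p ≤ q / (1 + t) := by rw [le_div_iff₀ (by linarith)]; exact hpt
    have h10 : x * p / 2 ≤ y * q / 2 + t / (1 + t) := by
      have h11 : x * p ≤ x * (q / (1 + t)) := mul_le_mul_of_nonneg_left h9 hx.le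
      have h12 : x * (q / (1 + t)) ≤ y * q + 2 * (t / (1 + t)) := by
        have e4 : 2 * (t / (1 + t)) * (1 + t) = 2 * t := by field_simp
        rw [← mul_div_assoc x, div_le_iff₀ (by linarith), add_mul, e4]
        have h13 : q / 2 * (x - y) ≤ t := mul_le_mul_of_nonneg_right hq2 hΔ
        have h14 : 0 ≤ y * q * t := by positivity
        nlinarith
      linarith
    rw [e1, e2]; linarith
  have hF : expPotential x D ≤ expPotential y E := by
    rw [expPotential, expPotential, div_le_div_iff₀ (by positivity) (by positivity)]
    have h15 := exp_le_exp.2 hexp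
    rw [exp_add, exp_log (by linarith)] at h15
    have h16 : (E * (1 + t)) ^ 2 ≤ D ^ 2 := pow_le_pow_left₀ (by positivity) hDE 2
    have h17 : E ^ 2 * (1 + t) ≤ D ^ 2 := by
      have : E ^ 2 * (1 + t) ≤ (E * (1 + t)) ^ 2 := by
        rw [mul_pow]
        exact mul_le_mul_of_nonneg_left (by nlinarith) (by positivity)
      linarith
    calc exp (x ^ 2 / (2 * D)) * E ^ 2 ≤ exp (y ^ 2 / (2 * E)) * (1 + t) * E ^ 2 :=
          mul_le_mul_of_nonneg_right h15 (by positivity)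
      _ = exp (y ^ 2 / (2 * E)) * (E ^ 2 * (1 + t)) := by ring
      _ ≤ _ := mul_le_mul_of_nonneg_left h17 (exp_pos _).le
  linarith

/-- If the sum stays above `y`, the same witness works. If it drops below, only the part of length
`r ≤ |h|` beneath `y` matters: it is an unclipped step from `(y, E)` with outcome `-r`, and there
the clipped bet `u` loses no more than the unclipped bet `tanh (y / E) V`. -/
lemma Capped.step {u x D W h : ℝ} (hc : Capped u x D W) (hh : |h| ≤ 1) :
    Capped u (x + h) (D + |h|) (W + h * u) ∨ expPotential (x + h) (D + |h|) ≤ W + h * u := by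
  obtain ⟨y, E, V, hy, hyx, hyE, hED, hVW, hFV, huV⟩ := hc
  have hE : 0 < E := hy.trans_le hyE
  by_cases hyx' : y ≤ x + h
  · exact Or.inl ⟨y, E, V, hy, hyx', hyE, hED.trans (by linarith [abs_nonneg h]),
      by linarith, hFV, huV⟩
  · right
    push Not at hyx'
    set r := y - (x + h) with hr
    have hr0 : 0 < r := by rw [hr]; linarith
    have hrh : r ≤ |h| := by linarith [neg_abs_le h]
    have hr1 : |-r| ≤ 1 := by rw [abs_neg, abs_of_pos hr0]; linarith
    have hs := expPotential_step hE (by rwa [abs_of_pos hy]) hr1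
    rw [abs_neg, abs_of_pos hr0] at hs
    have e : y + -r = x + h := by rw [hr]; ring
    rw [e] at hs
    have h1 : expPotential (x + h) (D + |h|) ≤ expPotential (x + h) (E + r) :=
      expPotential_anti (by positivity) (by linarith)
    have h2 : expPotential y E * (1 + -r * tanh (y / E)) ≤ V * (1 + -r * tanh (y / E)) := by
      refine mul_le_mul_of_nonneg_right hFV ?_
      have := tanh_lt_one (y / E)
      have := tanh_pos (div_pos hy hE)
      nlinarith
    have h3 : r * u ≤ r * (tanh (y / E) * V) := mul_le_mul_of_nonneg_left huV hr0.le
    have h4 : W + h * u ≥ V - r * u := by rw [hr]; linarith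
    linarith

section Clipped

variable {T : ℕ} {h b : ℕ → ℝ} {l u : ℝ}

/-- The sum of the first `n` outcomes. -/
def outcomeSum (h : ℕ → ℝ) (n : ℕ) : ℝ := ∑ i ∈ range n, h i

/-- One plus the sum of the absolute values of the first `n` outcomes. -/
def outcomeScale (h : ℕ → ℝ) (n : ℕ) : ℝ := 1 + ∑ i ∈ range n, |h i|

/-- The wealth after `n` rounds of the bettor with bets `b`. -/
def betWealth (h b : ℕ → ℝ) (n : ℕ) : ℝ := 1 + ∑ i ∈ range n, h i * b i

lemma abs_outcomeSum_le (h : ℕ → ℝ) (n : ℕ) : |outcomeSum h n| ≤ outcomeScale h n - 1 := by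
  rw [outcomeSum, outcomeScale, add_sub_cancel_left]
  exact abs_sum_le_sum_abs _ _

lemma one_le_outcomeScale (h : ℕ → ℝ) (n : ℕ) : 1 ≤ outcomeScale h n :=
  le_add_of_nonneg_right (sum_nonneg fun _ _ => abs_nonneg _)

/-- The wealth of a bettor with bets clipped to `[-l, u]` dominates the exponential potential,
or the bettor is capped. -/
lemma clipped_invariant (hl : 0 ≤ l) (hu : 0 ≤ u) (hh : ∀ n < T, |h n| ≤ 1)
    (hb : ∀ n < T, b n = max (-l) (min u
      (tanh (outcomeSum h n / outcomeScale h n) * betWealth h b n))) {n : ℕ} (hn : n ≤ T) :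
    expPotential (outcomeSum h n) (outcomeScale h n) ≤ betWealth h b n ∨
      Capped u (outcomeSum h n) (outcomeScale h n) (betWealth h b n) ∨
      Capped l (-outcomeSum h n) (outcomeScale h n) (betWealth h b n) := by
  induction n with
  | zero => left; simp [expPotential, outcomeSum, outcomeScale, betWealth]
  | succ n ih =>
    have ih := ih (by omega)
    have hhn := hh n (by omega)
    have hbn := hb n (by omega)
    have hx := abs_outcomeSum_le h n
    have hD := one_le_outcomeScale h n
    have ex : outcomeSum h (n + 1) = outcomeSum h n + h n := sum_range_succ _ _
    have eD : outcomeScale h (n + 1) = outcomeScale h n + |h n| := by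
      rw [outcomeScale, sum_range_succ, outcomeScale, add_assoc]
    have eW : betWealth h b (n + 1) = betWealth h b n + h n * b n := by
      rw [betWealth, sum_range_succ, betWealth, add_assoc]
    rw [ex, eD, eW]
    set x := outcomeSum h n
    set D := outcomeScale h n
    set W := betWealth h b n
    have hD0 : 0 < D := by linarith
    by_cases h1 : tanh (x / D) * W ≤ u
    · by_cases h2 : -l ≤ tanh (x / D) * W
      · left
        have hbn' : b n = tanh (x / D) * W := by rw [hbn, min_eq_right h1, max_eq_right h2]
        -- The current bet is unclipped, so a cap on either side has just been released.
        have hF : expPotential x D ≤ W := by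
          rcases ih with ih | ih | ih
          · exact ih
          · exact ih.expPotential_le hu h1
          · rw [← expPotential_neg]
            refine ih.expPotential_le hl ?_
            rw [neg_div, tanh_neg]; linarith
        refine (expPotential_step hD0 (by linarith) hhn).trans ?_
        have hpos : 0 ≤ 1 + h n * tanh (x / D) := by
          have : |h n * tanh (x / D)| ≤ 1 := by
            rw [abs_mul]
            exact mul_le_one₀ hhn (abs_nonneg _) (abs_tanh_lt_one _).le
          linarith [neg_abs_le (h n * tanh (x / D))]
        calc _ ≤ W * (1 + h n * tanh (x / D)) := mul_le_mul_of_nonneg_right hF hpos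
          _ = _ := by rw [hbn']; ring
      · push Not at h2
        have hbn' : b n = -l := by rw [hbn, min_eq_right h1, max_eq_left h2.le]
        have hcap : x < 0 → expPotential x D ≤ W → Capped l (-x) D W := fun hx0 hF =>
          ⟨-x, D, W, by linarith, le_rfl, by linarith [neg_abs_le x], le_rfl, by simp,
            by rwa [expPotential_neg], by rw [neg_div, tanh_neg]; linarith⟩
        -- At positive wealth the desired bet has the sign of `x`, so clipping at `-l` occurs only
        -- for `x < 0`.
        have hsgn : 0 < W → x < 0 := fun hW => by
          by_contra! hc
          have : 0 ≤ tanh (x / D) := by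
            rcases hc.eq_or_lt with hc | hc
            · simp [← hc]
            · exact (tanh_pos (by positivity)).le
          nlinarith [mul_nonneg this hW.le]
        have hc : Capped l (-x) D W := by
          rcases ih with ih | ih | ih
          · exact hcap (hsgn ((expPotential_pos hD0).trans_le ih)) ih
          · have hF := ih.expPotential_le hu h1
            exact hcap (hsgn ((expPotential_pos hD0).trans_le hF)) hF
          · exact ih
        -- A cap at `-l` is a cap at `l` for the negated outcomes.
        have hstep := hc.step (h := -h n) (by rwa [abs_neg])
        have e1 : -x + -h n = -(x + h n) := by ring
        have e2 : W + -h n * l = W + h n * b n := by rw [hbn']; ring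
        rw [abs_neg, e1, e2, expPotential_neg] at hstep
        tauto
    · push Not at h1
      have hbn' : b n = u := by rw [hbn, min_eq_left h1.le, max_eq_right (by linarith)]
      have hcap : 0 < x → expPotential x D ≤ W → Capped u x D W := fun hx0 hF =>
        ⟨x, D, W, hx0, le_rfl, by linarith [le_abs_self x], le_rfl, by simp, hF, h1.le⟩
      have hsgn : 0 < W → 0 < x := fun hW => by
        by_contra! hc
        have : 0 ≤ tanh (-x / D) := by
          rcases hc.eq_or_lt with hc | hc
          · simp [hc]
          · exact (tanh_pos (div_pos (by linarith) hD0)).le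
        rw [neg_div, tanh_neg] at this
        nlinarith [mul_nonneg this hW.le]
      have hc : Capped u x D W := by
        rcases ih with ih | ih | ih
        · exact hcap (hsgn ((expPotential_pos hD0).trans_le ih)) ih
        · exact ih
        · have hF : expPotential (-x) D ≤ W := ih.expPotential_le hl (by
            rw [neg_div, tanh_neg]; linarith)
          rw [expPotential_neg] at hF
          exact hcap (hsgn ((expPotential_pos hD0).trans_le hF)) hF
      have hstep := hc.step hhn
      rw [hbn']
      tauto

/-- Let `N = (T + 1) U`. For `y ≤ 4 √(T log N)` the linear term alone obeys the bound. For larger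
`y`, `D ≤ 2T` gives `exp (y² / (2D)) ≥ N⁴ ≥ U T D²`, so the potential exceeds `u y`. -/
lemma mul_sub_expPotential_le {U u y D : ℝ} (hT : 1 ≤ T) (hu : 0 ≤ u) (huU : u ≤ U) (hU : 2 ≤ U)
    (hy : y ≤ T) (hD : 0 < D) (hDT : D ≤ T + 1) :
    u * y - expPotential y D ≤ 4 * U * √(log (((T : ℝ) + 1) * U)) * √T := by
  have hT1 : (1 : ℝ) ≤ T := by exact_mod_cast hT
  set N := ((T : ℝ) + 1) * U with hN
  have hN1 : 1 ≤ N := by rw [hN]; nlinarith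
  set R := √(log N) * √T with hR
  have hR0 : 0 ≤ R := by positivity
  rcases le_or_gt y (4 * R) with h | h
  · have h1 : u * y ≤ U * (4 * R) := by
      rcases le_total y 0 with hy0 | hy0
      · have := mul_nonneg hu (neg_nonneg.2 hy0)
        have : 0 ≤ U * (4 * R) := by positivity
        linarith
      · exact mul_le_mul huU h hy0 (by linarith)
    have := expPotential_pos (x := y) hD
    calc _ ≤ U * (4 * R) := by linarith
      _ = _ := by rw [hR]; ring
  · have hy0 : 0 < y := by linarith
    have hR2 : R ^ 2 = log N * T := by
      rw [hR, mul_pow, Real.sq_sqrt (Real.log_nonneg hN1), Real.sq_sqrt (by linarith)]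
    have h1 : 4 * log N ≤ y ^ 2 / (2 * D) := by
      rw [le_div_iff₀ (by positivity)]
      have h2 : (4 * R) ^ 2 ≤ y ^ 2 := pow_le_pow_left₀ (by positivity) h.le 2
      have h3 := Real.log_nonneg hN1
      have h4 : log N * D ≤ log N * (2 * T) := mul_le_mul_of_nonneg_left (by linarith) h3
      nlinarith
    have h5 : N ^ 4 ≤ exp (y ^ 2 / (2 * D)) := by
      have := exp_le_exp.2 h1
      have e : exp (4 * log N) = N ^ 4 := by
        rw [show 4 * log N = log N * (4 : ℕ) by push_cast; ring, Real.exp_mul,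
          exp_log (by linarith), Real.rpow_natCast]
      linarith
    have h6 : u * y ≤ expPotential y D := by
      rw [expPotential, le_div_iff₀ (by positivity)]
      have h7 : u * y ≤ U * T := mul_le_mul huU hy hy0.le (by linarith)
      have h8 : D ^ 2 ≤ ((T : ℝ) + 1) ^ 2 := pow_le_pow_left₀ hD.le hDT 2
      have h9 : u * y * D ^ 2 ≤ U * T * ((T : ℝ) + 1) ^ 2 :=
        mul_le_mul h7 h8 (by positivity) (by positivity)
      have h10 : U * T * ((T : ℝ) + 1) ^ 2 ≤ N ^ 2 * N ^ 2 := by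
        refine mul_le_mul ?_ ?_ (by positivity) (by positivity)
        · rw [hN]; nlinarith [mul_pos (by linarith : 0 < U) (by linarith : (0 : ℝ) < T)]
        · rw [hN, mul_pow]
          exact le_mul_of_one_le_right (by positivity) (by nlinarith)
      calc _ ≤ N ^ 2 * N ^ 2 := h9.trans h10
        _ = N ^ 4 := by ring
        _ ≤ _ := h5
    have : 0 ≤ 4 * U * √(log N) * √T := by positivity
    linarith

/-- While capped at `u`, the growth `u (x - y)` of the wealth cancels that of `u x`, so the
potential is needed only at the point `y`. While capped at `-l`, the outcome sum is negative and the
wealth positive, and nothing is left to prove. -/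
lemma clipped_regret_upper {U : ℝ} (hT : 1 ≤ T) (hl : 0 ≤ l) (hu : 0 ≤ u) (huU : u ≤ U)
    (hU : 2 ≤ U) (hh : ∀ n < T, |h n| ≤ 1)
    (hb : ∀ n < T, b n = max (-l) (min u
      (tanh (outcomeSum h n / outcomeScale h n) * betWealth h b n))) :
    u * outcomeSum h T - betWealth h b T ≤ 4 * U * √(log (((T : ℝ) + 1) * U)) * √T := by
  have hx := abs_outcomeSum_le h T
  have hD := one_le_outcomeScale h T
  have hDT : outcomeScale h T ≤ T + 1 := by
    have := sum_le_sum fun i (hi : i ∈ range T) => hh i (mem_range.1 hi)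
    rw [outcomeScale]
    simp at this
    linarith
  have hxT : outcomeSum h T ≤ T := by linarith [le_abs_self (outcomeSum h T)]
  rcases clipped_invariant hl hu hh hb le_rfl with hi | hi | hi
  · have := mul_sub_expPotential_le hT hu huU hU hxT (by linarith) hDT
    linarith
  · obtain ⟨y, E, V, hy, hyx, hyE, hED, hVW, hFV, -⟩ := hi
    have := mul_sub_expPotential_le hT hu huU hU (hyx.trans hxT) (hy.trans_le hyE) (hED.trans hDT)
    linarith
  · obtain ⟨y, E, V, hy, hyx, hyE, hED, hVW, hFV, -⟩ := hi
    have h1 : 0 < V := (expPotential_pos (hy.trans_le hyE)).trans_le hFV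
    have h2 : u * outcomeSum h T ≤ 0 := mul_nonpos_of_nonneg_of_nonpos hu (by linarith)
    have h3 : 0 ≤ l * (-outcomeSum h T - y) := mul_nonneg hl (by linarith)
    have : 0 ≤ 4 * U * √(log (((T : ℝ) + 1) * U)) * √T := by positivity
    linarith

/-- Negating outcomes and bets exchanges `l` and `u`. -/
lemma clipped_regret_lower {U : ℝ} (hT : 1 ≤ T) (hl : 0 ≤ l) (hu : 0 ≤ u) (hlU : l ≤ U)
    (hU : 2 ≤ U) (hh : ∀ n < T, |h n| ≤ 1)
    (hb : ∀ n < T, b n = max (-l) (min u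
      (tanh (outcomeSum h n / outcomeScale h n) * betWealth h b n))) :
    -(l * outcomeSum h T) - betWealth h b T ≤ 4 * U * √(log (((T : ℝ) + 1) * U)) * √T := by
  have e1 : ∀ n, outcomeSum (fun i => -h i) n = -outcomeSum h n := fun n => by
    simp [outcomeSum]
  have e2 : ∀ n, outcomeScale (fun i => -h i) n = outcomeScale h n := fun n => by
    simp [outcomeScale]
  have e3 : ∀ n, betWealth (fun i => -h i) (fun i => -b i) n = betWealth h b n := fun n => by
    simp [betWealth]
  have := clipped_regret_upper (h := fun i => -h i) (b := fun i => -b i) hT hu hl hlU hU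
    (by simpa using hh) (fun n hn => by
      simp only [e1, e2, e3, neg_div, tanh_neg]
      rw [hb n hn, neg_mul, max_comm, ← min_neg_neg, neg_neg, ← max_neg_neg, max_comm,
        min_max_distrib_right, min_eq_left (by linarith : -u ≤ l), min_comm l, max_comm,
        max_comm])
  rw [e1, e3] at this
  linarith

end Clipped

end CoinBetting

/-! ### Least squares on a coreset. -/

section LeastSquares

open Finset Matrix

variable {Z : Type*} {d : ℕ} {φ : Z → Fin d → ℝ} {C : Finset Z} {wt : Z → ℝ}

lemma IsLeastSquares.normal_equation {q : Z → ℝ} {θ : Fin d → ℝ}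
    (h : IsLeastSquares φ C wt q θ) (v : Fin d → ℝ) :
    ∑ z ∈ C, wt z * (θ ⬝ᵥ φ z) * (v ⬝ᵥ φ z) = ∑ z ∈ C, wt z * q z * (v ⬝ᵥ φ z) := by
  set a := ∑ z ∈ C, wt z * (v ⬝ᵥ φ z) ^ 2 with ha
  set b := ∑ z ∈ C, wt z * (θ ⬝ᵥ φ z) * (v ⬝ᵥ φ z) - ∑ z ∈ C, wt z * q z * (v ⬝ᵥ φ z) with hb
  have key : ∀ t : ℝ, 0 ≤ 2 * t * b + t ^ 2 * a := by
    intro t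
    have h1 := h (θ + t • v)
    have h2 : ∑ z ∈ C, wt z * ((θ + t • v) ⬝ᵥ φ z - q z) ^ 2
        = ∑ z ∈ C, wt z * (θ ⬝ᵥ φ z - q z) ^ 2 + (2 * t * b + t ^ 2 * a) := by
      rw [hb, ha, mul_sub, mul_sum, mul_sum, mul_sum, ← sum_sub_distrib, ← sum_add_distrib,
        ← sum_add_distrib]
      refine sum_congr rfl fun z _ => ?_
      rw [add_dotProduct, smul_dotProduct, smul_eq_mul]
      ring
    linarith
  have hb0 : b = 0 := by
    by_contra hne
    have hb2 : 0 < b ^ 2 := by positivity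
    -- Damping by `1 + |a|` instead of `a` avoids a separate case `a = 0`.
    have h1 := key (-b / (1 + |a|))
    have hp : 0 < 1 + |a| := by positivity
    have h2 : 2 * (-b / (1 + |a|)) * b + (-b / (1 + |a|)) ^ 2 * a
        = b ^ 2 * (a - 2 * (1 + |a|)) / (1 + |a|) ^ 2 := by field_simp; ring
    rw [h2, le_div_iff₀ (by positivity), zero_mul] at h1
    nlinarith [le_abs_self a, abs_nonneg a]
  linarith

lemma dotProduct_gramMatrix_mulVec (u v : Fin d → ℝ) :
    u ⬝ᵥ (gramMatrix φ C wt *ᵥ v) = ∑ z ∈ C, wt z * (u ⬝ᵥ φ z) * (v ⬝ᵥ φ z) := by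
  rw [gramMatrix, sum_mulVec, dotProduct_sum]
  refine sum_congr rfl fun z _ => ?_
  rw [smul_mulVec, dotProduct_smul, vecMulVec_mulVec, smul_eq_mul, op_smul_eq_smul,
    dotProduct_smul, smul_eq_mul, dotProduct_comm (φ z) v]
  ring

/-- The matrix `P = 1 - G Gd` is symmetric and `P G = 0`, so the quadratic form of `G` vanishes at
every `P v`. Each of its summands is nonnegative, so `P` kills the features of positive weight and
hence their span. -/
lemma gramMatrix_mul_pinv_mulVec {Gd : Matrix (Fin d) (Fin d) ℝ}
    (hG : IsPseudoinverse (gramMatrix φ C wt) Gd) (hwt : ∀ z ∈ C, 0 ≤ wt z) {x : Fin d → ℝ}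
    (hx : x ∈ Submodule.span ℝ (φ '' {z' | z' ∈ C ∧ 0 < wt z'})) :
    gramMatrix φ C wt *ᵥ (Gd *ᵥ x) = x := by
  set G := gramMatrix φ C wt with hGdef
  set P := 1 - G * Gd with hP
  have hPG : P * G = 0 := by rw [hP, sub_mul, one_mul, hG.mul_mul_left, sub_self]
  have hPt : Pᵀ = P := by rw [hP, transpose_sub, transpose_one, hG.symm_left]
  have hPz : ∀ z ∈ C, 0 < wt z → P *ᵥ φ z = 0 := by
    intro z hz hwz
    have h1 : ∀ v : Fin d → ℝ, v ⬝ᵥ (P *ᵥ φ z) = 0 := by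
      intro v
      have h2 : (P *ᵥ v) ⬝ᵥ (G *ᵥ (P *ᵥ v)) = 0 := by
        rw [dotProduct_comm, dotProduct_mulVec, ← mulVec_transpose, hPt, mulVec_mulVec, hPG]
        simp
      rw [hGdef, dotProduct_gramMatrix_mulVec] at h2
      have h3 := (sum_eq_zero_iff_of_nonneg fun z hz => by
        rw [mul_assoc]; exact mul_nonneg (hwt z hz) (mul_self_nonneg _)).1 h2 z hz
      rw [mul_assoc] at h3
      have h4 := mul_self_eq_zero.1 ((mul_eq_zero.1 h3).resolve_left hwz.ne')
      rwa [dotProduct_mulVec, ← mulVec_transpose, hPt]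
    exact dotProduct_self_eq_zero.1 (h1 _)
  have hPx : P *ᵥ x = 0 := by
    refine Submodule.span_induction (p := fun y _ => P *ᵥ y = 0) ?_ (by simp) ?_ ?_ hx
    · rintro _ ⟨z, ⟨hz, hwz⟩, rfl⟩
      exact hPz z hz hwz
    · intro y y' _ _ h h'
      rw [mulVec_add, h, h', add_zero]
    · intro a y _ h
      rw [mulVec_smul, h, smul_zero]
  rw [hP, sub_mulVec, one_mulVec, sub_eq_zero] at hPx
  rw [mulVec_mulVec, ← hPx]

lemma IsCoreset.dim_pos (hC : IsCoreset φ C wt) : 0 < d := by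
  rcases Nat.eq_zero_or_pos d with rfl | h
  · have h1 := hC.card_le
    have h2 : C = ∅ := card_eq_zero.1 (by omega)
    have h3 := hC.wt_sum
    rw [h2] at h3
    simp at h3
  · exact h

/-- Least squares predictions on a coreset amplify the sup-norm error of the targets by at most
`√d`. -/
lemma IsCoreset.abs_dotProduct_sub_le (hC : IsCoreset φ C wt) {Q q : Z → ℝ} {θ θ' : Fin d → ℝ}
    (hθ : IsLeastSquares φ C wt q θ) {e y : ℝ} (he : ∀ z, |Q z - θ' ⬝ᵥ φ z| ≤ e)
    (hy : ∀ z ∈ C, |q z - Q z| ≤ y) (x : Z) :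
    |θ ⬝ᵥ φ x - Q x| ≤ e * (1 + √d) + √d * y := by
  obtain ⟨Gd, hG, hn⟩ := hC.norm_le
  have hd : (0 : ℝ) < d := by exact_mod_cast hC.dim_pos
  set v := Gd *ᵥ φ x with hv
  have hGv : gramMatrix φ C wt *ᵥ v = φ x :=
    gramMatrix_mul_pinv_mulVec hG hC.wt_nonneg (hC.mem_span x)
  -- The normal equations tested against `v` show that the prediction at `x` is linear in the
  -- targets, with coefficients `ω(z) ⟨v, φ(z)⟩`.
  have h1 : θ ⬝ᵥ φ x = ∑ z ∈ C, wt z * q z * (v ⬝ᵥ φ z) := by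
    rw [← hθ.normal_equation, ← dotProduct_gramMatrix_mulVec, hGv]
  have h2 : θ' ⬝ᵥ φ x = ∑ z ∈ C, wt z * (θ' ⬝ᵥ φ z) * (v ⬝ᵥ φ z) := by
    rw [← dotProduct_gramMatrix_mulVec, hGv]
  have h3 : ∑ z ∈ C, wt z * (v ⬝ᵥ φ z) ^ 2 ≤ d := by
    have h4 : v ⬝ᵥ (gramMatrix φ C wt *ᵥ v) = ∑ z ∈ C, wt z * (v ⬝ᵥ φ z) ^ 2 := by
      rw [dotProduct_gramMatrix_mulVec]
      exact sum_congr rfl fun z _ => by ring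
    rw [← h4, hGv, dotProduct_comm]
    exact (Real.sqrt_le_sqrt_iff hd.le).1 (hn x)
  have hsd : 0 < √(d : ℝ) := Real.sqrt_pos.2 hd
  -- Cauchy-Schwarz in the form `|a| ≤ a² / (2√d) + √d / 2`, summed against weights of total mass
  -- one.
  have h5 : ∑ z ∈ C, wt z * |v ⬝ᵥ φ z| ≤ √d := by
    have h6 : ∀ z ∈ C, wt z * |v ⬝ᵥ φ z|
        ≤ (2 * √d)⁻¹ * (wt z * (v ⬝ᵥ φ z) ^ 2) + √d / 2 * wt z := by
      intro z hz
      have h7 : |v ⬝ᵥ φ z| ≤ (2 * √d)⁻¹ * (v ⬝ᵥ φ z) ^ 2 + √d / 2 := by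
        rw [← sq_abs (v ⬝ᵥ φ z), ← sub_nonneg]
        have : (2 * √d)⁻¹ * |v ⬝ᵥ φ z| ^ 2 + √d / 2 - |v ⬝ᵥ φ z|
          = (2 * √d)⁻¹ * (|v ⬝ᵥ φ z| - √d) ^ 2 := by field_simp; ring
        rw [this]; positivity
      have := mul_le_mul_of_nonneg_left h7 (hC.wt_nonneg z hz)
      linarith
    refine (sum_le_sum h6).trans ?_
    rw [sum_add_distrib, ← mul_sum, ← mul_sum, hC.wt_sum]
    have h8 := mul_le_mul_of_nonneg_left h3 (by positivity : 0 ≤ (2 * √(d : ℝ))⁻¹)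
    have h9 : (2 * √(d : ℝ))⁻¹ * d = √d / 2 := by
      nth_rewrite 2 [← Real.mul_self_sqrt hd.le]
      field_simp
    linarith
  have h10 : |θ ⬝ᵥ φ x - θ' ⬝ᵥ φ x| ≤ (e + y) * √d := by
    rw [h1, h2, ← sum_sub_distrib]
    refine (abs_sum_le_sum_abs _ _).trans ?_
    have h11 : ∀ z ∈ C, |wt z * q z * (v ⬝ᵥ φ z) - wt z * (θ' ⬝ᵥ φ z) * (v ⬝ᵥ φ z)|
        ≤ (e + y) * (wt z * |v ⬝ᵥ φ z|) := by
      intro z hz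
      have h12 : wt z * q z * (v ⬝ᵥ φ z) - wt z * (θ' ⬝ᵥ φ z) * (v ⬝ᵥ φ z)
        = (q z - θ' ⬝ᵥ φ z) * (wt z * (v ⬝ᵥ φ z)) := by ring
      rw [h12, abs_mul, abs_mul, abs_of_nonneg (hC.wt_nonneg z hz)]
      refine mul_le_mul_of_nonneg_right ?_ (mul_nonneg (hC.wt_nonneg z hz) (abs_nonneg _))
      have := abs_sub_le (q z) (Q z) (θ' ⬝ᵥ φ z)
      linarith [he z, hy z hz]
    have hey : 0 ≤ e + y := by
      obtain ⟨z, hz⟩ : C.Nonempty := by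
        rw [nonempty_iff_ne_empty]
        rintro rfl
        simpa using hC.wt_sum
      exact add_nonneg ((abs_nonneg _).trans (he z)) ((abs_nonneg _).trans (hy z hz))
    refine (sum_le_sum h11).trans ?_
    rw [← mul_sum]
    exact mul_le_mul_of_nonneg_left h5 hey
  have h13 := abs_sub_le (θ ⬝ᵥ φ x) (θ' ⬝ᵥ φ x) (Q x)
  have h14 := he x
  rw [abs_sub_comm] at h14
  linarith

/-- If `Q` is `ε`-close to the span of the features, least squares on a coreset with targets that
are `y`-close to `Q` predicts `Q` up to `ε (1 + √d) + √d y`. -/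
lemma IsCoreset.abs_dotProduct_sub_le_of_iInf_le (hC : IsCoreset φ C wt) {Q q : Z → ℝ}
    {θ : Fin d → ℝ} (hθ : IsLeastSquares φ C wt q θ) {ε y : ℝ} (hε : 0 ≤ ε)
    (hQ : (⨅ θ' : Fin d → ℝ, ⨆ z, ENNReal.ofReal |Q z - θ' ⬝ᵥ φ z|) ≤ ENNReal.ofReal ε)
    (hy : ∀ z ∈ C, |q z - Q z| ≤ y) (x : Z) :
    |θ ⬝ᵥ φ x - Q x| ≤ ε * (1 + √d) + √d * y := by
  -- The infimum over `θ'` need not be attained, hence a slack `η`, scaled to cancel `1 + √d`.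
  refine le_of_forall_pos_le_add fun η hη => ?_
  have hd : 0 < 1 + √(d : ℝ) := by positivity
  have h1 : (⨅ θ' : Fin d → ℝ, ⨆ z, ENNReal.ofReal |Q z - θ' ⬝ᵥ φ z|)
      < ENNReal.ofReal (ε + η / (1 + √d)) :=
    hQ.trans_lt ((ENNReal.ofReal_lt_ofReal_iff (by positivity)).2 (by
      have : 0 < η / (1 + √d) := by positivity
      linarith))
  obtain ⟨θ', hθ'⟩ := iInf_lt_iff.1 h1
  have h2 : ∀ z, |Q z - θ' ⬝ᵥ φ z| ≤ ε + η / (1 + √d) := fun z =>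
    (ENNReal.ofReal_le_ofReal_iff (by positivity)).1
      ((le_iSup (fun z => ENNReal.ofReal |Q z - θ' ⬝ᵥ φ z|) z).trans hθ'.le)
  refine (hC.abs_dotProduct_sub_le hθ h2 hy x).trans (le_of_eq ?_)
  field_simp
  ring

end LeastSquares

/-! ### Regret of a run: truncated estimates, primal and dual regret, Lagrangian gap. -/

namespace CMDP

variable {S A : Type*} (M : CMDP S A) {d : ℕ} (φ : S × A → Fin d → ℝ)

lemma qHat_mem (θ : Fin d → ℝ) (s : S) (a : A) : M.qHat φ θ s a ∈ Set.Icc 0 M.horizon :=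
  ⟨le_max_left _ _, max_le M.horizon_pos.le (min_le_left _ _)⟩

lemma abs_qHat_le (θ : Fin d → ℝ) (s : S) (a : A) : |M.qHat φ θ s a| ≤ M.horizon :=
  abs_le_of_mem (M.qHat_mem φ θ s a)

lemma abs_qHat_sub_le {θ : Fin d → ℝ} {s : S} {a : A} {Q e : ℝ} (hQ : Q ∈ Set.Icc 0 M.horizon)
    (h : |θ ⬝ᵥ φ (s, a) - Q| ≤ e) : |M.qHat φ θ s a - Q| ≤ e := by
  obtain ⟨h1, h2⟩ := abs_le.1 h
  have he : 0 ≤ e := (abs_nonneg _).trans h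
  change |max 0 (min M.horizon (θ ⬝ᵥ φ (s, a))) - Q| ≤ e
  obtain ⟨h3, h4⟩ := hQ
  rw [abs_le]
  constructor
  · have : Q - e ≤ max 0 (min M.horizon (θ ⬝ᵥ φ (s, a))) :=
      le_max_of_le_right (le_min (by linarith) (by linarith))
    linarith
  · have : max 0 (min M.horizon (θ ⬝ᵥ φ (s, a))) ≤ Q + e :=
      max_le (by linarith) ((min_le_right _ _).trans (by linarith))
    linarith

end CMDP

namespace CMDP

open Finset

variable {S A : Type*} (M : CMDP S A)

/-- As `b ≥ 0`, `ζ ≤ 1 / (1 - γ)`. The bound serves the comparison in `mul_sub_expPotential_le`. -/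
lemma two_le_dualBound (hb : 0 ≤ M.b) (hζ : 0 < M.slater) (π : Policy S A) :
    2 ≤ M.dualBound := by
  have h1 := M.slater_le_horizon_sub π
  have h2 : M.slater * (1 - M.γ) ≤ 1 := by
    have := mul_le_mul_of_nonneg_left (by linarith : M.slater ≤ M.horizon) M.one_sub_pos.le
    linarith [M.one_sub_mul_horizon]
  rw [dualBound, le_div_iff₀ (mul_pos hζ M.one_sub_pos)]
  linarith

variable {d : ℕ} {φ : S × A → Fin d → ℝ}

/-- The estimated action value of the Lagrangian reward `r + lam * c`. -/
def lagHat (φ : S × A → Fin d → ℝ) (θr θc : Fin d → ℝ) (lam : ℝ) (s : S) (a : A) : ℝ :=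
  M.qHat φ θr s a + lam * M.qHat φ θc s a

lemma lagHat_mem (θr θc : Fin d → ℝ) {lam U : ℝ} (h0 : 0 ≤ lam) (hU : lam ≤ U) (s : S) (a : A) :
    M.lagHat φ θr θc lam s a ∈ Set.Icc 0 ((1 + U) * M.horizon) := by
  have h1 := M.qHat_mem φ θr s a
  have h2 := M.qHat_mem φ θc s a
  have h3 := mul_nonneg h0 h2.1
  have h4 := mul_le_mul hU h2.2 h2.1 (h0.trans hU)
  rw [lagHat]
  constructor <;> linarith [h1.1, h1.2]

lemma abs_lagHat_le (θr θc : Fin d → ℝ) {lam U : ℝ} (h0 : 0 ≤ lam) (hU : lam ≤ U) (s : S)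
    (a : A) : |M.lagHat φ θr θc lam s a| ≤ (1 + U) * M.horizon :=
  abs_le_of_mem (M.lagHat_mem θr θc h0 hU s a)

lemma advHat_eq (U : ℝ) (θr θc : Fin d → ℝ) (lam : ℝ) (π : Policy S A) (s : S) (a : A) :
    M.advHat φ U θr θc lam π s a = (1 - M.γ) / (1 + U)
      * (M.lagHat φ θr θc lam s a - (π s).expect (M.lagHat φ θr θc lam s)) := rfl

lemma expect_advHat {U : ℝ} (θr θc : Fin d → ℝ) {lam : ℝ} (h0 : 0 ≤ lam) (hU : lam ≤ U)
    (π : Policy S A) (s : S) (p : PMF A) : p.expect (M.advHat φ U θr θc lam π s)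
      = (1 - M.γ) / (1 + U) * (p.expect (M.lagHat φ θr θc lam s)
        - (π s).expect (M.lagHat φ θr θc lam s)) := by
  have hb := M.abs_lagHat_le (φ := φ) θr θc h0 hU s
  have hc : ∀ _ : A, |(π s).expect (M.lagHat φ θr θc lam s)|
    ≤ |(π s).expect (M.lagHat φ θr θc lam s)| := fun _ => le_rfl
  rw [funext (M.advHat_eq U θr θc lam π s), PMF.expect_mul_left, p.expect_sub hb hc,
    PMF.expect_const]

lemma abs_advHat_le {U : ℝ} (θr θc : Fin d → ℝ) {lam : ℝ} (h0 : 0 ≤ lam) (hU : lam ≤ U)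
    (π : Policy S A) (s : S) (a : A) : |M.advHat φ U θr θc lam π s a| ≤ 1 := by
  have h1 := M.lagHat_mem (φ := φ) θr θc h0 hU s a
  have h2 := (π s).expect_mem_Icc (M.lagHat_mem (φ := φ) θr θc h0 hU s)
  have hU0 : 0 < 1 + U := by linarith
  have h3 : |M.lagHat φ θr θc lam s a - (π s).expect (M.lagHat φ θr θc lam s)|
      ≤ (1 + U) * M.horizon := by
    rw [abs_le]; constructor <;> linarith [h1.1, h1.2, h2.1, h2.2]
  rw [advHat_eq, abs_mul, abs_of_nonneg (div_nonneg M.one_sub_pos.le hU0.le)]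
  refine (mul_le_mul_of_nonneg_left h3 (div_nonneg M.one_sub_pos.le hU0.le)).trans (le_of_eq ?_)
  have := M.one_sub_mul_horizon
  field_simp
  linarith

lemma JcHat_mem (θ : Fin d → ℝ) (π : Policy S A) : M.JcHat φ θ π ∈ Set.Icc 0 M.horizon :=
  PMF.expect_mem_Icc _ fun s => PMF.expect_mem_Icc _ (M.qHat_mem φ θ s)

/-- At states of zero occupancy the divergence may be infinite, so pointwise finiteness holds only
on the support. -/
lemma toReal_policyKL [MeasurableSpace A] {π π' : Policy S A} (h : M.policyKL π π' ≠ ⊤) :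
    HasSum (fun s => (M.occ π M.ρ s).toReal
      * (InformationTheory.klDiv (π s).toMeasure (π' s).toMeasure).toReal)
      (M.policyKL π π').toReal ∧
    ∀ s, M.occ π M.ρ s ≠ 0 →
      InformationTheory.klDiv (π s).toMeasure (π' s).toMeasure ≠ ⊤ := by
  have hne : ∀ s, M.occupancy π s * InformationTheory.klDiv (π s).toMeasure (π' s).toMeasure ≠ ⊤ :=
    fun s => ENNReal.ne_top_of_tsum_ne_top h s
  constructor
  · have h1 := ENNReal.summable_toReal h
    have h2 := ENNReal.tsum_toReal_eq hne
    rw [policyKL, h2]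
    simp only [ENNReal.toReal_mul, ← occ_apply] at h1 ⊢
    exact h1.hasSum
  · intro s hs htop
    have := hne s
    rw [htop, ← occ_apply, ENNReal.mul_top hs] at this
    exact this rfl

section Run

variable {C : Finset (S × A)} {wt : S × A → ℝ} {T : ℕ} {π₀ : Policy S A} {lam₀ : ℝ}
  {qr qc : ℕ → S × A → ℝ} {θr θc : ℕ → Fin d → ℝ} {w : ℕ → S → A → ℝ} {π : ℕ → Policy S A}
  {lam : ℕ → ℝ}

lemma IsCBPRun.lam_mem (hrun : M.IsCBPRun φ C wt T π₀ lam₀ qr qc θr θc w π lam)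
    (hU : 0 ≤ M.dualBound) (hlam₀ : lam₀ ∈ Set.Icc 0 M.dualBound) {t : ℕ} (ht : t ≤ T) :
    lam t ∈ Set.Icc 0 M.dualBound := by
  cases t with
  | zero => rw [hrun.lam_zero]; exact hlam₀
  | succ t =>
    rw [hrun.lam_succ t (by omega)]
    exact ⟨le_max_left _ _, max_le hU (min_le_left _ _)⟩

/-- The primal regret of the run against a policy, averaged over the occupancy measure. -/
lemma IsCBPRun.primal_regret [MeasurableSpace A] [DiscreteMeasurableSpace A]
    (hrun : M.IsCBPRun φ C wt T π₀ lam₀ qr qc θr θc w π lam)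
    (hU : 0 ≤ M.dualBound) (hlam₀ : lam₀ ∈ Set.Icc 0 M.dualBound) (hT : 1 ≤ T)
    {πstar : Policy S A} (hKL : M.policyKL πstar π₀ ≠ ⊤) :
    ∑ t ∈ range T, (M.occ πstar M.ρ).expect (fun s =>
        (πstar s).expect (M.lagHat φ (θr t) (θc t) (lam t) s)
          - (π t s).expect (M.lagHat φ (θr t) (θc t) (lam t) s))
      ≤ 3 * (1 + M.dualBound) * M.horizon * √(1 + (M.policyKL πstar π₀).toReal) * √T := by
  set U := M.dualBound with hUdef
  set K := (M.policyKL πstar π₀).toReal with hK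
  set ν := M.occ πstar M.ρ with hν
  have hT0 : (0 : ℝ) < T := by exact_mod_cast hT
  have hK0 : 0 ≤ K := ENNReal.toReal_nonneg
  have hl : ∀ t ∈ range T, lam t ∈ Set.Icc 0 U := fun t ht =>
    hrun.lam_mem M hU hlam₀ (mem_range.1 ht).le
  set h : ℕ → S → A → ℝ := fun t => M.advHat φ U (θr t) (θc t) (lam t) (π t) with hh
  set c : ℕ → S → A → ℝ := fun t s a => CoinBetting.coin (w t s a) (h t s a) with hc
  have hhb : ∀ t ∈ range T, ∀ s a, |h t s a| ≤ 1 := fun t ht s a =>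
    M.abs_advHat_le _ _ (hl t ht).1 (hl t ht).2 _ s a
  have hcb : ∀ t ∈ range T, ∀ s a, |c t s a| ≤ 1 := fun t ht s a =>
    CoinBetting.abs_coin_le (hhb t ht s a)
  have hSb : ∀ s a, |∑ t ∈ range T, c t s a| ≤ T := fun s a =>
    CoinBetting.abs_sum_range_le fun t ht => hcb t (mem_range.2 ht) s a
  have hS2 : ∀ s a, |(∑ t ∈ range T, c t s a) ^ 2| ≤ (T : ℝ) ^ 2 := fun s a => by
    rw [abs_pow]; exact pow_le_pow_left₀ (abs_nonneg _) (hSb s a) 2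
  have hw : ∀ s, ∀ t < T, ∀ a, w t s a = (∑ i ∈ range t, c i s a) / ((t : ℝ) + (T : ℝ) / 2)
      * (1 + ∑ i ∈ range t, c i s a * w i s a) := by
    intro s t ht a
    cases t with
    | zero => simp [hrun.w_zero]
    | succ t =>
      rw [hrun.w_succ t (by omega) s a]
      push_cast
      rfl
  have hπ : ∀ s, ∀ t < T, ∑' a', π₀ s a' * ENNReal.ofReal (w t s a') ≠ 0 → ∀ a, π t s a
      = π₀ s a * ENNReal.ofReal (w t s a) / ∑' a', π₀ s a' * ENNReal.ofReal (w t s a') := by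
    intro s t ht
    cases t with
    -- All bets are zero at time `0`, so the normaliser vanishes and the premise fails.
    | zero => simp [hrun.w_zero]
    | succ t => exact hrun.π_succ_of_ne_zero t (by omega) s
  have hcent : ∀ s, ∀ t < T, (π t s).expect (h t s) = 0 := by
    intro s t ht
    have hlt := hl t (mem_range.2 ht)
    rw [hh, M.expect_advHat _ _ hlt.1 hlt.2, sub_self, mul_zero]
  obtain ⟨hKs, hKf⟩ := M.toReal_policyKL hKL
  -- `R` balances `S ≤ S² / (2R) + R / 2`: the mean of `S²` is at most `(9T / 2) (K + 2) ≤ R²`, so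
  -- both terms contribute at most `R / 2`.
  set R := √(9 * T * (1 + K)) with hR
  have hR0 : 0 < R := Real.sqrt_pos.2 (by positivity)
  have hRR : R * R = 9 * T * (1 + K) := Real.mul_self_sqrt (by positivity)
  have hSν : ν.expect (fun s => (πstar s).expect fun a => ∑ t ∈ range T, c t s a) ≤ R := by
    have hpt : ∀ s, (ν s).toReal * (πstar s).expect (fun a => ∑ t ∈ range T, c t s a)
        ≤ (2 * R)⁻¹ * (9 / 2 * T) * ((ν s).toReal
            * (InformationTheory.klDiv (πstar s).toMeasure (π₀ s).toMeasure).toReal)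
          + (ν s).toReal * ((2 * R)⁻¹ * (9 * T) + R / 2) := by
      intro s
      by_cases hs : ν s = 0
      · simp [hs]
      have h1 := CoinBetting.expect_sq_sum_coin_le hT (hKf s hs) (h := fun t => h t s)
        (w := fun t => w t s) (π := fun t => π t s) (fun t ht => hhb t (mem_range.2 ht) s)
        (hcent s) (hw s) (hπ s)
      have h2 : (πstar s).expect (fun a => ∑ t ∈ range T, c t s a)
          ≤ (2 * R)⁻¹ * (πstar s).expect (fun a => (∑ t ∈ range T, c t s a) ^ 2) + R / 2 := by
        have hcR : ∀ _ : A, |R / 2| ≤ |R / 2| := fun _ => le_rfl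
        have hS2' : ∀ a, |(2 * R)⁻¹ * (∑ t ∈ range T, c t s a) ^ 2|
            ≤ |(2 * R)⁻¹| * (T : ℝ) ^ 2 := fun a => by
          rw [abs_mul]; exact mul_le_mul_of_nonneg_left (hS2 s a) (abs_nonneg _)
        rw [← (πstar s).expect_const (R / 2), ← PMF.expect_mul_left,
          ← (πstar s).expect_add hS2' hcR]
        refine (πstar s).expect_mono (hSb s)
          (fun a => (abs_add_le _ _).trans (add_le_add (hS2' a) (hcR a))) fun a => ?_
        set x := ∑ t ∈ range T, c t s a
        rw [← sub_nonneg]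
        have : (2 * R)⁻¹ * x ^ 2 + R / 2 - x = (2 * R)⁻¹ * (x - R) ^ 2 := by field_simp; ring
        rw [this]; positivity
      have h3 := h2.trans (add_le_add (mul_le_mul_of_nonneg_left h1
        (by positivity : 0 ≤ (2 * R)⁻¹)) le_rfl)
      refine (mul_le_mul_of_nonneg_left h3 ENNReal.toReal_nonneg).trans (le_of_eq ?_)
      ring
    have hsum := (hKs.mul_left ((2 * R)⁻¹ * (9 / 2 * T))).add
      (ν.hasSum_toReal.mul_right ((2 * R)⁻¹ * (9 * T) + R / 2))
    have hle := Summable.tsum_le_tsum hpt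
      (ν.summable_expect fun s => PMF.abs_expect_le _ (hSb s)) hsum.summable
    rw [hsum.tsum_eq] at hle
    refine hle.trans ?_
    have h4 : (2 * R)⁻¹ * (9 / 2 * T) * K + 1 * ((2 * R)⁻¹ * (9 * T) + R / 2)
        = (2 * R)⁻¹ * (9 / 2 * T * K + 9 * T) + R / 2 := by ring
    have h5 : (2 * R)⁻¹ * (9 / 2 * T * K + 9 * T) ≤ (2 * R)⁻¹ * (R * R) := by
      refine mul_le_mul_of_nonneg_left ?_ (by positivity)
      rw [hRR]
      nlinarith [mul_nonneg hT0.le hK0]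
    have h6 : (2 * R)⁻¹ * (R * R) = R / 2 := by field_simp
    rw [h4]
    linarith
  have hU0 : 0 < 1 + U := by linarith
  have hterm : ∀ t ∈ range T, ν.expect (fun s =>
        (πstar s).expect (M.lagHat φ (θr t) (θc t) (lam t) s)
          - (π t s).expect (M.lagHat φ (θr t) (θc t) (lam t) s))
      ≤ (1 + U) * M.horizon * ν.expect fun s => (πstar s).expect (c t s) := by
    intro t ht
    have h1 : ∀ s, (πstar s).expect (M.lagHat φ (θr t) (θc t) (lam t) s)
          - (π t s).expect (M.lagHat φ (θr t) (θc t) (lam t) s)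
        = (1 + U) * M.horizon * (πstar s).expect (h t s) := by
      intro s
      rw [hh, M.expect_advHat _ _ (hl t ht).1 (hl t ht).2, ← mul_assoc]
      have : (1 + U) * M.horizon * ((1 - M.γ) / (1 + U)) = 1 := by
        have := M.one_sub_mul_horizon
        field_simp
        linarith
      rw [this, one_mul]
    simp only [h1]
    rw [PMF.expect_mul_left]
    refine mul_le_mul_of_nonneg_left ?_ (mul_pos hU0 M.horizon_pos).le
    exact ν.expect_mono (fun s => PMF.abs_expect_le _ (hhb t ht s))
      (fun s => PMF.abs_expect_le _ (hcb t ht s)) fun s =>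
        PMF.expect_mono _ (hhb t ht s) (hcb t ht s) fun a => CoinBetting.le_coin _ _
  refine (sum_le_sum hterm).trans ?_
  rw [← mul_sum, ← ν.expect_sum _ fun t ht s => PMF.abs_expect_le _ (hcb t ht s)]
  have h7 : (fun s => ∑ t ∈ range T, (πstar s).expect (c t s))
      = fun s => (πstar s).expect fun a => ∑ t ∈ range T, c t s a := by
    funext s
    rw [(πstar s).expect_sum _ fun t ht => hcb t ht s]
  rw [h7]
  refine (mul_le_mul_of_nonneg_left hSν (mul_pos hU0 M.horizon_pos).le).trans (le_of_eq ?_)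
  have h8 : R = 3 * √(1 + K) * √T := by
    rw [hR, show 9 * (T : ℝ) * (1 + K) = 3 ^ 2 * ((1 + K) * T) by ring,
      Real.sqrt_mul (by norm_num), Real.sqrt_sq (by norm_num), Real.sqrt_mul (by linarith)]
    ring
  rw [h8]; ring

/-- The dual regret of the run against the endpoints of `[0, U]`. -/
lemma IsCBPRun.dual_regret (hrun : M.IsCBPRun φ C wt T π₀ lam₀ qr qc θr θc w π lam)
    (hb : M.b ∈ Set.Icc 0 M.horizon) (hU : 2 ≤ M.dualBound)
    (hlam₀ : lam₀ ∈ Set.Icc 0 M.dualBound) (hT : 1 ≤ T) {x : ℝ} (hx : x = 0 ∨ x = M.dualBound) :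
    ∑ t ∈ range T, (lam t - x) * (M.JcHat φ (θc t) (π t) - M.b)
      ≤ M.horizon * (√T * dualRegretConst M.dualBound T) := by
  set U := M.dualBound with hUdef
  have hT1 : (1 : ℝ) ≤ √T := Real.one_le_sqrt.2 (by exact_mod_cast hT)
  set g : ℕ → ℝ := fun t => M.JcHat φ (θc t) (π t) - M.b with hg
  -- The outcomes are scaled to `[-1, 1]` and negated, since `λ` is minimised over; with bets `λ_t -
  -- λ_0` the clipping interval is `[-λ_0, U - λ_0]`.
  set h : ℕ → ℝ := fun t => -((1 - M.γ) * g t) with hh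
  set b : ℕ → ℝ := fun t => lam t - lam₀ with hbdef
  have hγ := M.one_sub_pos
  have hγG := M.one_sub_mul_horizon
  have hGpos := M.horizon_pos
  have hgb : ∀ t, |g t| ≤ M.horizon := fun t => by
    have h1 := M.JcHat_mem (φ := φ) (θc t) (π t)
    rw [abs_le]; constructor <;> simp only [hg] <;> linarith [h1.1, h1.2, hb.1, hb.2]
  have hhabs : ∀ t, |h t| = (1 - M.γ) * |g t| := fun t => by
    rw [hh, abs_neg, abs_mul, abs_of_pos hγ]
  have hhb : ∀ t < T, |h t| ≤ 1 := fun t _ => by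
    rw [hhabs]; exact (mul_le_mul_of_nonneg_left (hgb t) hγ.le).trans_eq hγG
  have hbet : ∀ n < T, b n = max (-lam₀) (min (U - lam₀)
      (Real.tanh (CoinBetting.outcomeSum h n / CoinBetting.outcomeScale h n)
        * CoinBetting.betWealth h b n)) := by
    intro n hn
    cases n with
    | zero =>
      simp only [hbdef, hrun.lam_zero, CoinBetting.outcomeSum, range_zero, sum_empty, zero_div,
        Real.tanh_zero, zero_mul, sub_self]
      rw [min_eq_right (by linarith [hlam₀.2]), max_eq_right (by linarith [hlam₀.1])]
    | succ n =>
      have e1 : CoinBetting.outcomeSum h (n + 1) = -((1 - M.γ) * ∑ i ∈ range (n + 1), g i) := by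
        simp only [CoinBetting.outcomeSum, hh, sum_neg_distrib, mul_sum]
      have e2 : CoinBetting.outcomeScale h (n + 1)
          = (1 - M.γ) * (1 / (1 - M.γ) + ∑ i ∈ range (n + 1), |g i|) := by
        simp only [CoinBetting.outcomeScale, hhabs, ← mul_sum]
        rw [mul_add, mul_one_div_cancel hγ.ne']
      have e3 : CoinBetting.betWealth h b (n + 1)
          = (1 - M.γ) * (1 / (1 - M.γ) - ∑ i ∈ range (n + 1), (lam i - lam₀) * g i) := by
        rw [CoinBetting.betWealth, mul_sub, mul_one_div_cancel hγ.ne', mul_sum, sub_eq_add_neg,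
          ← sum_neg_distrib]
        congr 1
        exact sum_congr rfl fun i _ => by simp only [hh, hbdef]; ring
      have e4 : 2 * (∑ i ∈ range (n + 1), g i) / (1 / (1 - M.γ) + ∑ i ∈ range (n + 1), |g i|)
          = 2 * -(CoinBetting.outcomeSum h (n + 1) / CoinBetting.outcomeScale h (n + 1)) := by
        rw [e1, e2, neg_div, neg_neg, mul_div_mul_left _ _ hγ.ne', mul_div_assoc]
      simp only [hbdef]
      rw [hrun.lam_succ n (by omega)]
      change max 0 (min U (lam₀ - (1 - M.γ) * (2 * Real.sigmoid
        (2 * (∑ i ∈ range (n + 1), g i) / (1 / (1 - M.γ) + ∑ i ∈ range (n + 1), |g i|)) - 1)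
        * (1 / (1 - M.γ) - ∑ i ∈ range (n + 1), (lam i - lam₀) * g i))) - lam₀ = _
      rw [e4, CoinBetting.two_mul_sigmoid_sub_one, Real.tanh_neg]
      rw [← max_sub_sub_right, ← min_sub_sub_right, zero_sub]
      congr 2
      change _ = _ * CoinBetting.betWealth h b (n + 1)
      rw [e3]
      ring
  -- The summand `1` of `Ψ` covers the initial wealth, because `√T ≥ 1`.
  have hΨ : 4 * U * √(Real.log (((T : ℝ) + 1) * U)) * √T + 1 ≤ √T * dualRegretConst U T := by
    rw [dualRegretConst]; linarith
  have hW : CoinBetting.betWealth h b T = 1 + ∑ t ∈ range T, h t * b t := rfl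
  rcases hx with rfl | rfl
  · have h1 := CoinBetting.clipped_regret_lower (U := U) hT hlam₀.1 (sub_nonneg.2 hlam₀.2)
      hlam₀.2 hU hhb hbet
    have h2 : ∑ t ∈ range T, (lam t - 0) * g t = M.horizon
        * (-(lam₀ * CoinBetting.outcomeSum h T) - CoinBetting.betWealth h b T + 1) := by
      rw [hW, CoinBetting.outcomeSum]
      have : -(lam₀ * ∑ i ∈ range T, h i) - (1 + ∑ t ∈ range T, h t * b t) + 1
          = ∑ t ∈ range T, (1 - M.γ) * ((lam t - 0) * g t) := by
        rw [mul_sum]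
        have : ∀ t, (1 - M.γ) * ((lam t - 0) * g t) = -(lam₀ * h t) - h t * b t := fun t => by
          simp only [hh, hbdef]; ring
        simp only [this, sum_sub_distrib, sum_neg_distrib]
        ring
      rw [this, ← mul_sum, ← mul_assoc, mul_comm M.horizon, hγG, one_mul]
    rw [h2]
    exact mul_le_mul_of_nonneg_left (by linarith) hGpos.le
  · have h1 := CoinBetting.clipped_regret_upper (U := U) hT hlam₀.1 (sub_nonneg.2 hlam₀.2)
      (by linarith [hlam₀.1]) hU hhb hbet
    have h2 : ∑ t ∈ range T, (lam t - U) * g t = M.horizon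
        * ((U - lam₀) * CoinBetting.outcomeSum h T - CoinBetting.betWealth h b T + 1) := by
      rw [hW, CoinBetting.outcomeSum]
      have : (U - lam₀) * ∑ i ∈ range T, h i - (1 + ∑ t ∈ range T, h t * b t) + 1
          = ∑ t ∈ range T, (1 - M.γ) * ((lam t - U) * g t) := by
        rw [mul_sum]
        have : ∀ t, (1 - M.γ) * ((lam t - U) * g t) = (U - lam₀) * h t - h t * b t := fun t => by
          simp only [hh, hbdef]; ring
        simp only [this, sum_sub_distrib]
        ring
      rw [this, ← mul_sum, ← mul_assoc, mul_comm M.horizon, hγG, one_mul]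
    rw [h2]
    exact mul_le_mul_of_nonneg_left (by linarith) hGpos.le

end Run

/-- Decomposition of the Lagrangian gap of one iterate into its primal regret, its dual regret,
and the estimation error. -/
lemma lagrangian_gap_le {πstar π : Policy S A} (hfeas : M.b ≤ M.Jc πstar)
    {θr θc : Fin d → ℝ} {lam x e : ℝ} (hlam : 0 ≤ lam) (hx : 0 ≤ x)
    (her : ∀ s a, |M.qHat φ θr s a - M.qValue M.r π (s, a)| ≤ e)
    (hec : ∀ s a, |M.qHat φ θc s a - M.qValue M.c π (s, a)| ≤ e) :
    (M.Jr πstar - M.Jr π) + x * (M.b - M.Jc π)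
      ≤ M.horizon * (M.occ πstar M.ρ).expect (fun s =>
          (πstar s).expect (M.lagHat φ θr θc lam s) - (π s).expect (M.lagHat φ θr θc lam s))
        + (lam - x) * (M.JcHat φ θc π - M.b)
        + e * (2 * M.horizon + lam * ((1 + M.γ) * M.horizon) + x) := by
  set ν := M.occ πstar M.ρ with hν
  have hG := M.horizon_pos
  have hγG := M.one_sub_mul_horizon
  have hbq : ∀ θ s a, |M.qHat φ θ s a| ≤ M.horizon := M.abs_qHat_le φ
  have hbQ : ∀ {f : S → A → ℝ}, (∀ s a, f s a ∈ Set.Icc (0 : ℝ) 1) → ∀ s a,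
    |M.qValue f π (s, a)| ≤ M.horizon := fun hf s a => M.abs_qValue_le hf π (s, a)
  have hdiff : ∀ {f : S → A → ℝ} {θ : Fin d → ℝ}, (∀ s a, f s a ∈ Set.Icc (0 : ℝ) 1) →
      (∀ s a, |M.qHat φ θ s a - M.qValue f π (s, a)| ≤ e) → ∀ (p : Policy S A) s,
      |(p s).expect (M.qHat φ θ s) - (p s).expect (fun a => M.qValue f π (s, a))| ≤ e :=
    fun hf he p s => PMF.abs_expect_sub_le _ (hbq _ s) (hbQ hf s) (he s)
  have hbe : ∀ (p : Policy S A) θ s, |(p s).expect (M.qHat φ θ s)| ≤ M.horizon := fun p θ s =>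
    PMF.abs_expect_le _ (hbq θ s)
  have hbE : ∀ {f : S → A → ℝ}, (∀ s a, f s a ∈ Set.Icc (0 : ℝ) 1) → ∀ (p : Policy S A) s,
    |(p s).expect (fun a => M.qValue f π (s, a))| ≤ M.horizon := fun hf p s =>
      PMF.abs_expect_le _ (hbQ hf s)
  -- the reward part
  have hr := M.performance_difference M.r_mem πstar π
  rw [PMF.expect_sub _ (hbE M.r_mem πstar) (hbE M.r_mem π)] at hr
  have hr1 := abs_le.1 (ν.abs_expect_sub_le (hbe πstar θr) (hbE M.r_mem πstar)
    (hdiff M.r_mem her πstar))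
  have hr2 := abs_le.1 (ν.abs_expect_sub_le (hbe π θr) (hbE M.r_mem π) (hdiff M.r_mem her π))
  -- the constraint part
  have hc := M.performance_difference M.c_mem πstar π
  rw [PMF.expect_sub _ (hbE M.c_mem πstar) (hbE M.c_mem π)] at hc
  have hc1 := abs_le.1 (ν.abs_expect_sub_le (hbe πstar θc) (hbE M.c_mem πstar)
    (hdiff M.c_mem hec πstar))
  -- The error under the current policy is averaged over the occupancy measure of `πstar`, whereas
  -- `g_t` averages over `ρ`. Passing from one to the other costs `γ e`; the remaining error of
  -- `JcHat` merges with the dual term.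
  have hc2 := abs_le.1 (M.abs_expect_occ_sub_le πstar M.ρ (hdiff M.c_mem hec π))
  rw [PMF.expect_sub _ (hbe π θc) (hbE M.c_mem π), PMF.expect_sub _ (hbe π θc) (hbE M.c_mem π),
    ← M.ret_eq_expect_qValue M.c_mem] at hc2
  have hc3 := abs_le.1 (M.ρ.abs_expect_sub_le (hbe π θc) (hbE M.c_mem π) (hdiff M.c_mem hec π))
  rw [← M.ret_eq_expect_qValue M.c_mem] at hc3
  -- linearity of the estimated Lagrangian value
  have hbl : ∀ θ s a, |lam * M.qHat φ θ s a| ≤ lam * M.horizon := fun θ s a => by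
    rw [abs_mul, abs_of_nonneg hlam]; exact mul_le_mul_of_nonneg_left (hbq θ s a) hlam
  have hlag : ∀ (p : Policy S A) s, (p s).expect (M.lagHat φ θr θc lam s)
      = (p s).expect (M.qHat φ θr s) + lam * (p s).expect (M.qHat φ θc s) := fun p s => by
    rw [← PMF.expect_mul_left, ← PMF.expect_add _ (hbq θr s) (hbl θc s)]; rfl
  have hble : ∀ (p : Policy S A) s, |lam * (p s).expect (M.qHat φ θc s)| ≤ lam * M.horizon :=
    fun p s => by
      rw [abs_mul, abs_of_nonneg hlam]; exact mul_le_mul_of_nonneg_left (hbe p θc s) hlam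
  have hsum : ∀ (p : Policy S A) s, |(p s).expect (M.qHat φ θr s)
      + lam * (p s).expect (M.qHat φ θc s)| ≤ M.horizon + lam * M.horizon := fun p s =>
    (abs_add_le _ _).trans (add_le_add (hbe p θr s) (hble p s))
  simp only [hlag]
  rw [ν.expect_sub (hsum πstar) (hsum π), ν.expect_add (hbe πstar θr) (hble πstar),
    ν.expect_add (hbe π θr) (hble π), PMF.expect_mul_left, PMF.expect_mul_left]
  change (1 - M.γ) * (M.Jr πstar - M.Jr π) = _ at hr
  change (1 - M.γ) * (M.Jc πstar - M.Jc π) = _ at hc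
  change _ ≤ M.JcHat φ θc π - M.Jc π ∧ M.JcHat φ θc π - M.Jc π ≤ _ at hc3
  change _ ≤ _ - (1 - M.γ) * (M.JcHat φ θc π - M.Jc π) ∧
    _ - (1 - M.γ) * (M.JcHat φ θc π - M.Jc π) ≤ _ at hc2
  set Rs := ν.expect fun s => (πstar s).expect (M.qHat φ θr s)
  set Rp := ν.expect fun s => (π s).expect (M.qHat φ θr s)
  set Cs := ν.expect fun s => (πstar s).expect (M.qHat φ θc s)
  set Cp := ν.expect fun s => (π s).expect (M.qHat φ θc s)
  have hR : M.Jr πstar - M.Jr π ≤ M.horizon * (Rs - Rp + 2 * e) := by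
    have h1 : (1 - M.γ) * (M.Jr πstar - M.Jr π) ≤ Rs - Rp + 2 * e := by
      rw [hr]; linarith [hr1.1, hr2.2]
    have h2 := mul_le_mul_of_nonneg_left h1 hG.le
    have h3 : M.horizon * ((1 - M.γ) * (M.Jr πstar - M.Jr π)) = M.Jr πstar - M.Jr π := by
      rw [← mul_assoc, mul_comm M.horizon, hγG, one_mul]
    linarith
  have hC : M.Jc πstar - M.Jc π
      ≤ M.horizon * (Cs - Cp + (1 + M.γ) * e) + (M.JcHat φ θc π - M.Jc π) := by
    have h1 : (1 - M.γ) * (M.Jc πstar - M.Jc π)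
        ≤ Cs - Cp + (1 + M.γ) * e + (1 - M.γ) * (M.JcHat φ θc π - M.Jc π) := by
      rw [hc]; linarith [hc1.1, hc2.2]
    have h2 := mul_le_mul_of_nonneg_left h1 hG.le
    have h3 : ∀ y, M.horizon * ((1 - M.γ) * y) = y := fun y => by
      rw [← mul_assoc, mul_comm M.horizon, hγG, one_mul]
    rw [mul_add M.horizon, h3, h3] at h2
    exact h2
  -- Feasibility of `πstar` enters here, through `b - J_c(π) ≤ J_c(π*) - J_c(π)`.
  have h4 : lam * (M.b - M.Jc π) ≤ lam * (M.horizon * (Cs - Cp + (1 + M.γ) * e)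
      + (M.JcHat φ θc π - M.Jc π)) := mul_le_mul_of_nonneg_left (by linarith) hlam
  have h5 : x * (M.JcHat φ θc π - M.Jc π) ≤ x * e := mul_le_mul_of_nonneg_left hc3.2 hx
  linarith

end CMDP

/-! ### Deterministic bounds on the optimality gap and the violation. -/

namespace CMDP

open Finset

variable {S A : Type*} (M : CMDP S A) {d : ℕ} {φ : S × A → Fin d → ℝ} {C : Finset (S × A)}
  {wt : S × A → ℝ} {T : ℕ} {π₀ : Policy S A} {lam₀ : ℝ} {qr qc : ℕ → S × A → ℝ}
  {θr θc : ℕ → Fin d → ℝ} {w : ℕ → S → A → ℝ} {π : ℕ → Policy S A} {lam : ℕ → ℝ}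

/-- The guarantee of the algorithm in terms of the errors `ε t` of the estimated action values. -/
theorem IsCBPRun.optGap_consViol_le [MeasurableSpace A] [DiscreteMeasurableSpace A]
    (hrun : M.IsCBPRun φ C wt T π₀ lam₀ qr qc θr θc w π lam)
    (hb : 0 ≤ M.b) (hζ : 0 < M.slater) {πstar : Policy S A} (hstar : M.IsOptimal πstar)
    (hKL : M.policyKL πstar π₀ ≠ ⊤) (hlam₀ : lam₀ ∈ Set.Icc 0 M.dualBound) (hT : 1 ≤ T)
    {ε : ℕ → ℝ} {εavg : ℝ} (hε : ∑ t ∈ range T, ε t ≤ T * εavg)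
    (her : ∀ t < T, ∀ s a, |M.qHat φ (θr t) s a - M.qValue M.r (π t) (s, a)| ≤ ε t)
    (hec : ∀ t < T, ∀ s a, |M.qHat φ (θc t) s a - M.qValue M.c (π t) (s, a)| ≤ ε t) :
    M.optGap πstar T π ≤
        (3 * (1 + M.dualBound) * √(1 + (M.policyKL πstar π₀).toReal) / (1 - M.γ)
            + dualRegretConst M.dualBound T) / ((1 - M.γ) * √T)
          + εavg * (2 + (1 + M.γ) * M.dualBound) / (1 - M.γ)
    ∧ M.consViol T π ≤
        M.slater * (3 * (1 + M.dualBound) * √(1 + (M.policyKL πstar π₀).toReal)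
            / (1 - M.γ) + dualRegretConst M.dualBound T) / √T
          + M.slater * εavg * (2 + 2 * M.dualBound) := by
  have hU2 := M.two_le_dualBound hb hζ πstar
  have hprimal := hrun.primal_regret M (by linarith) hlam₀ hT hKL
  have hdual := fun x => hrun.dual_regret M (x := x)
    ⟨hb, by linarith [M.slater_le_horizon_sub πstar]⟩ hU2 hlam₀ hT
  have hl := fun t (ht : t < T) => hrun.lam_mem M (by linarith) hlam₀ ht.le
  have hT0 : (0 : ℝ) < T := by exact_mod_cast hT
  have hsT : 0 < √(T : ℝ) := Real.sqrt_pos.2 hT0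
  have hG := M.horizon_pos
  have hγ := M.one_sub_pos
  have hγG := M.one_sub_mul_horizon
  have hUζ : M.dualBound * (M.slater * (1 - M.γ)) = 2 := by
    rw [dualBound, div_mul_cancel₀ _ (mul_pos hζ hγ).ne']
  have hε0 : ∀ t < T, 0 ≤ ε t := fun t ht => by
    obtain ⟨s, -⟩ := M.ρ.support_nonempty
    obtain ⟨a, -⟩ := (π₀ s).support_nonempty
    exact (abs_nonneg _).trans (her t ht s a)
  have hεavg : 0 ≤ εavg := by
    have h1 := (sum_nonneg fun t ht => hε0 t (mem_range.1 ht)).trans hε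
    exact nonneg_of_mul_nonneg_right h1 hT0
  set U := M.dualBound with hUdef
  set Ψ := dualRegretConst U T with hΨ
  set κ := √(1 + (M.policyKL πstar π₀).toReal) with hκ
  set B := M.horizon * ((3 * (1 + U) * κ * M.horizon + Ψ) * √T) with hB
  have hΨ0 : 0 ≤ Ψ := by rw [hΨ, dualRegretConst]; positivity
  have hB0 : 0 ≤ B := by positivity
  have hgap : ∀ x, x = 0 ∨ x = U → ∑ t ∈ range T, (M.Jr πstar - M.Jr (π t))
      + x * ∑ t ∈ range T, (M.b - M.Jc (π t))
      ≤ B + T * εavg * (2 * M.horizon + U * ((1 + M.γ) * M.horizon) + x) := by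
    intro x hx
    have hx0 : 0 ≤ x := by rcases hx with rfl | rfl <;> linarith
    have h1 : ∀ t ∈ range T, (M.Jr πstar - M.Jr (π t)) + x * (M.b - M.Jc (π t))
        ≤ M.horizon * (M.occ πstar M.ρ).expect (fun s =>
            (πstar s).expect (M.lagHat φ (θr t) (θc t) (lam t) s)
              - (π t s).expect (M.lagHat φ (θr t) (θc t) (lam t) s))
          + (lam t - x) * (M.JcHat φ (θc t) (π t) - M.b)
          + ε t * (2 * M.horizon + U * ((1 + M.γ) * M.horizon) + x) := by
      intro t ht
      have ht := mem_range.1 ht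
      refine (M.lagrangian_gap_le hstar.1 (hl t ht).1 hx0 (her t ht) (hec t ht)).trans ?_
      have h2 : lam t * ((1 + M.γ) * M.horizon) ≤ U * ((1 + M.γ) * M.horizon) :=
        mul_le_mul_of_nonneg_right (hl t ht).2
          (mul_nonneg (by linarith [M.γ_nonneg]) hG.le)
      have h3 := mul_le_mul_of_nonneg_left h2 (hε0 t ht)
      linarith
    have h4 := sum_le_sum h1
    rw [sum_add_distrib, sum_add_distrib, sum_add_distrib, ← mul_sum, ← mul_sum, ← sum_mul] at h4
    have h5 := hdual x hx
    have h6 := mul_le_mul_of_nonneg_left hprimal hG.le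
    have h7 : 0 ≤ 2 * M.horizon + U * ((1 + M.γ) * M.horizon) + x := by
      have := M.γ_nonneg
      positivity
    have h8 := mul_le_mul_of_nonneg_right hε h7
    have h9 : B = M.horizon * (3 * (1 + U) * M.horizon * κ * √T) + M.horizon * (√T * Ψ) := by
      rw [hB]; ring
    linarith
  have hsq : √(T : ℝ) * √T = T := Real.mul_self_sqrt hT0.le
  have hBT : 1 / (T : ℝ) * B
      = (3 * (1 + U) * κ / (1 - M.γ) + Ψ) / ((1 - M.γ) * √T) := by
    rw [hB, horizon]
    nth_rewrite 1 [← hsq]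
    field_simp
  have hTp : (0 : ℝ) < 1 / T := by positivity
  constructor
  · have h1 := mul_le_mul_of_nonneg_left (hgap 0 (Or.inl rfl)) hTp.le
    rw [zero_mul, add_zero, add_zero, mul_add, hBT] at h1
    rw [optGap]
    refine h1.trans (le_of_eq ?_)
    congr 1
    rw [horizon]
    field_simp
  · have hrhs : M.slater * (3 * (1 + U) * κ / (1 - M.γ) + Ψ) / √T
        + M.slater * εavg * (2 + 2 * U)
        = M.slater * (1 - M.γ) * (1 / (T : ℝ) * B + εavg * ((2 + 2 * U) * M.horizon)) := by
      rw [hBT, horizon]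
      field_simp
    rw [hrhs, consViol]
    set v := ∑ t ∈ range T, (M.b - M.Jc (π t)) with hv
    have hR0 : 0 ≤ 1 / (T : ℝ) * B + εavg * ((2 + 2 * U) * M.horizon) := by positivity
    rcases le_or_gt v 0 with hv0 | hv0
    · rw [max_eq_right hv0, mul_zero]
      positivity
    · rw [max_eq_left hv0.le]
      have h1 := mul_le_mul_of_nonneg_left (hgap U (Or.inr rfl)) hTp.le
      have h2 := M.avg_Jr_sub_le hstar hζ hT π (v := 1 / (T : ℝ) * v) (by positivity) rfl
      have h3 : ∑ t ∈ range T, (M.Jr (π t) - M.Jr πstar)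
          = -∑ t ∈ range T, (M.Jr πstar - M.Jr (π t)) := by
        rw [← sum_neg_distrib]; exact sum_congr rfl fun t _ => by ring
      rw [h3] at h2
      set x := 1 / (T : ℝ) * v with hx
      set y := 1 / (T : ℝ) * ∑ t ∈ range T, (M.Jr πstar - M.Jr (π t)) with hy
      have h4 : y + U * x ≤ 1 / (T : ℝ) * B + εavg * ((2 + 2 * U) * M.horizon) := by
        have e : 1 / (T : ℝ) * (B + T * εavg * (2 * M.horizon + U * ((1 + M.γ) * M.horizon) + U))
            = 1 / (T : ℝ) * B + εavg * ((2 + 2 * U) * M.horizon) := by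
          have : 2 * M.horizon + U * ((1 + M.γ) * M.horizon) + U = (2 + 2 * U) * M.horizon := by
            linear_combination U * M.one_add_mul_horizon
          rw [this]; field_simp
        rw [e] at h1
        refine le_trans (le_of_eq ?_) h1
        rw [hy, hx]; ring
      have h5 : M.slater * (1 - M.γ) * -y ≤ x := by
        have e1 : 1 / (T : ℝ) * -∑ t ∈ range T, (M.Jr πstar - M.Jr (π t)) = -y := by
          rw [hy]; ring
        rw [e1] at h2
        have h6 := mul_le_mul_of_nonneg_left h2 hγ.le
        have e2 : (1 - M.γ) * (x * M.horizon) = x := by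
          rw [mul_left_comm, hγG, mul_one]
        linarith
      -- As `ζ (1 - γ) U = 2`, scaling turns the left side into `ζ (1 - γ) y + 2x`. By `h5` the
      -- first term costs at most one `x`, and the other `x` is the bound sought.
      have h7 := mul_le_mul_of_nonneg_left h4 (mul_pos hζ hγ).le
      have h8 : M.slater * (1 - M.γ) * (y + U * x) = M.slater * (1 - M.γ) * y + 2 * x := by
        linear_combination x * hUζ
      linarith

end CMDP

/-! ### Laws of finite paths, truncated returns and Hoeffding's bound. -/

namespace PMF

lemma expect_map {α β : Type*} (p : PMF α) (g : α → β) {f : β → ℝ} {B : ℝ}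
    (hf : ∀ x, |f x| ≤ B) : (p.map g).expect f = p.expect fun x => f (g x) := by
  rw [← PMF.bind_pure_comp, expect_bind _ _ hf]
  simp only [Function.comp_apply, expect_pure]

end PMF

namespace CMDP

open Finset

variable {S A : Type*} (M : CMDP S A)

/-- The law of the first `n + 1` state-action pairs of a trajectory from `z` that follows `π`. -/
def pathLaw (π : Policy S A) : (n : ℕ) → S × A → PMF (Fin (n + 1) → S × A)
  | 0, z => PMF.pure fun _ => z
  | n + 1, z => ((M.P z.1 z.2).joint π).bind fun z' =>
      (pathLaw π n z').map fun h => Fin.cons (α := fun _ => S × A) z h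

/-- A path of length `n + 1`, continued by its last entry. -/
def pathExtend {Z : Type*} {n : ℕ} (h : Fin (n + 1) → Z) (k : ℕ) : Z :=
  h ⟨min k n, by omega⟩

lemma pathExtend_succ {Z : Type*} {n : ℕ} (h : Fin (n + 2) → Z) (k : ℕ) :
    pathExtend h (k + 1) = pathExtend (Fin.tail h) k := by
  simp only [pathExtend, Fin.tail]
  congr 1
  ext
  simp

lemma prefixProb_succ (π : Policy S A) (z : S × A) (n : ℕ) (h : Fin (n + 2) → S × A) :
    M.prefixProb π z (n + 1) (pathExtend h) = (by classical exact if h 0 = z then 1 else 0)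
      * ((M.P z.1 z.2).joint π (h 1)
        * M.prefixProb π (h 1) n (pathExtend (Fin.tail h))) := by
  classical
  have h0 : pathExtend h 0 = h 0 := by simp [pathExtend]
  have h1 : pathExtend h 1 = h 1 := by
    simp [pathExtend]
  have h2 : pathExtend (Fin.tail h) 0 = h 1 := by rw [← pathExtend_succ, h1]
  rw [prefixProb, prefixProb, prod_range_succ', h0]
  by_cases hz : h 0 = z
  · rw [if_pos hz]
    simp only [pathExtend_succ]
    rw [hz, h2, if_pos rfl, PMF.joint_apply]
    ring
  · simp [hz]

/-- This ties the recursive law, convenient for expectations, to the product formula in which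
`IsRollout` is phrased. -/
lemma pathLaw_apply (π : Policy S A) (n : ℕ) (z : S × A) (h : Fin (n + 1) → S × A) :
    M.pathLaw π n z h = M.prefixProb π z n (pathExtend h) := by
  classical
  induction n generalizing z with
  | zero =>
    have h0 : pathExtend h 0 = h 0 := by simp [pathExtend]
    rw [pathLaw, PMF.pure_apply, prefixProb, h0]
    have : h = (fun _ => z) ↔ h 0 = z :=
      ⟨fun e => by rw [e], fun e => by ext1 i; rw [Fin.fin_one_eq_zero i, e]⟩
    simp [this]
  | succ n ih =>
    rw [prefixProb_succ, pathLaw, PMF.bind_apply]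
    have hmap : ∀ z', ((M.pathLaw π n z').map fun h => Fin.cons (α := fun _ => S × A) z h) h
        = (if h 0 = z then 1 else 0) * M.pathLaw π n z' (Fin.tail h) := by
      intro z'
      rw [PMF.map_apply, tsum_eq_single (Fin.tail h)]
      · have : h = Fin.cons (α := fun _ => S × A) z (Fin.tail h) ↔ h 0 = z := by
          constructor
          · intro e; rw [e, Fin.cons_zero]
          · intro e; rw [← e, Fin.cons_self_tail]
        by_cases hz : h 0 = z
        · rw [if_pos (this.2 hz), if_pos hz, one_mul]
        · rw [if_neg (fun e => hz (this.1 e)), if_neg hz, zero_mul]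
      · intro h' hh'
        rw [if_neg]
        intro e
        exact hh' (by rw [e, Fin.tail_cons])
    simp only [hmap, ih]
    rw [tsum_eq_single (h 1)]
    · split_ifs <;> ring
    · intro z' hz'
      have h2 : pathExtend (Fin.tail h) 0 = h 1 := by
        simp [pathExtend, Fin.tail]
      rw [prefixProb, h2, if_neg (Ne.symm hz')]
      simp

/-- The discounted return of a path. -/
def pathReturn (f : S → A → ℝ) {n : ℕ} (h : Fin (n + 1) → S × A) : ℝ :=
  ∑ k : Fin (n + 1), M.γ ^ (k : ℕ) * f (h k).1 (h k).2

variable {f : S → A → ℝ}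

lemma pathReturn_mem (hf : ∀ s a, f s a ∈ Set.Icc (0 : ℝ) 1) {n : ℕ}
    (h : Fin (n + 1) → S × A) : M.pathReturn f h ∈ Set.Icc 0 M.horizon := by
  have hg := hasSum_geometric_of_lt_one M.γ_nonneg M.γ_lt_one
  have hγ : ∀ k : ℕ, 0 ≤ M.γ ^ k := fun k => pow_nonneg M.γ_nonneg k
  constructor
  · exact sum_nonneg fun k _ => mul_nonneg (hγ k) (hf _ _).1
  · calc M.pathReturn f h ≤ ∑ k : Fin (n + 1), M.γ ^ (k : ℕ) :=
          sum_le_sum fun k _ => mul_le_of_le_one_right (hγ k) (hf _ _).2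
      _ = ∑ k ∈ range (n + 1), M.γ ^ k := (sum_range _).symm
      _ ≤ ∑' k : ℕ, M.γ ^ k := hg.summable.sum_le_tsum _ fun k _ => hγ k
      _ = M.horizon := by rw [hg.tsum_eq, horizon, one_div]

/-- The action value of `π` truncated after `n + 1` steps. -/
def qTrunc (f : S → A → ℝ) (π : Policy S A) (n : ℕ) (z : S × A) : ℝ :=
  (M.pathLaw π n z).expect (M.pathReturn f)

lemma qTrunc_zero (π : Policy S A) (z : S × A) : M.qTrunc f π 0 z = f z.1 z.2 := by
  rw [qTrunc, pathLaw, PMF.expect_pure, pathReturn]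
  simp

lemma qTrunc_succ (hf : ∀ s a, f s a ∈ Set.Icc (0 : ℝ) 1) (π : Policy S A) (n : ℕ) (z : S × A) :
    M.qTrunc f π (n + 1) z
      = f z.1 z.2 + M.γ * ((M.P z.1 z.2).joint π).expect (M.qTrunc f π n) := by
  have hb : ∀ {n : ℕ} (h : Fin (n + 1) → S × A), |M.pathReturn f h| ≤ M.horizon := fun h =>
    abs_le_of_mem (M.pathReturn_mem hf h)
  have hcons : ∀ h : Fin (n + 1) → S × A,
      M.pathReturn f (Fin.cons (α := fun _ => S × A) z h : Fin (n + 2) → S × A)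
        = f z.1 z.2 + M.γ * M.pathReturn f h := by
    intro h
    rw [pathReturn, Fin.sum_univ_succ, pathReturn, mul_sum]
    simp only [Fin.cons_zero, Fin.cons_succ, Fin.val_zero, pow_zero, one_mul, Fin.val_succ,
      pow_succ]
    congr 1
    exact sum_congr rfl fun k _ => by ring
  have hγb : ∀ {x : ℝ}, |x| ≤ M.horizon → |M.γ * x| ≤ M.γ * M.horizon := fun hx => by
    rw [abs_mul, abs_of_nonneg M.γ_nonneg]; exact mul_le_mul_of_nonneg_left hx M.γ_nonneg
  rw [qTrunc, pathLaw, PMF.expect_bind _ _ hb]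
  have h1 : ∀ z', ((M.pathLaw π n z').map fun h => Fin.cons (α := fun _ => S × A) z h).expect
      (M.pathReturn f) = f z.1 z.2 + M.γ * M.qTrunc f π n z' := by
    intro z'
    rw [PMF.expect_map _ _ hb]
    simp only [hcons]
    rw [PMF.expect_add _ (fun _ => le_refl |f z.1 z.2|) (fun h => hγb (hb h)), PMF.expect_const,
      PMF.expect_mul_left]
    rfl
  simp only [h1]
  rw [PMF.expect_add _ (fun _ => le_refl |f z.1 z.2|)
    (f := fun _ => f z.1 z.2) (g := fun z' => M.γ * M.qTrunc f π n z')
    (fun z' => hγb (PMF.abs_expect_le _ hb)), PMF.expect_const, PMF.expect_mul_left]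

/-- Both functions obey the same one-step recursion, so every further step multiplies the error by
`γ`. -/
lemma abs_qValue_sub_qTrunc_le (hf : ∀ s a, f s a ∈ Set.Icc (0 : ℝ) 1) (π : Policy S A) (n : ℕ)
    (z : S × A) : |M.qValue f π z - M.qTrunc f π n z| ≤ M.γ ^ (n + 1) * M.horizon := by
  have hQ : ∀ z : S × A, |M.qValue f π z| ≤ M.horizon := M.abs_qValue_le hf π
  have hrec : ∀ z : S × A, M.qValue f π z
      = f z.1 z.2 + M.γ * ((M.P z.1 z.2).joint π).expect (M.qValue f π) := by
    intro z
    have := PMF.expect_joint (M.P z.1 z.2) π (g := fun s a => M.qValue f π (s, a))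
      (fun s a => hQ (s, a))
    simp only [Prod.mk.eta] at this
    rw [qValue, this]
    congr 3
    exact funext (M.value_eq_expect_qValue hf π)
  induction n generalizing z with
  | zero =>
    rw [hrec, qTrunc_zero, add_sub_cancel_left, abs_mul, abs_of_nonneg M.γ_nonneg, zero_add,
      pow_one]
    exact mul_le_mul_of_nonneg_left (PMF.abs_expect_le _ hQ) M.γ_nonneg
  | succ n ih =>
    have hT : ∀ z, |M.qTrunc f π n z| ≤ M.horizon := fun z =>
      PMF.abs_expect_le _ fun h => abs_le_of_mem (M.pathReturn_mem hf h)
    rw [hrec, qTrunc_succ M hf, add_sub_add_left_eq_sub, ← mul_sub, abs_mul,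
      abs_of_nonneg M.γ_nonneg, pow_succ', mul_assoc]
    exact mul_le_mul_of_nonneg_left (PMF.abs_expect_sub_le _ hQ hT ih) M.γ_nonneg

lemma abs_tsum_sub_pathReturn_le (hf : ∀ s a, f s a ∈ Set.Icc (0 : ℝ) 1) (x : ℕ → S × A) (n : ℕ) :
    |(∑' k : ℕ, M.γ ^ k * f (x k).1 (x k).2) - M.pathReturn f (fun k : Fin (n + 1) => x k)|
      ≤ M.γ ^ (n + 1) * M.horizon := by
  have hg := hasSum_geometric_of_lt_one M.γ_nonneg M.γ_lt_one
  have hγ : ∀ k : ℕ, 0 ≤ M.γ ^ k := fun k => pow_nonneg M.γ_nonneg k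
  have hle : ∀ k, M.γ ^ k * f (x k).1 (x k).2 ≤ M.γ ^ k := fun k =>
    mul_le_of_le_one_right (hγ k) (hf _ _).2
  have h0 : ∀ k, 0 ≤ M.γ ^ k * f (x k).1 (x k).2 := fun k => mul_nonneg (hγ k) (hf _ _).1
  have hs : Summable fun k : ℕ => M.γ ^ k * f (x k).1 (x k).2 :=
    Summable.of_nonneg_of_le h0 hle hg.summable
  have h1 : M.pathReturn f (fun k : Fin (n + 1) => x k)
      = ∑ k ∈ range (n + 1), M.γ ^ k * f (x k).1 (x k).2 :=
    (sum_range fun k => M.γ ^ k * f (x k).1 (x k).2).symm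
  rw [← hs.sum_add_tsum_nat_add (n + 1), h1, add_sub_cancel_left,
    abs_of_nonneg (tsum_nonneg fun k => h0 _)]
  have hs2 : HasSum (fun k : ℕ => M.γ ^ (k + (n + 1))) (M.γ ^ (n + 1) * M.horizon) := by
    have := hg.mul_left (M.γ ^ (n + 1))
    rw [horizon, one_div]
    simpa only [pow_add, mul_comm] using this
  rw [← hs2.tsum_eq]
  exact Summable.tsum_le_tsum (fun k => hle _) ((summable_nat_add_iff (n + 1)).2 hs) hs2.summable

/-- The average return of `m` paths. -/
def meanReturn (f : S → A → ℝ) {m n : ℕ} (h : Fin m → Fin (n + 1) → S × A) : ℝ :=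
  (1 / (m : ℝ)) * ∑ j, M.pathReturn f (h j)

lemma abs_mcReturn_sub_le (hf : ∀ s a, f s a ∈ Set.Icc (0 : ℝ) 1) {m : ℕ} (hm : 1 ≤ m)
    (x : Fin m → ℕ → S × A) (n : ℕ) :
    |M.mcReturn f x - M.meanReturn f (fun j (k : Fin (n + 1)) => x j k)|
      ≤ M.γ ^ (n + 1) * M.horizon := by
  have hm0 : (0 : ℝ) < m := by exact_mod_cast hm
  rw [mcReturn, meanReturn, ← mul_sub, ← sum_sub_distrib, abs_mul, abs_of_pos (by positivity),
    one_div, inv_mul_le_iff₀ hm0]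
  refine (abs_sum_le_sum_abs _ _).trans ?_
  refine (sum_le_sum fun j _ => M.abs_tsum_sub_pathReturn_le hf (x j) n).trans ?_
  simp

section Hoeffding

open MeasureTheory ProbabilityTheory

variable [Countable S] [MeasurableSpace S] [DiscreteMeasurableSpace S]
  [Countable A] [MeasurableSpace A] [DiscreteMeasurableSpace A]

/-- The joint law of the first `n + 1` steps of `m` independent trajectories from each point of
`C`. -/
def blockLaw (C : Finset (S × A)) (m n : ℕ) (π : Policy S A) :
    Measure (C × Fin m → Fin (n + 1) → S × A) :=
  Measure.pi fun i => (M.pathLaw π n i.1).toMeasure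

instance (C : Finset (S × A)) (m n : ℕ) (π : Policy S A) :
    IsProbabilityMeasure (M.blockLaw C m n π) := by
  unfold blockLaw; infer_instance

/-- Hoeffding's bound on the exponential moments of the average return. -/
lemma lintegral_exp_meanReturn_le (hf : ∀ s a, f s a ∈ Set.Icc (0 : ℝ) 1) (C : Finset (S × A))
    {m : ℕ} (hm : 1 ≤ m) (n : ℕ) (π : Policy S A) (z : C) (κ : ℝ) :
    ∫⁻ h, ENNReal.ofReal (Real.exp
        (κ * (M.meanReturn f (fun j => h (z, j)) - M.qTrunc f π n z))) ∂(M.blockLaw C m n π)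
      ≤ ENNReal.ofReal (Real.exp (κ ^ 2 * M.horizon ^ 2 / (8 * m))) := by
  classical
  have hm0 : (0 : ℝ) < m := by exact_mod_cast hm
  set P := M.blockLaw C m n π with hP
  set Y : C × Fin m → (C × Fin m → Fin (n + 1) → S × A) → ℝ := fun i h =>
    M.pathReturn f (h i) - M.qTrunc f π n i.1 with hY
  have hindep : iIndepFun Y P :=
    iIndepFun_pi (μ := fun i : C × Fin m => (M.pathLaw π n i.1).toMeasure)
      (X := fun i h => M.pathReturn f h - M.qTrunc f π n i.1)
      fun i => Measurable.of_discrete.aemeasurable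
  -- Hoeffding's lemma: a variable in an interval of length `1 / (1 - γ)` has variance proxy a
  -- quarter of the squared length.
  have hsub : ∀ i, HasSubgaussianMGF (Y i) ((‖M.horizon - 0‖₊ / 2) ^ 2) P := by
    intro i
    have hb : ∀ᵐ h ∂P, M.pathReturn f (h i) ∈ Set.Icc 0 M.horizon :=
      Filter.Eventually.of_forall fun h => M.pathReturn_mem hf (h i)
    have h1 := hasSubgaussianMGF_of_mem_Icc (μ := P) (X := fun h => M.pathReturn f (h i))
      Measurable.of_discrete.aemeasurable hb
    have h2 : ∫ h, M.pathReturn f (h i) ∂P = M.qTrunc f π n i.1 := by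
      have hmp := measurePreserving_eval
        (fun i : C × Fin m => (M.pathLaw π n i.1).toMeasure) i
      have h3 := ((M.pathLaw π n i.1).expect_eq_integral fun h =>
        abs_le_of_mem (M.pathReturn_mem hf h)).2
      rw [qTrunc, ← h3, ← hmp.map_eq, integral_map hmp.measurable.aemeasurable
        Measurable.of_discrete.aestronglyMeasurable]
      rfl
    rwa [h2] at h1
  have hsum := HasSubgaussianMGF.sum_of_iIndepFun hindep
    (s := univ.image fun j : Fin m => (z, j)) fun i _ => hsub i
  have hinj : Function.Injective fun j : Fin m => (z, j) := fun j j' h => (Prod.ext_iff.1 h).2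
  have e1 : ∀ h, κ * (M.meanReturn f (fun j => h (z, j)) - M.qTrunc f π n z)
      = κ / m * ∑ i ∈ univ.image (fun j : Fin m => (z, j)), Y i h := by
    intro h
    rw [sum_image hinj.injOn, hY]
    simp only [sum_sub_distrib, sum_const, card_univ, Fintype.card_fin, nsmul_eq_mul]
    rw [meanReturn]
    field_simp
  simp only [e1]
  rw [← ofReal_integral_eq_lintegral_ofReal (hsum.integrable_exp_mul _)
    (Filter.Eventually.of_forall fun h => (Real.exp_pos _).le)]
  refine ENNReal.ofReal_le_ofReal ((hsum.mgf_le (κ / m)).trans (le_of_eq ?_))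
  congr 1
  rw [sum_const, card_image_of_injective _ hinj, card_univ, Fintype.card_fin]
  simp only [sub_zero, nsmul_eq_mul, NNReal.coe_mul, NNReal.coe_natCast, NNReal.coe_pow,
    NNReal.coe_div, coe_nnnorm, Real.norm_eq_abs, abs_of_pos M.horizon_pos, NNReal.coe_ofNat]
  field_simp
  ring

end Hoeffding

end CMDP

/-! ### Conditioning on the past trajectories. -/

section Disintegration

open MeasureTheory Finset

variable {S A Ω : Type*} [MeasurableSpace S] [MeasurableSpace A] [mΩ : MeasurableSpace Ω]
  {μ : Measure Ω} {M : CMDP S A} {C : Finset (S × A)} {m T : ℕ}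
  {X : ℕ → S × A → Fin m → ℕ → Ω → S × A} {π : ℕ → Ω → Policy S A}

lemma IsRollout.pastTrajectories_le (hX : IsRollout μ M C T X π) {t : ℕ} (ht : t ≤ T) :
    pastTrajectories C X t ≤ mΩ :=
  iSup₂_le fun i hi => iSup₂_le fun z hz => iSup₂_le fun j k =>
    (hX.measurable i (hi.trans_le ht) z hz j k).comap_le

lemma pastTrajectories_mono {Ω : Type*} (C : Finset (S × A)) (X : ℕ → S × A → Fin m → ℕ → Ω → S × A)
    {t t' : ℕ} (h : t ≤ t') : pastTrajectories C X t ≤ pastTrajectories C X t' :=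
  iSup₂_le fun i hi => le_iSup₂_of_le i (hi.trans_le h) le_rfl

lemma measurable_pastTrajectories {Ω : Type*} (C : Finset (S × A))
    (X : ℕ → S × A → Fin m → ℕ → Ω → S × A) {i t : ℕ} (hi : i < t) {z : S × A} (hz : z ∈ C)
    (j : Fin m) (k : ℕ) : Measurable[pastTrajectories C X t] (X i z j k) :=
  measurable_iff_comap_le.2 (le_iSup₂_of_le i hi (le_iSup₂_of_le z hz
    (le_iSup₂_of_le (f := fun j k => MeasurableSpace.comap (X i z j k) inferInstance) j k le_rfl)))

/-- The first `n + 1` steps of all trajectories of iteration `t`. -/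
def block (C : Finset (S × A)) (X : ℕ → S × A → Fin m → ℕ → Ω → S × A) (t n : ℕ) (ω : Ω) :
    C × Fin m → Fin (n + 1) → S × A :=
  fun i k => X t i.1 i.2 k ω

variable [Countable S] [DiscreteMeasurableSpace S] [Countable A] [DiscreteMeasurableSpace A]

lemma IsRollout.measure_inter_block (hX : IsRollout μ M C T X π) {t : ℕ} (ht : t < T) (n : ℕ)
    {E : Set Ω} (hE : MeasurableSet[pastTrajectories C X t] E)
    (h : C × Fin m → Fin (n + 1) → S × A) :
    μ (E ∩ {ω | block C X t n ω = h})
      = ∫⁻ ω in E, M.blockLaw C m n (π t ω) {h} ∂μ := by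
  classical
  -- `IsRollout.law` prescribes paths for all pairs and all times; the values outside `C` or after
  -- time `n` are irrelevant.
  let g : S × A → Fin m → ℕ → S × A := fun z j =>
    if hz : z ∈ C then CMDP.pathExtend (h (⟨z, hz⟩, j)) else fun _ => z
  have hg : ∀ (z : C) j, g z j = CMDP.pathExtend (h (z, j)) := fun z j => by
    simp only [g, z.2, dif_pos]
  have hset : {ω | block C X t n ω = h} = {ω | ∀ z ∈ C, ∀ j, ∀ k ≤ n, X t z j k ω = g z j k} := by
    ext ω
    simp only [Set.mem_ofPred_eq]
    constructor
    · intro hω z hz j k hk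
      rw [hg ⟨z, hz⟩ j, CMDP.pathExtend, ← hω]
      simp only [block, min_eq_left hk]
    · intro hω
      funext ⟨z, j⟩ k
      have := hω z z.2 j k (by omega)
      rw [hg z j, CMDP.pathExtend] at this
      simp only [block, this]
      congr 1
      ext
      simp only
      omega
  rw [hset, hX.law t ht E hE n g]
  refine lintegral_congr fun ω => ?_
  rw [CMDP.blockLaw, Measure.pi_singleton, Fintype.prod_prod_type, ← prod_coe_sort C]
  refine prod_congr rfl fun z _ => prod_congr rfl fun j _ => ?_
  rw [PMF.toMeasure_apply_singleton _ _ (measurableSet_singleton _), CMDP.pathLaw_apply, hg]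

/-- Given the past, the trajectories of iteration `t` are distributed according to the block law
of the current policy. -/
lemma IsRollout.lintegral_block (hX : IsRollout μ M C T X π) {t : ℕ} (ht : t < T) (n : ℕ)
    (hπ : ∀ s a, Measurable[pastTrajectories C X t] fun ω => π t ω s a)
    {F : Ω → (C × Fin m → Fin (n + 1) → S × A) → ℝ≥0∞}
    (hF : ∀ h, Measurable[pastTrajectories C X t] fun ω => F ω h) :
    ∫⁻ ω, F ω (block C X t n ω) ∂μ = ∫⁻ ω, ∫⁻ h, F ω h ∂(M.blockLaw C m n (π t ω)) ∂μ := by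
  classical
  have hm := hX.pastTrajectories_le ht.le
  have hblock : Measurable (block C X t n) :=
    measurable_pi_lambda _ fun i => measurable_pi_lambda _ fun k =>
      hX.measurable t ht i.1 i.1.2 i.2 k
  have hlaw : ∀ h, Measurable[pastTrajectories C X t]
      fun ω => M.blockLaw C m n (π t ω) {h} := by
    intro h
    simp only [CMDP.blockLaw, Measure.pi_singleton,
      PMF.toMeasure_apply_singleton _ _ (measurableSet_singleton _), CMDP.pathLaw_apply,
      CMDP.prefixProb]
    refine Finset.measurable_prod _ fun i _ => Measurable.const_mul ?_ _
    exact Finset.measurable_prod _ fun k _ => Measurable.const_mul (hπ _ _) _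
  have hsingle : ∀ h, MeasurableSet {ω | block C X t n ω = h} := fun h =>
    hblock (measurableSet_singleton h)
  have hpoint : ∀ h, ∫⁻ ω in {ω | block C X t n ω = h}, F ω h ∂μ
      = ∫⁻ ω, F ω h * M.blockLaw C m n (π t ω) {h} ∂μ := by
    intro h
    -- On past events the law of the rollout identifies these two measures, so they integrate every
    -- past-measurable function alike.
    have htrim : (μ.restrict {ω | block C X t n ω = h}).trim hm
        = (μ.withDensity fun ω => M.blockLaw C m n (π t ω) {h}).trim hm := by
      refine @Measure.ext _ (pastTrajectories C X t) _ _ fun E hE => ?_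
      rw [trim_measurableSet_eq hm hE, trim_measurableSet_eq hm hE,
        Measure.restrict_apply (hm E hE), withDensity_apply _ (hm E hE),
        hX.measure_inter_block ht n hE]
    rw [← lintegral_trim hm (hF h), htrim, lintegral_trim hm (hF h),
      lintegral_withDensity_eq_lintegral_mul _ ((hlaw h).mono hm le_rfl)
        ((hF h).mono hm le_rfl)]
    simp only [Pi.mul_apply, mul_comm]
  have hL : ∀ ω, F ω (block C X t n ω)
      = ∑' h, ({ω | block C X t n ω = h} : Set Ω).indicator (fun ω => F ω h) ω := by
    intro ω
    rw [tsum_eq_single (block C X t n ω)]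
    · simp
    · intro h hh
      rw [Set.indicator_of_notMem]
      exact fun e => hh (Eq.symm e)
  simp only [hL, lintegral_countable']
  have hmeas : ∀ h, AEMeasurable (fun ω => F ω h * M.blockLaw C m n (π t ω) {h}) μ := fun h =>
    (((hF h).mul (hlaw h)).mono hm le_rfl).aemeasurable
  rw [lintegral_tsum fun h => (((hF h).mono hm le_rfl).indicator (hsingle h)).aemeasurable,
    lintegral_tsum hmeas]
  refine tsum_congr fun h => ?_
  rw [lintegral_indicator (hsingle h), hpoint]

end Disintegration

/-! ### Measurability of the iterates in the past. -/

lemma PMF.measurable_expect {α Ω : Type*} [Countable α] {_ : MeasurableSpace Ω} {p : Ω → PMF α}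
    {f : Ω → α → ℝ} (hp : ∀ x, Measurable fun ω => p ω x) (hf : ∀ x, Measurable fun ω => f ω x) :
    Measurable fun ω => (p ω).expect (f ω) :=
  Measurable.tsum fun x => (hp x).ennreal_toReal.mul (hf x)

section LeastSquares

open Matrix Finset

variable {Z Ω : Type*} {d : ℕ} {φ : Z → Fin d → ℝ} {C : Finset Z} {wt : Z → ℝ}

/-- A minimiser `θ` need be neither unique nor measurable in `ω`; its predictions are determined by
the normal equations and linear in the targets. -/
lemma IsCoreset.measurable_dotProduct (hC : IsCoreset φ C wt) {_ : MeasurableSpace Ω}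
    {q : Ω → Z → ℝ} {θ : Ω → Fin d → ℝ} (hθ : ∀ ω, IsLeastSquares φ C wt (q ω) (θ ω))
    (hq : ∀ z ∈ C, Measurable fun ω => q ω z) (x : Z) : Measurable fun ω => θ ω ⬝ᵥ φ x := by
  obtain ⟨Gd, hG, -⟩ := hC.norm_le
  have h : ∀ ω, θ ω ⬝ᵥ φ x = ∑ z ∈ C, wt z * q ω z * ((Gd *ᵥ φ x) ⬝ᵥ φ z) := fun ω => by
    rw [← (hθ ω).normal_equation, ← dotProduct_gramMatrix_mulVec,
      gramMatrix_mul_pinv_mulVec hG hC.wt_nonneg (hC.mem_span x)]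
  simp only [h]
  exact Finset.measurable_sum _ fun z hz => ((hq z hz).const_mul _).mul_const _

end LeastSquares

namespace CMDP

open Finset MeasureTheory

variable {S A Ω : Type*} (M : CMDP S A) {d : ℕ} {φ : S × A → Fin d → ℝ}

lemma measurable_qHat {_ : MeasurableSpace Ω} {θ : Ω → Fin d → ℝ}
    (hθ : ∀ x, Measurable fun ω => θ ω ⬝ᵥ φ x) (s : S) (a : A) :
    Measurable fun ω => M.qHat φ (θ ω) s a :=
  measurable_const.max (measurable_const.min (hθ (s, a)))

lemma measurable_JcHat [Countable S] [Countable A] {_ : MeasurableSpace Ω} {θ : Ω → Fin d → ℝ}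
    {π : Ω → Policy S A} (hθ : ∀ x, Measurable fun ω => θ ω ⬝ᵥ φ x)
    (hπ : ∀ s a, Measurable fun ω => π ω s a) : Measurable fun ω => M.JcHat φ (θ ω) (π ω) :=
  PMF.measurable_expect (fun _ => measurable_const) fun s =>
    PMF.measurable_expect (hπ s) (M.measurable_qHat hθ s)

lemma measurable_advTilde [Countable A] {_ : MeasurableSpace Ω} {θr θc : Ω → Fin d → ℝ}
    {w : Ω → S → A → ℝ} {lam : Ω → ℝ} {π : Ω → Policy S A}
    (hθr : ∀ x, Measurable fun ω => θr ω ⬝ᵥ φ x) (hθc : ∀ x, Measurable fun ω => θc ω ⬝ᵥ φ x)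
    (hlam : Measurable lam) (hw : ∀ s a, Measurable fun ω => w ω s a)
    (hπ : ∀ s a, Measurable fun ω => π ω s a) (U : ℝ) (s : S) (a : A) :
    Measurable fun ω => M.advTilde φ U (θr ω) (θc ω) (lam ω) (w ω) (π ω) s a := by
  have hL : ∀ a, Measurable fun ω => M.qHat φ (θr ω) s a + lam ω * M.qHat φ (θc ω) s a :=
    fun a => (M.measurable_qHat hθr s a).add (hlam.mul (M.measurable_qHat hθc s a))
  have hA : Measurable fun ω => M.advHat φ U (θr ω) (θc ω) (lam ω) (π ω) s a :=
    ((hL a).sub (PMF.measurable_expect (hπ s) hL)).const_mul _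
  exact Measurable.ite (measurableSet_lt measurable_const (hw s a)) hA (hA.max measurable_const)

/-- The iterates of the algorithm depend measurably on the earlier estimates. -/
lemma IsCBPRun.measurable [Countable S] [Countable A] {C : Finset (S × A)} {wt : S × A → ℝ}
    {T : ℕ} {π₀ : Policy S A} {lam₀ : ℝ} {qr qc : Ω → ℕ → S × A → ℝ}
    {θr θc : ℕ → Ω → Fin d → ℝ} {w : ℕ → Ω → S → A → ℝ} {π : ℕ → Ω → Policy S A}
    {lam : ℕ → Ω → ℝ} (hC : IsCoreset φ C wt)
    (hrun : ∀ ω, M.IsCBPRun φ C wt T π₀ lam₀ (qr ω) (qc ω) (fun t => θr t ω) (fun t => θc t ω)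
      (fun t => w t ω) (fun t => π t ω) (fun t => lam t ω))
    {ℱ : ℕ → MeasurableSpace Ω} (hℱ : Monotone ℱ)
    (hqr : ∀ t < T, ∀ z ∈ C, Measurable[ℱ (t + 1)] fun ω => qr ω t z)
    (hqc : ∀ t < T, ∀ z ∈ C, Measurable[ℱ (t + 1)] fun ω => qc ω t z) {t : ℕ} (ht : t ≤ T) :
    (∀ s a, Measurable[ℱ t] fun ω => π t ω s a) ∧ (∀ s a, Measurable[ℱ t] fun ω => w t ω s a) ∧
      Measurable[ℱ t] (lam t) := by
  induction t using Nat.strong_induction_on with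
  | _ t ih =>
  rcases t with _ | t
  · refine ⟨fun s a => ?_, fun s a => ?_, ?_⟩
    · simp only [fun ω => (hrun ω).π_zero, measurable_const]
    · simp only [fun ω => (hrun ω).w_zero, measurable_const]
    · rw [funext fun ω => (hrun ω).lam_zero]
      exact measurable_const
  have htT : t < T := ht
  have hle : ∀ {i}, i ∈ range (t + 1) → i + 1 ≤ t + 1 := fun hi => mem_range.1 hi
  have hθr : ∀ i ∈ range (t + 1), ∀ x, Measurable[ℱ (t + 1)] fun ω => θr i ω ⬝ᵥ φ x :=
    fun i hi x => (hC.measurable_dotProduct (fun ω => (hrun ω).fit_r i ((hle hi).trans ht))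
      (hqr i ((hle hi).trans ht)) x).mono (hℱ (hle hi)) le_rfl
  have hθc : ∀ i ∈ range (t + 1), ∀ x, Measurable[ℱ (t + 1)] fun ω => θc i ω ⬝ᵥ φ x :=
    fun i hi x => (hC.measurable_dotProduct (fun ω => (hrun ω).fit_c i ((hle hi).trans ht))
      (hqc i ((hle hi).trans ht)) x).mono (hℱ (hle hi)) le_rfl
  have hπ : ∀ i ∈ range (t + 1), ∀ s a, Measurable[ℱ (t + 1)] fun ω => π i ω s a :=
    fun i hi s a => ((ih i (mem_range.1 hi) ((Nat.le_succ i).trans ((hle hi).trans ht))).1 s a).mono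
      (hℱ ((Nat.le_succ i).trans (hle hi))) le_rfl
  have hw : ∀ i ∈ range (t + 1), ∀ s a, Measurable[ℱ (t + 1)] fun ω => w i ω s a :=
    fun i hi s a =>
      ((ih i (mem_range.1 hi) ((Nat.le_succ i).trans ((hle hi).trans ht))).2.1 s a).mono
        (hℱ ((Nat.le_succ i).trans (hle hi))) le_rfl
  have hlam : ∀ i ∈ range (t + 1), Measurable[ℱ (t + 1)] (lam i) :=
    fun i hi => ((ih i (mem_range.1 hi) ((Nat.le_succ i).trans ((hle hi).trans ht))).2.2).mono
      (hℱ ((Nat.le_succ i).trans (hle hi))) le_rfl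
  have hadv : ∀ i ∈ range (t + 1), ∀ s a, Measurable[ℱ (t + 1)] fun ω =>
      M.advTilde φ M.dualBound (θr i ω) (θc i ω) (lam i ω) (w i ω) (π i ω) s a := fun i hi =>
    M.measurable_advTilde (hθr i hi) (hθc i hi) (hlam i hi) (hw i hi) (hπ i hi) _
  have hg : ∀ i ∈ range (t + 1), Measurable[ℱ (t + 1)] fun ω =>
      M.JcHat φ (θc i ω) (π i ω) - M.b := fun i hi =>
    (M.measurable_JcHat (hθc i hi) (hπ i hi)).sub_const _
  have hw' : ∀ s a, Measurable[ℱ (t + 1)] fun ω => w (t + 1) ω s a := by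
    intro s a
    simp only [fun ω => (hrun ω).w_succ t htT]
    exact ((Finset.measurable_sum _ fun i hi => hadv i hi s a).div_const _).mul
      (measurable_const.add
        (Finset.measurable_sum _ fun i hi => (hadv i hi s a).mul (hw i hi s a)))
  have hmass : ∀ s a, Measurable[ℱ (t + 1)] fun ω => π₀ s a * ENNReal.ofReal (w (t + 1) ω s a) :=
    fun s a => (hw' s a).ennreal_ofReal.const_mul _
  have hnorm : ∀ s, Measurable[ℱ (t + 1)] fun ω =>
      ∑' a, π₀ s a * ENNReal.ofReal (w (t + 1) ω s a) := fun s => by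
    let _ := ℱ (t + 1)
    exact Measurable.tsum (hmass s)
  refine ⟨fun s a => ?_, hw', ?_⟩
  · classical
    have h : (fun ω => π (t + 1) ω s a) = fun ω =>
        if ∑' a', π₀ s a' * ENNReal.ofReal (w (t + 1) ω s a') = 0 then π₀ s a else
          π₀ s a * ENNReal.ofReal (w (t + 1) ω s a)
            / ∑' a', π₀ s a' * ENNReal.ofReal (w (t + 1) ω s a') := by
      funext ω
      split_ifs with h0
      · rw [(hrun ω).π_succ_of_eq_zero t htT s h0]
      · exact (hrun ω).π_succ_of_ne_zero t htT s h0 a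
    rw [h]
    exact Measurable.ite (hnorm s (measurableSet_singleton 0)) measurable_const
      ((hmass s a).div (hnorm s))
  · let _ := ℱ (t + 1)
    rw [funext fun ω => (hrun ω).lam_succ t htT]
    refine measurable_const.max (measurable_const.min (measurable_const.sub (Measurable.mul ?_
      (measurable_const.sub (Finset.measurable_sum _ fun i hi =>
        ((hlam i hi).sub_const _).mul (hg i hi))))))
    refine measurable_const.mul (Measurable.sub_const (measurable_const.mul
      (continuous_sigmoid.measurable.comp (Measurable.div (measurable_const.mul
        (Finset.measurable_sum _ hg)) (measurable_const.add
          (Finset.measurable_sum _ fun i hi => (hg i hi).norm))))) _)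

lemma measurable_pathLaw {_ : MeasurableSpace Ω} {π : Ω → Policy S A}
    (hπ : ∀ s a, Measurable fun ω => π ω s a) (n : ℕ) (z : S × A) (h : Fin (n + 1) → S × A) :
    Measurable fun ω => M.pathLaw (π ω) n z h := by
  simp only [pathLaw_apply, prefixProb]
  exact Measurable.const_mul
    (Finset.measurable_prod _ fun k _ => Measurable.const_mul (hπ _ _) _) _

lemma measurable_qTrunc [Countable S] [Countable A] (f : S → A → ℝ) {_ : MeasurableSpace Ω} {π : Ω → Policy S A}
    (hπ : ∀ s a, Measurable fun ω => π ω s a) (n : ℕ) (z : S × A) :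
    Measurable fun ω => M.qTrunc f (π ω) n z :=
  PMF.measurable_expect (M.measurable_pathLaw hπ n z) fun _ => measurable_const

variable [Countable S] [MeasurableSpace S] [DiscreteMeasurableSpace S] [Countable A]
  [MeasurableSpace A] [DiscreteMeasurableSpace A] (f : S → A → ℝ)

lemma measurable_mcReturn {_ : MeasurableSpace Ω} {m : ℕ} {x : Ω → Fin m → ℕ → S × A}
    (hx : ∀ j k, Measurable fun ω => x ω j k) : Measurable fun ω => M.mcReturn f (x ω) :=
  measurable_const.mul (Finset.measurable_sum _ fun j _ => Measurable.tsum fun k =>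
    measurable_const.mul ((Measurable.of_discrete (f := fun z : S × A => f z.1 z.2)).comp (hx j k)))

end CMDP

/-! ### Exponential moments of the errors and the Chernoff bound over iterations. -/

section Dev

open Finset

variable {ι : Type*} [Fintype ι]

/-- A smooth proxy of the largest absolute value of a family of deviations. -/
def expDev (κ : ℝ) (x : ι → ℝ) : ℝ := ∑ u, (Real.exp (κ * x u) + Real.exp (-κ * x u))

lemma expDev_nonneg (κ : ℝ) (x : ι → ℝ) : 0 ≤ expDev κ x :=
  sum_nonneg fun _ _ => (add_pos (Real.exp_pos _) (Real.exp_pos _)).le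

lemma expDev_pos [Nonempty ι] (κ : ℝ) (x : ι → ℝ) : 0 < expDev κ x :=
  sum_pos (fun _ _ => add_pos (Real.exp_pos _) (Real.exp_pos _)) univ_nonempty

lemma expDev_le {κ e : ℝ} (hκ : 0 ≤ κ) {x y : ι → ℝ} (h : ∀ u, |x u - y u| ≤ e) :
    expDev κ x ≤ Real.exp (κ * e) * expDev κ y := by
  rw [expDev, expDev, mul_sum]
  refine sum_le_sum fun u _ => ?_
  obtain ⟨h1, h2⟩ := abs_le.1 (h u)
  rw [mul_add, ← Real.exp_add, ← Real.exp_add]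
  refine add_le_add (Real.exp_le_exp.2 ?_) (Real.exp_le_exp.2 ?_)
  · nlinarith
  · nlinarith

/-- The right side serves as the error level of one iteration; these levels add up to the logarithm
of a product. -/
lemma abs_le_log_expDev_div {κ : ℝ} (hκ : 0 < κ) (x : ι → ℝ) (u : ι) :
    |x u| ≤ Real.log (expDev κ x) / κ := by
  rw [le_div_iff₀ hκ, ← Real.log_exp (|x u| * κ)]
  refine Real.log_le_log (Real.exp_pos _) ?_
  have h1 : Real.exp (|x u| * κ) ≤ Real.exp (κ * x u) + Real.exp (-κ * x u) := by
    rcases abs_cases (x u) with ⟨h, -⟩ | ⟨h, -⟩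
    · rw [h, mul_comm]
      linarith [Real.exp_pos (-κ * x u)]
    · rw [h, neg_mul_comm, mul_comm (x u), neg_mul, ← mul_neg, mul_neg, ← neg_mul]
      linarith [Real.exp_pos (κ * x u)]
  exact h1.trans (single_le_sum
    (f := fun u => Real.exp (κ * x u) + Real.exp (-κ * x u))
    (fun _ _ => (add_pos (Real.exp_pos _) (Real.exp_pos _)).le) (mem_univ u))

end Dev

namespace CMDP

open MeasureTheory Finset

variable {S A : Type*} (M : CMDP S A)

/-- The reward and the constraint reward, as a family. -/
def signal (b : Bool) : S → A → ℝ := if b then M.r else M.c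

lemma signal_mem (b : Bool) (s : S) (a : A) : M.signal b s a ∈ Set.Icc (0 : ℝ) 1 := by
  cases b
  · exact M.c_mem s a
  · exact M.r_mem s a

/-- The deviations of the truncated Monte Carlo estimates from their means. -/
def truncDev (C : Finset (S × A)) {m : ℕ} (n : ℕ) (π : Policy S A)
    (h : C × Fin m → Fin (n + 1) → S × A) (u : C × Bool) : ℝ :=
  M.meanReturn (M.signal u.2) (fun j => h (u.1, j)) - M.qTrunc (M.signal u.2) π n u.1

/-- The deviations of the Monte Carlo estimates from the action values. -/
def mcDev (C : Finset (S × A)) {m : ℕ} (π : Policy S A) (x : S × A → Fin m → ℕ → S × A)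
    (u : C × Bool) : ℝ :=
  M.mcReturn (M.signal u.2) (x u.1) - M.qValue (M.signal u.2) π u.1

lemma measurable_expDev {Ω : Type*} [Countable S] [MeasurableSpace S]
    [DiscreteMeasurableSpace S] [Countable A] [MeasurableSpace A] [DiscreteMeasurableSpace A]
    {_ : MeasurableSpace Ω} {C : Finset (S × A)} {m : ℕ} {π : Ω → Policy S A}
    (hπ : ∀ s a, Measurable fun ω => π ω s a) (n : ℕ) (κ : ℝ)
    {h : Ω → C × Fin m → Fin (n + 1) → S × A} (hh : Measurable h) :
    Measurable fun ω => ENNReal.ofReal (expDev κ (M.truncDev C n (π ω) (h ω))) := by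
  have hd : ∀ u, Measurable fun ω => M.truncDev C n (π ω) (h ω) u := fun u =>
    ((Measurable.of_discrete (f := fun h : C × Fin m → Fin (n + 1) → S × A =>
      M.meanReturn (M.signal u.2) fun j => h (u.1, j))).comp hh).sub
        (M.measurable_qTrunc (M.signal u.2) hπ n u.1)
  exact (Finset.measurable_sum _ fun u _ => (((hd u).const_mul κ).exp).add
    (((hd u).const_mul (-κ)).exp)).ennreal_ofReal

lemma measurable_prod_expDev {Ω : Type*} [Countable S] [MeasurableSpace S]
    [DiscreteMeasurableSpace S] [Countable A] [MeasurableSpace A] [DiscreteMeasurableSpace A]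
    {C : Finset (S × A)} {m T : ℕ} {X : ℕ → S × A → Fin m → ℕ → Ω → S × A}
    {π : ℕ → Ω → Policy S A}
    (hπ : ∀ t ≤ T, ∀ s a, Measurable[pastTrajectories C X t] fun ω => π t ω s a) (n : ℕ) (κ : ℝ)
    {t : ℕ} (ht : t ≤ T) :
    Measurable[pastTrajectories C X t] fun ω => ∏ i ∈ range t,
      ENNReal.ofReal (expDev κ (M.truncDev C n (π i ω) (block C X i n ω))) := by
  let _ := pastTrajectories C X t
  refine Finset.measurable_prod _ fun i hi => ?_
  have hit := mem_range.1 hi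
  refine M.measurable_expDev (fun s a => (hπ i (hit.le.trans ht) s a).mono
    (pastTrajectories_mono C X hit.le) le_rfl) n κ ?_
  exact measurable_pi_lambda _ fun u => measurable_pi_lambda _ fun k =>
    measurable_pastTrajectories C X hit u.1.2 u.2 k

variable {Ω : Type*} [Countable S] [MeasurableSpace S] [DiscreteMeasurableSpace S]
  [Countable A] [MeasurableSpace A] [DiscreteMeasurableSpace A] [MeasurableSpace Ω]
  {μ : Measure Ω} {C : Finset (S × A)} {m T : ℕ}
  {X : ℕ → S × A → Fin m → ℕ → Ω → S × A} {π : ℕ → Ω → Policy S A}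

/-- There are `2 |C|` pairs of a coreset point and a signal, each with two signs, hence `4 |C|`
exponential moments. -/
lemma lintegral_expDev_le (C : Finset (S × A)) (hm : 1 ≤ m) (n : ℕ) (π : Policy S A) (κ : ℝ) :
    ∫⁻ h, ENNReal.ofReal (expDev κ (M.truncDev C n π h)) ∂(M.blockLaw C m n π)
      ≤ ENNReal.ofReal (4 * C.card * Real.exp (κ ^ 2 * M.horizon ^ 2 / (8 * m))) := by
  have h1 : ∀ h : C × Fin m → Fin (n + 1) → S × A,
      ENNReal.ofReal (expDev κ (M.truncDev C n π h))
        = ∑ u, (ENNReal.ofReal (Real.exp (κ * M.truncDev C n π h u))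
          + ENNReal.ofReal (Real.exp (-κ * M.truncDev C n π h u))) := fun h => by
    rw [expDev, ENNReal.ofReal_sum_of_nonneg
      fun _ _ => (add_pos (Real.exp_pos _) (Real.exp_pos _)).le]
    exact sum_congr rfl fun u _ =>
      ENNReal.ofReal_add (Real.exp_pos _).le (Real.exp_pos _).le
  simp only [h1]
  rw [lintegral_finsetSum _ fun _ _ => Measurable.of_discrete]
  have h2 : ∀ u : C × Bool, ∫⁻ h, (ENNReal.ofReal (Real.exp (κ * M.truncDev C n π h u))
      + ENNReal.ofReal (Real.exp (-κ * M.truncDev C n π h u))) ∂(M.blockLaw C m n π)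
      ≤ ENNReal.ofReal (2 * Real.exp (κ ^ 2 * M.horizon ^ 2 / (8 * m))) := fun u => by
    rw [lintegral_add_left Measurable.of_discrete, two_mul,
      ENNReal.ofReal_add (Real.exp_pos _).le (Real.exp_pos _).le]
    refine add_le_add (M.lintegral_exp_meanReturn_le (M.signal_mem u.2) C hm n π u.1 κ) ?_
    have := M.lintegral_exp_meanReturn_le (M.signal_mem u.2) C hm n π u.1 (-κ)
    rwa [neg_sq] at this
  refine (sum_le_sum fun u _ => h2 u).trans (le_of_eq ?_)
  rw [sum_const, card_univ, Fintype.card_prod, Fintype.card_coe, Fintype.card_bool,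
    ← ENNReal.ofReal_nsmul, nsmul_eq_mul]
  congr 1
  push_cast
  ring

/-- Given the past, the last factor has a mean bounded uniformly over policies, so `lintegral_block`
removes the factors one at a time. -/
lemma _root_.IsRollout.lintegral_prod_expDev_le [IsProbabilityMeasure μ]
    (hX : IsRollout μ M C T X π) (hm : 1 ≤ m) (n : ℕ)
    (hπ : ∀ t ≤ T, ∀ s a, Measurable[pastTrajectories C X t] fun ω => π t ω s a) (κ : ℝ)
    {t : ℕ} (ht : t ≤ T) :
    ∫⁻ ω, ∏ i ∈ range t,
        ENNReal.ofReal (expDev κ (M.truncDev C n (π i ω) (block C X i n ω))) ∂μ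
      ≤ ENNReal.ofReal (4 * C.card * Real.exp (κ ^ 2 * M.horizon ^ 2 / (8 * m))) ^ t := by
  induction t with
  | zero => simp
  | succ t ih =>
    have htT : t < T := ht
    have key := hX.lintegral_block htT n (hπ t htT.le)
      (F := fun ω h => (∏ i ∈ range t,
        ENNReal.ofReal (expDev κ (M.truncDev C n (π i ω) (block C X i n ω))))
          * ENNReal.ofReal (expDev κ (M.truncDev C n (π t ω) h)))
      fun h => (M.measurable_prod_expDev hπ n κ htT.le).mul
        (M.measurable_expDev (hπ t htT.le) n κ measurable_const)
    simp only [prod_range_succ]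
    rw [key]
    refine (lintegral_mono (g := fun ω => (∏ i ∈ range t,
      ENNReal.ofReal (expDev κ (M.truncDev C n (π i ω) (block C X i n ω))))
        * ENNReal.ofReal (4 * C.card * Real.exp (κ ^ 2 * M.horizon ^ 2 / (8 * m))))
      fun ω => ?_).trans ?_
    · beta_reduce
      rw [lintegral_const_mul _ Measurable.of_discrete]
      exact mul_le_mul_right (M.lintegral_expDev_le C hm n (π t ω) κ) _
    · rw [lintegral_mul_const' _ _ ENNReal.ofReal_ne_top, pow_succ]
      exact mul_le_mul_left (ih htT.le) _

/-- Chernoff bound for the sum over all iterations of the errors of the estimates. -/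
lemma _root_.IsRollout.measure_le_prod_expDev_le [IsProbabilityMeasure μ]
    (hX : IsRollout μ M C T X π) (hm : 1 ≤ m)
    (hπ : ∀ t ≤ T, ∀ s a, Measurable[pastTrajectories C X t] fun ω => π t ω s a) {κ a : ℝ}
    (hκ : 0 ≤ κ) (ha : 0 < a) :
    μ {ω | a ^ T ≤ ∏ t ∈ range T,
        expDev κ (M.mcDev C (π t ω) fun z j k => X t z j k ω)}
      ≤ ENNReal.ofReal ((4 * C.card * Real.exp (κ ^ 2 * M.horizon ^ 2 / (8 * m)) / a) ^ T) := by
  set c := 4 * C.card * Real.exp (κ ^ 2 * M.horizon ^ 2 / (8 * m)) with hc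
  have hc0 : 0 ≤ c := by positivity
  -- Only laws of finite prefixes are available. Truncating both the returns and the action values
  -- costs a factor that tends to `1` as `n → ∞`.
  have hbound : ∀ n : ℕ, μ {ω | a ^ T ≤ ∏ t ∈ range T,
        expDev κ (M.mcDev C (π t ω) fun z j k => X t z j k ω)}
      ≤ ENNReal.ofReal ((Real.exp (κ * (2 * (M.γ ^ (n + 1) * M.horizon))) * c / a) ^ T) := by
    intro n
    set e := Real.exp (κ * (2 * (M.γ ^ (n + 1) * M.horizon))) with he
    have he0 : 0 < e := Real.exp_pos _
    have hdev : ∀ t ω, expDev κ (M.mcDev C (π t ω) fun z j k => X t z j k ω)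
        ≤ e * expDev κ (M.truncDev C n (π t ω) (block C X t n ω)) := by
      intro t ω
      refine expDev_le hκ fun u => ?_
      have h1 := M.abs_mcReturn_sub_le (M.signal_mem u.2) hm (fun j k => X t u.1 j k ω) n
      have h2 := M.abs_qValue_sub_qTrunc_le (M.signal_mem u.2) (π t ω) n u.1
      have h3 : M.mcDev C (π t ω) (fun z j k => X t z j k ω) u
          - M.truncDev C n (π t ω) (block C X t n ω) u
          = (M.mcReturn (M.signal u.2) (fun j k => X t u.1 j k ω)
              - M.meanReturn (M.signal u.2) (fun j (k : Fin (n + 1)) => X t u.1 j k ω))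
            - (M.qValue (M.signal u.2) (π t ω) u.1 - M.qTrunc (M.signal u.2) (π t ω) n u.1) := by
        exact sub_sub_sub_comm _ _ _ _
      rw [h3, two_mul]
      exact (abs_sub _ _).trans (add_le_add h1 h2)
    have hlt := hX.lintegral_prod_expDev_le M hm n hπ κ le_rfl
    have hmk := meas_ge_le_lintegral_div (μ := μ) (f := fun ω => ∏ i ∈ range T,
        ENNReal.ofReal (expDev κ (M.truncDev C n (π i ω) (block C X i n ω))))
      ((M.measurable_prod_expDev hπ n κ le_rfl).mono
        (hX.pastTrajectories_le le_rfl) le_rfl).aemeasurable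
      (ε := ENNReal.ofReal ((a / e) ^ T)) (by simp; positivity) ENNReal.ofReal_ne_top
    refine (measure_mono fun ω hω => ?_).trans (hmk.trans ?_)
    · simp only [Set.mem_ofPred_eq] at hω ⊢
      rw [← ENNReal.ofReal_prod_of_nonneg fun _ _ => expDev_nonneg _ _]
      refine ENNReal.ofReal_le_ofReal ?_
      rw [div_pow, div_le_iff₀ (pow_pos he0 _)]
      refine hω.trans ((prod_le_prod (fun _ _ => expDev_nonneg _ _)
        fun t _ => hdev t ω).trans (le_of_eq ?_))
      rw [prod_mul_distrib, prod_const, card_range, mul_comm]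
    · refine (ENNReal.div_le_div_right hlt _).trans (le_of_eq ?_)
      rw [← ENNReal.ofReal_pow hc0, ← ENNReal.ofReal_div_of_pos (by positivity), ← div_pow]
      congr 2
      field_simp
  have h0 : Filter.Tendsto (fun n : ℕ => M.γ ^ (n + 1)) Filter.atTop (nhds 0) :=
    (tendsto_pow_atTop_nhds_zero_of_lt_one M.γ_nonneg M.γ_lt_one).comp
      (Filter.tendsto_add_atTop_nat 1)
  have h1 : Filter.Tendsto
      (fun x : ℝ => (Real.exp (κ * (2 * (x * M.horizon))) * c / a) ^ T) (nhds 0)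
      (nhds ((Real.exp (κ * (2 * (0 * M.horizon))) * c / a) ^ T)) :=
    Continuous.tendsto (by fun_prop) 0
  have h2 := h1.comp h0
  rw [zero_mul, mul_zero, mul_zero, Real.exp_zero, one_mul] at h2
  exact ge_of_tendsto' (ENNReal.tendsto_ofReal h2) hbound

end CMDP

namespace CMDP

open MeasureTheory Finset

variable {S A Ω : Type*} [Countable S] [MeasurableSpace S] [DiscreteMeasurableSpace S]
  [Countable A] [MeasurableSpace A] [DiscreteMeasurableSpace A] [MeasurableSpace Ω]
  {μ : Measure Ω} (M : CMDP S A) {C : Finset (S × A)} {m T : ℕ}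
  {X : ℕ → S × A → Fin m → ℕ → Ω → S × A} {π : ℕ → Ω → Policy S A}

/-- With high probability, the errors of the estimates at the points of the coreset are small on
average over the iterations. -/
lemma _root_.IsRollout.exists_error_bound [IsProbabilityMeasure μ] (hX : IsRollout μ M C T X π)
    (hm : 1 ≤ m) (hT : 1 ≤ T) (hC : C.Nonempty)
    (hπ : ∀ t ≤ T, ∀ s a, Measurable[pastTrajectories C X t] fun ω => π t ω s a) {N δ : ℝ}
    (hN : 4 * C.card ≤ N) (hδ : δ ∈ Set.Ioo (0 : ℝ) 1) :
    μ {ω | ¬ ∃ y : ℕ → ℝ,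
        (∀ t < T, ∀ b : Bool, ∀ z ∈ C, |M.mcReturn (M.signal b) (fun j k => X t z j k ω)
          - M.qValue (M.signal b) (π t ω) z| ≤ y t) ∧
        ∑ t ∈ range T, y t ≤ T * (M.horizon * √(Real.log (N / δ) / (2 * m)))}
      ≤ ENNReal.ofReal δ := by
  have hm0 : (0 : ℝ) < m := by exact_mod_cast hm
  have hG := M.horizon_pos
  have hcard : (1 : ℝ) ≤ C.card := by exact_mod_cast hC.card_pos
  have hN0 : 0 < N := by linarith
  set L := Real.log (N / δ) with hL
  have hL0 : 0 < L := Real.log_pos ((one_lt_div hδ.1).2 (by linarith [hδ.2]))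
  set η := M.horizon * √(L / (2 * m)) with hη
  have hη0 : 0 < η := mul_pos hG (Real.sqrt_pos.2 (by positivity))
  have hη2 : η ^ 2 = M.horizon ^ 2 * (L / (2 * m)) := by
    rw [hη, mul_pow, Real.sq_sqrt (by positivity)]
  -- Twice the cumulant bound is `κ η = 2L`, so each iteration contributes the ratio `4 |C| exp (-L)
  -- ≤ δ`.
  set κ := 4 * m * η / M.horizon ^ 2 with hκ
  have hκ0 : 0 < κ := by positivity
  have hκη : κ * η = 2 * L := by
    have : κ * η = 4 * m * η ^ 2 / M.horizon ^ 2 := by rw [hκ]; ring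
    rw [this, hη2]
    field_simp
    ring
  have hκG : κ ^ 2 * M.horizon ^ 2 / (8 * m) = L := by
    have : κ ^ 2 * M.horizon ^ 2 / (8 * m) = κ * η / 2 := by
      rw [hκ]; field_simp; ring
    rw [this, hκη, mul_div_cancel_left₀ _ two_ne_zero]
  have hchernoff := hX.measure_le_prod_expDev_le M hm hπ hκ0.le (Real.exp_pos (κ * η))
  have hratio : 4 * C.card * Real.exp (κ ^ 2 * M.horizon ^ 2 / (8 * m)) / Real.exp (κ * η) ≤ δ := by
    rw [hκG, hκη, mul_div_assoc, ← Real.exp_sub, show L - 2 * L = -L by ring, Real.exp_neg, hL,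
      Real.exp_log (div_pos hN0 hδ.1), inv_div, mul_div_assoc', div_le_iff₀ hN0, mul_comm δ]
    exact mul_le_mul_of_nonneg_right hN hδ.1.le
  refine (measure_mono fun ω hω => ?_).trans (hchernoff.trans (ENNReal.ofReal_le_ofReal ?_))
  · simp only [Set.mem_ofPred_eq] at hω ⊢
    by_contra hlt
    rw [not_le] at hlt
    obtain ⟨z₀, hz₀⟩ := hC
    have : Nonempty C := ⟨⟨z₀, hz₀⟩⟩
    set x := fun t => expDev κ (M.mcDev C (π t ω) fun z j k => X t z j k ω) with hx
    refine hω ⟨fun t => Real.log (x t) / κ, fun t _ b z hz => ?_, ?_⟩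
    · exact abs_le_log_expDev_div hκ0 (M.mcDev C (π t ω) fun z j k => X t z j k ω) (⟨z, hz⟩, b)
    · have hxpos : ∀ t, 0 < x t := fun t => expDev_pos κ _
      rw [← sum_div, div_le_iff₀ hκ0, ← Real.log_prod fun t _ => (hxpos t).ne']
      refine (Real.log_le_log (prod_pos fun t _ => hxpos t) hlt.le).trans (le_of_eq ?_)
      rw [Real.log_pow, Real.log_exp]
      ring
  · refine (pow_le_pow_left₀ (by positivity) hratio T).trans ?_
    -- The bound `δ ^ T` is even smaller than needed; this is why no union bound over iterations is
    -- paid.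
    exact pow_le_of_le_one hδ.1.le hδ.2.le (by omega)

end CMDP

end

theorem mainTheorem2 {S A Ω : Type*}
    [Countable S] [MeasurableSpace S] [DiscreteMeasurableSpace S]
    [Countable A] [MeasurableSpace A] [DiscreteMeasurableSpace A]
    [MeasurableSpace Ω] (μ : MeasureTheory.Measure Ω) [MeasureTheory.IsProbabilityMeasure μ]
    (M : CMDP S A) (hb : 0 ≤ M.b) (hζ : 0 < M.slater)
    (πstar : Policy S A) (hstar : M.IsOptimal πstar)
    {d : ℕ} (φ : S × A → Fin d → ℝ) (εb : ℝ) (hεb : 0 ≤ εb) (hφ : M.Realizable φ εb)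
    (C : Finset (S × A)) (wt : S × A → ℝ) (hC : IsCoreset φ C wt)
    (T m : ℕ) (hT : 1 ≤ T) (hm : 1 ≤ m) (δ : ℝ) (hδ : δ ∈ Set.Ioo (0 : ℝ) 1)
    (π₀ : Policy S A) (hKL : M.policyKL πstar π₀ ≠ ⊤)
    (lam₀ : ℝ) (hlam₀ : lam₀ ∈ Set.Icc 0 M.dualBound)
    (X : ℕ → S × A → Fin m → ℕ → Ω → S × A)
    (θr θc : ℕ → Ω → Fin d → ℝ) (w : ℕ → Ω → S → A → ℝ)
    (π : ℕ → Ω → Policy S A) (lam : ℕ → Ω → ℝ)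
    (hX : IsRollout μ M C T X π)
    (hrun : ∀ ω, M.IsCBPRun φ C wt T π₀ lam₀
      (fun t z => M.mcReturn M.r fun j k => X t z j k ω)
      (fun t z => M.mcReturn M.c fun j k => X t z j k ω)
      (fun t => θr t ω) (fun t => θc t ω) (fun t => w t ω) (fun t => π t ω)
      (fun t => lam t ω)) :
    μ {ω | ¬ (
      M.optGap πstar T (fun t => π t ω) ≤
          (3 * (1 + M.dualBound) * Real.sqrt (1 + (M.policyKL πstar π₀).toReal) / (1 - M.γ)
              + dualRegretConst M.dualBound T) / ((1 - M.γ) * Real.sqrt T)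
            + approxError εb d m M.γ δ * (2 + (1 + M.γ) * M.dualBound) / (1 - M.γ)
      ∧ M.consViol T (fun t => π t ω) ≤
          M.slater * (3 * (1 + M.dualBound) * Real.sqrt (1 + (M.policyKL πstar π₀).toReal)
              / (1 - M.γ) + dualRegretConst M.dualBound T) / Real.sqrt T
            + M.slater * approxError εb d m M.γ δ * (2 + 2 * M.dualBound))}
      ≤ ENNReal.ofReal δ := by
  have hCne : C.Nonempty := by
    rw [Finset.nonempty_iff_ne_empty]
    rintro rfl
    simpa using hC.wt_sum
  have hmc : ∀ f : S → A → ℝ, ∀ t < T, ∀ z ∈ C, @Measurable _ _ (pastTrajectories C X (t + 1)) _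
      fun ω => M.mcReturn f fun j k => X t z j k ω := fun f t _ z hz =>
    M.measurable_mcReturn f fun j k => measurable_pastTrajectories C X t.lt_succ_self hz j k
  have hπ : ∀ t ≤ T, ∀ s a, @Measurable _ _ (pastTrajectories C X t) _
      (fun ω => π t ω s a) := fun t ht =>
    (CMDP.IsCBPRun.measurable M hC hrun (fun _ _ => pastTrajectories_mono C X) (hmc M.r)
      (hmc M.c) ht).1
  have hcard : 4 * (C.card : ℝ) ≤ 2 * d * (d + 1) := by
    have h : 4 * C.card ≤ 2 * d * (d + 1) := by linarith [hC.card_le]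
    exact_mod_cast h
  refine (MeasureTheory.measure_mono fun ω hω => ?_).trans
    (hX.exists_error_bound M hm hT hCne hπ hcard hδ)
  rw [Set.mem_ofPred_eq] at hω ⊢
  rintro ⟨y, hy, hysum⟩
  refine hω ((hrun ω).optGap_consViol_le M hb hζ hstar hKL hlam₀ hT
    (ε := fun t => εb * (1 + Real.sqrt d) + Real.sqrt d * y t) ?_
    (fun t ht s a => M.abs_qHat_sub_le φ (M.qValue_mem M.r_mem _ _) ?_)
    (fun t ht s a => M.abs_qHat_sub_le φ (M.qValue_mem M.c_mem _ _) ?_))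
  · rw [Finset.sum_add_distrib, Finset.sum_const, ← Finset.mul_sum, Finset.card_range,
      nsmul_eq_mul]
    refine (add_le_add_right (mul_le_mul_of_nonneg_left hysum (Real.sqrt_nonneg _)) _).trans
      (le_of_eq ?_)
    rw [approxError, CMDP.horizon]
    ring
  · exact hC.abs_dotProduct_sub_le_of_iInf_le ((hrun ω).fit_r t ht) hεb (hφ (π t ω)).1
      (hy t ht true) (s, a)
  · exact hC.abs_dotProduct_sub_le_of_iInf_le ((hrun ω).fit_c t ht) hεb (hφ (π t ω)).2
      (hy t ht false) (s, a)
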